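/- **Setting.** Let $d\ge 1$ be an integer. A *smooth compact body* is a compact set $K\subset\mathbb R^{d+1}$ with non-empty interior such that for every $y\in\partial K$ there is a smooth $\varphi:\mathbb R^{d+1}\to\mathbb R$ with $\varphi(y)=0$, $\nabla\varphi(y)\neq 0$ and $K=\{\varphi\le 0\}$ in a neighbourhood of $y$. Put $\Sigma=\partial K$, let $n$ be the outward unit normal, and let $\mathcal H^d$ be the Hausdorff measure (normalized to agree with Lebesgue measure on $\mathbb R^d$); all Lebesgue norms on $\Sigma$ are with respect to $\mathcal H^d$. For $s\in(0,1)$ and a fixed normalizing constant $c_s\in\mathbb R\setminus\{0\}$ let $$H_{\Sigma,s}(x)=c_s\int_\Sigma\frac{\langle x-y,n(y)\rangle}{|x-y|^{d+1+s}}\,d\mathcal H^d(y),\qquad |A|_{\Sigma,s}(x)=|c_s|\int_\Sigma\frac{|\langle x-y,n(y)\rangle|}{|x-y|^{d+1+s}}\,d\mathcal H^d(y),$$ $$\mathcal W_{s,p}(\Sigma)=\int_\Sigma|H_{\Sigma,s}|^p\,d\mathcal H^d,\qquad \mathcal B_{s,p}(\Sigma)=\int_\Sigma|A|_{\Sigma,s}^p\,d\mathcal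 H^d .$$ For $q\in(1,\infty)$ and $f:\Sigma\to\mathbb R$ let $$[f]_{W^{\alpha,q}(\Sigma)}=\Big(\int_\Sigma\int_\Sigma\frac{|f(x)-f(y)|^q}{|x-y|^{d+\alpha q}}\,d\mathcal H^d(y)\,d\mathcal H^d(x)\Big)^{1/q}\quad(0<\alpha<1),\qquad [f]_{W^{1,q}(\Sigma)}=\|\nabla_\Sigma f\|_{L^q(\Sigma)},$$ where $\nabla_\Sigma f$ is the weak tangential gradient (defined through smooth local parametrizations of $\Sigma$; the seminorm is $\infty$ if there is none in $L^q$). $W^{\alpha,q}(\Sigma)$ is the set of $f\in L^q(\Sigma)$ with $[f]_{W^{\alpha,q}(\Sigma)}<\infty$. Finally $[f]_{C^\beta(\Sigma)}=\sup_{x\ne y\in\Sigma}|f(x)-f(y)|/|x-y|^\beta$. **Statement (weak Michael–Simon type inequality).** Let $d\ge1$, $s\in(0,1)$, $p>\frac ds$, $\Lambda>0$, $\alpha\in(0,1]$ and $q\in(1,\infty)$. Then there is a constant $C=C(p,d,s,\alpha,q,\Lambda)$ (which also depends on the normalization $c_s$) such that the following holds. Let $\Sigma=\partial K$ be the boundary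 of a smooth compact body $K\subset\mathbb R^{d+1}$ and assume that either $K$ is convex and $\mathcal W_{s,p}(\Sigma)\le\Lambda$, or (without convexity) $\mathcal B_{s,p}(\Sigma)\le\Lambda$. Let $f\in W^{\alpha,q}(\Sigma)$. 1. If $q<\frac d\alpha$, then $$\|f\|_{L^{\frac{dq}{d-\alpha q}}(\Sigma)}\le C\big([f]_{W^{\alpha,q}(\Sigma)}+\|f\|_{L^q(\Sigma)}\big).$$ 2. If $\alpha-\frac dq=\beta$ for some $\beta\in(0,\alpha)$, then $f$ agrees $\mathcal H^d$-almost everywhere on $\Sigma$ with a continuous function, again denoted by $f$, such that $$\|f\|_{L^\infty(\Sigma)}+[f]_{C^\beta(\Sigma)}\le C\big([f]_{W^{\alpha,q}(\Sigma)}+\|f\|_{L^q(\Sigma)}\big).$$ -/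

import Mathlib

open MeasureTheory Set Filter Topology
open scoped NNReal ENNReal ContDiff RealInnerProductSpace Gradient

noncomputable section

namespace FracWillmore

/-- The Euclidean space of dimension `n`. -/
abbrev E (n : ℕ) : Type := EuclideanSpace ℝ (Fin n)

variable {d : ℕ}

/-- `φ` is a smooth defining function of `K` near the boundary point `y`: `φ` vanishes at `y`,
has non-zero gradient there, and `K` coincides with `{φ ≤ 0}` in a neighbourhood of `y`. -/
def IsDefiningFunctionAt (K : Set (E (d + 1))) (y : E (d + 1)) (φ : E (d + 1) → ℝ) : Prop :=
  ContDiff ℝ ∞ φ ∧ φ y = 0 ∧ ∇ φ y ≠ 0 ∧ ∀ᶠ z in 𝓝 y, (z ∈ K ↔ φ z ≤ 0)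

/-- A compact body with smooth boundary: a compact set with non-empty interior which near each of
its boundary points is the sublevel set of a smooth function with non-zero gradient. Neither
connectedness nor convexity is required. -/
def IsSmoothBody (K : Set (E (d + 1))) : Prop :=
  IsCompact K ∧ (interior K).Nonempty ∧ ∀ y ∈ frontier K, ∃ φ, IsDefiningFunctionAt K y φ

/-- `ν` is the outward pointing unit normal of `K` at the boundary point `y`. -/
def IsOuterUnitNormal (K : Set (E (d + 1))) (y ν : E (d + 1)) : Prop :=
  ∃ φ, IsDefiningFunctionAt K y φ ∧ ν = ‖∇ φ y‖⁻¹ • ∇ φ y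

/-- A function that vanishes at `y` is negative just after `y` in any direction that has negative
inner product with the gradient. -/
theorem eventually_neg_of_inner_neg {φ : E (d + 1) → ℝ} {y v : E (d + 1)}
    (hφ : ContDiff ℝ ∞ φ) (h0 : φ y = 0) (hv : ⟪∇ φ y, v⟫ < 0) :
    ∀ᶠ t : ℝ in 𝓝[>] 0, φ (y + t • v) < 0 := by
  have hd : HasDerivAt (fun t : ℝ => φ (y + t • v)) ⟪∇ φ y, v⟫ 0 := by
    have h1 : HasFDerivAt φ (fderiv ℝ φ y) (y + (0 : ℝ) • v) := by
      simpa using (hφ.differentiable (by simp) y).hasFDerivAt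
    have h2 : HasDerivAt (fun t : ℝ => y + t • v) v 0 := by
      simpa using ((hasDerivAt_id (0 : ℝ)).smul_const v).const_add y
    have h3 := h1.comp_hasDerivAt (0 : ℝ) h2
    rwa [← inner_gradient_left] at h3
  have hs := (hasDerivAt_iff_tendsto_slope.1 hd).eventually (gt_mem_nhds hv)
  have hle : 𝓝[>] (0 : ℝ) ≤ 𝓝[≠] 0 := nhdsWithin_mono _ (fun t ht => ne_of_gt ht)
  filter_upwards [hs.filter_mono hle, self_mem_nhdsWithin] with t ht htpos
  have htpos' : (0 : ℝ) < t := htpos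
  simp only [slope_def_field, zero_smul, add_zero, h0, sub_zero] at ht
  rcases div_neg_iff.1 ht with h | h
  · linarith [h.2]
  · exact h.1

/-- The outward unit normal is unique. -/
theorem IsOuterUnitNormal.unique {K : Set (E (d + 1))} {y ν ν' : E (d + 1)}
    (h : IsOuterUnitNormal K y ν) (h' : IsOuterUnitNormal K y ν') : ν = ν' := by
  obtain ⟨φ, ⟨hφ, hφ0, hφg, hφK⟩, hν⟩ := h
  obtain ⟨ψ, ⟨hψ, hψ0, hψg, hψK⟩, hν'⟩ := h'
  by_contra hne
  have n1 : ‖ν‖ = 1 := by rw [hν]; exact norm_smul_inv_norm (𝕜 := ℝ) hφg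
  have n2 : ‖ν'‖ = 1 := by rw [hν']; exact norm_smul_inv_norm (𝕜 := ℝ) hψg
  have hlt : ⟪ν, ν'⟫ < 1 := inner_lt_one_iff_real_of_norm_eq_one n1 n2 |>.2 hne
  have eφ : ∇ φ y = ‖∇ φ y‖ • ν := by
    rw [hν, smul_smul, mul_inv_cancel₀ (norm_ne_zero_iff.2 hφg), one_smul]
  have eψ : ∇ ψ y = ‖∇ ψ y‖ • ν' := by
    rw [hν', smul_smul, mul_inv_cancel₀ (norm_ne_zero_iff.2 hψg), one_smul]
  have hg : ∇ (fun z => -ψ z) y = -∇ ψ y := by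
    simp [gradient, fderiv_fun_neg]
  have i1 : ⟪∇ φ y, ν' - ν⟫ < 0 := by
    rw [eφ, real_inner_smul_left, inner_sub_right, real_inner_self_eq_norm_sq, n1]
    have := norm_pos_iff.2 hφg
    nlinarith
  have i2 : ⟪∇ (fun z => -ψ z) y, ν' - ν⟫ < 0 := by
    rw [hg, eψ, inner_neg_left, real_inner_smul_left, inner_sub_right,
      real_inner_self_eq_norm_sq, n2, real_inner_comm]
    have := norm_pos_iff.2 hψg
    nlinarith
  have t1 := eventually_neg_of_inner_neg hφ hφ0 i1
  have t2 := eventually_neg_of_inner_neg (φ := fun z => -ψ z) hψ.neg (by simp [hψ0]) i2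
  have hc : Tendsto (fun t : ℝ => y + t • (ν' - ν)) (𝓝[>] 0) (𝓝 y) := by
    have : Continuous (fun t : ℝ => y + t • (ν' - ν)) := by fun_prop
    have h0 := this.tendsto 0
    simp only [zero_smul, add_zero] at h0
    exact h0.mono_left nhdsWithin_le_nhds
  obtain ⟨t, a1, a2, a3, a4⟩ :=
    (t1.and (t2.and ((hc.eventually hφK).and (hc.eventually hψK)))).exists
  have : ψ (y + t • (ν' - ν)) ≤ 0 := a4.1 (a3.2 a1.le)
  linarith

open Classical in
/-- The outward unit normal `n(y)` of `K` at `y`, with value `0` where there is none. -/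
def outerUnitNormal (K : Set (E (d + 1))) (y : E (d + 1)) : E (d + 1) :=
  if h : ∃ ν, IsOuterUnitNormal K y ν then h.choose else 0

theorem IsOuterUnitNormal.eq_outerUnitNormal {K : Set (E (d + 1))} {y ν : E (d + 1)}
    (h : IsOuterUnitNormal K y ν) : outerUnitNormal K y = ν := by
  have hex : ∃ ν, IsOuterUnitNormal K y ν := ⟨ν, h⟩
  rw [outerUnitNormal, dif_pos hex]
  exact hex.choose_spec.unique h

/-- The surface measure on `Σ = ∂K`: the `d`-dimensional Hausdorff measure, normalized so that it
agrees with Lebesgue measure on `ℝ^d`, restricted to `Σ`. -/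
def surfaceMeasure (K : Set (E (d + 1))) : Measure (E (d + 1)) :=
  (μHE[d] : Measure (E (d + 1))).restrict (frontier K)

/-- The kernel `⟨x - y, n(y)⟩ / |x - y|^(d+1+s)`. -/
def curvatureKernel (K : Set (E (d + 1))) (s : ℝ) (x y : E (d + 1)) : ℝ :=
  ⟪x - y, outerUnitNormal K y⟫ / ‖x - y‖ ^ ((d : ℝ) + 1 + s)

/-- The fractional mean curvature `H_{Σ,s}(x)`, with normalizing constant `c`. -/
def fracMeanCurvature (c s : ℝ) (K : Set (E (d + 1))) (x : E (d + 1)) : ℝ :=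
  c * ∫ y, curvatureKernel K s x y ∂(surfaceMeasure K)

/-- The nonlocal curvature `|A|_{Σ,s}(x)`, with normalizing constant `c`. -/
def fracAbsCurvature (c s : ℝ) (K : Set (E (d + 1))) (x : E (d + 1)) : ℝ≥0∞ :=
  ‖c‖ₑ * ∫⁻ y, ‖curvatureKernel K s x y‖ₑ ∂(surfaceMeasure K)

/-- The fractional Willmore energy `W_{s,p}(Σ)`. -/
def willmoreEnergy (c s p : ℝ) (K : Set (E (d + 1))) : ℝ≥0∞ :=
  ∫⁻ x, ‖fracMeanCurvature c s K x‖ₑ ^ p ∂(surfaceMeasure K)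

/-- The nonlocal bending energy `B_{s,p}(Σ)`. -/
def bendingEnergy (c s p : ℝ) (K : Set (E (d + 1))) : ℝ≥0∞ :=
  ∫⁻ x, fracAbsCurvature c s K x ^ p ∂(surfaceMeasure K)

/-- `Φ : U → Σ = ∂K` is a smooth local parametrization: a smooth injective immersion of an open
subset `U` of `ℝ^d` into `Σ`. -/
def IsLocalParametrization (K : Set (E (d + 1))) (U : Set (E d)) (Φ : E d → E (d + 1)) : Prop :=
  IsOpen U ∧ ContDiffOn ℝ ∞ Φ U ∧ InjOn Φ U ∧ MapsTo Φ U (frontier K) ∧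
    ∀ x ∈ U, Function.Injective (fderiv ℝ Φ x)

/-- The vector field `g ∈ L^q(Σ)` is the weak tangential gradient of `f` on `Σ = ∂K`: it is
tangential, and in each local parametrization `Φ : U → Σ` the function `f ∘ Φ` has the weak
directional derivatives `v ↦ ⟨g ∘ Φ, DΦ v⟩`. -/
def HasWeakGradient (K : Set (E (d + 1))) (q : ℝ) (f : E (d + 1) → ℝ)
    (g : E (d + 1) → E (d + 1)) : Prop :=
  MemLp g (ENNReal.ofReal q) (surfaceMeasure K) ∧
  (∀ᵐ y ∂(surfaceMeasure K), ⟪g y, outerUnitNormal K y⟫ = 0) ∧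
  ∀ (U : Set (E d)) (Φ : E d → E (d + 1)), IsLocalParametrization K U Φ →
    ∀ ψ : E d → ℝ, ContDiff ℝ ∞ ψ → HasCompactSupport ψ → tsupport ψ ⊆ U → ∀ v : E d,
      ∫ x in U, f (Φ x) * fderiv ℝ ψ x v = -∫ x in U, ⟪g (Φ x), fderiv ℝ Φ x v⟫ * ψ x

/-- The Gagliardo seminorm
`(∫_Σ ∫_Σ |f(x) - f(y)|^q / |x - y|^(d + α q))^(1/q)` on `Σ = ∂K`. -/
def gagliardoSeminorm (K : Set (E (d + 1))) (α q : ℝ) (f : E (d + 1) → ℝ) : ℝ≥0∞ :=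
  (∫⁻ x, ∫⁻ y, ‖f x - f y‖ₑ ^ q / ‖x - y‖ₑ ^ ((d : ℝ) + α * q)
    ∂(surfaceMeasure K) ∂(surfaceMeasure K)) ^ (1 / q)

/-- The `L^q(Σ)` norm of the (a.e. unique) weak gradient of `f`, and `∞` if there is no weak
gradient in `L^q(Σ)`. -/
def gradientSeminorm (K : Set (E (d + 1))) (q : ℝ) (f : E (d + 1) → ℝ) : ℝ≥0∞ :=
  ⨅ (g : E (d + 1) → E (d + 1)) (_ : HasWeakGradient K q f g),
    eLpNorm g (ENNReal.ofReal q) (surfaceMeasure K)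

open Classical in
/-- The seminorm `[f]_{W^{α,q}(Σ)}` for `α ∈ (0,1]`: the Gagliardo seminorm if `α < 1`, the `L^q`
norm of the weak gradient if `α = 1`. -/
def sobolevSeminorm (K : Set (E (d + 1))) (α q : ℝ) (f : E (d + 1) → ℝ) : ℝ≥0∞ :=
  if α = 1 then gradientSeminorm K q f else gagliardoSeminorm K α q f

/-- `f ∈ W^{α,q}(Σ)`, `Σ = ∂K`. -/
def MemSobolev (K : Set (E (d + 1))) (α q : ℝ) (f : E (d + 1) → ℝ) : Prop :=
  MemLp f (ENNReal.ofReal q) (surfaceMeasure K) ∧ sobolevSeminorm K α q f < ⊤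

/-- The right-hand side `[f]_{W^{α,q}(Σ)} + ‖f‖_{L^q(Σ)}`. -/
def sobolevNorm (K : Set (E (d + 1))) (α q : ℝ) (f : E (d + 1) → ℝ) : ℝ≥0∞ :=
  sobolevSeminorm K α q f + eLpNorm f (ENNReal.ofReal q) (surfaceMeasure K)

/-- The Hölder seminorm `[f]_{C^β(Σ)} = sup |f(x) - f(y)| / |x - y|^β` over distinct points of
`Σ = ∂K`. -/
def holderSeminorm (K : Set (E (d + 1))) (β : ℝ) (f : E (d + 1) → ℝ) : ℝ≥0∞ :=
  ⨆ (x ∈ frontier K) (y ∈ frontier K) (_ : x ≠ y), ‖f x - f y‖ₑ / ‖x - y‖ₑ ^ β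

end FracWillmore

end

open MeasureTheory Set Filter Topology
open scoped NNReal ENNReal ContDiff RealInnerProductSpace Gradient

noncomputable section

namespace FracWillmore

variable {d : ℕ}

/-! ### Defining functions, the unit normal, and its non-quantitative regularity -/

section Normal

variable {K : Set (E (d + 1))} {y v : E (d + 1)} {φ : E (d + 1) → ℝ}

/-! The energy bound is used for one geometric fact only: near each of its points, Σ is a graph with
controlled slope over a ball whose radius depends on the parameters and Λ but not on K
(`exists_hasUniformCharts`). The rest is Sobolev theory on sets with such charts. If K is convex,
the kernel has constant sign on Σ, so |H| = |A| there and the Willmore hypothesis becomes the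
bending hypothesis (`IsSmoothBody.willmoreEnergy_eq_bendingEnergy`).

Uniform charts. Call a point of B_ρ(x) shadowed if the segment from x to it meets Σ after leaving x.
Cone coordinates over Σ bound the volume of the shadow by 2ρ^(d+1+s) ∫ |kernel|
(`IsSmoothBody.volume_shadow_le`), and off the shadow K agrees in B_ρ(x) with the inner tangent
half-space at x, up to the tangent plane. If the shadows of two boundary points at distance about ρ
are together too small to contain a δ-ball, the two half-spaces cannot disagree on a δ-ball, so the
normals differ by at most about δ/ρ and each point lies within about δ of the other's tangent plane
(`IsSmoothBody.halfspace_comparison`). Small curvature is not known at every point, but Chebyshev's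
inequality finds, within κρ of a given point, one with |A| ≲ ρ^(-d/p). There the shadow at scale ρ
has volume ≲ ρ^(d+1+s-d/p) = ρ^((d+1)(1+γ)) with γ = (s - d/p)/(d+1), which is positive exactly
because p > d/s; hence δ ~ ρ^(1+γ), a Hölder bound for the normal.

Chebyshev needs a lower bound for the surface measure of small balls, which in turn follows from
charts at a smaller scale. The Hölder bound is therefore propagated from scale R to 2R with the same
constant (`NormalHolder.double`). Smoothness of K starts the induction at some scale depending on K;
only the number of doublings depends on K, not the final scale (`exists_uniform_isGraphChart`).

Sobolev theory. Charts give surface measure at least c r^d to small balls. For α < 1 this suffices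
for the Sobolev inequality: compare f(x) with its values on B_r(x), optimize over r pointwise,
integrate and absorb (`fractional_sobolev`). For α = 1 the Gagliardo–Nirenberg–Sobolev inequality is
applied in charts to mollifications, and the local bounds are integrated over all centres
(`sobolev_of_hasWeakGradient`). Above the critical exponent both cases reduce to a Campanato
condition on oscillations over balls, which holds trivially for the Gagliardo seminorm
(`oscillationBound_of_gagliardo`) and by Poincaré's inequality in charts for the gradient
(`oscillationBound_of_hasWeakGradient`); then `exists_holder_bound` gives Hölder continuity. -/

theorem inner_gradient_eq (φ : E (d + 1) → ℝ) (y v : E (d + 1)) :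
    ⟪∇ φ y, v⟫ = fderiv ℝ φ y v := inner_gradient_left

theorem IsDefiningFunctionAt.isOuterUnitNormal (h : IsDefiningFunctionAt K y φ) :
    outerUnitNormal K y = ‖∇ φ y‖⁻¹ • ∇ φ y :=
  IsOuterUnitNormal.eq_outerUnitNormal ⟨φ, h, rfl⟩

theorem continuous_gradient (hφ : ContDiff ℝ ∞ φ) : Continuous (∇ φ) := by
  unfold gradient
  exact (InnerProductSpace.toDual ℝ (E (d + 1))).symm.continuous.comp
    (hφ.continuous_fderiv (by simp))

theorem contDiff_gradient (hφ : ContDiff ℝ ∞ φ) : ContDiff ℝ 1 (∇ φ) := by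
  unfold gradient
  exact (InnerProductSpace.toDual ℝ (E (d + 1))).symm.contDiff.comp
    ((contDiff_infty_iff_fderiv.1 hφ).2.of_le (by simp))

/-- A defining function at `y` is a defining function at all nearby boundary points. -/
theorem IsDefiningFunctionAt.eventually (hK : IsClosed K) (h : IsDefiningFunctionAt K y φ) :
    ∀ᶠ z in 𝓝 y, z ∈ frontier K → IsDefiningFunctionAt K z φ := by
  obtain ⟨hφ, h0, hg, hloc⟩ := h
  have hg' : ∀ᶠ z in 𝓝 y, ∇ φ z ≠ 0 := (continuous_gradient hφ).continuousAt.eventually_ne hg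
  filter_upwards [hloc.eventually_nhds, hg'] with z hz hgz hzK
  refine ⟨hφ, ?_, hgz, hz⟩
  have hzmem : z ∈ K := hK.frontier_subset hzK
  refine le_antisymm (hz.self_of_nhds.1 hzmem) ?_
  by_contra! hlt
  have : ∀ᶠ w in 𝓝 z, w ∈ K := by
    filter_upwards [hz, hφ.continuous.continuousAt.eventually_lt_const hlt] with w hw hw'
    exact hw.2 hw'.le
  exact hzK.2 (mem_interior_iff_mem_nhds.2 this)

theorem IsDefiningFunctionAt.norm_outerUnitNormal (h : IsDefiningFunctionAt K y φ) :
    ‖outerUnitNormal K y‖ = 1 := by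
  rw [h.isOuterUnitNormal]; exact norm_smul_inv_norm (𝕜 := ℝ) h.2.2.1

theorem IsDefiningFunctionAt.inner_outerUnitNormal (h : IsDefiningFunctionAt K y φ)
    (v : E (d + 1)) : ⟪outerUnitNormal K y, v⟫ = ‖∇ φ y‖⁻¹ * fderiv ℝ φ y v := by
  rw [h.isOuterUnitNormal, real_inner_smul_left, inner_gradient_eq]

theorem IsSmoothBody.norm_outerUnitNormal (hK : IsSmoothBody K) (hy : y ∈ frontier K) :
    ‖outerUnitNormal K y‖ = 1 := by
  obtain ⟨φ, h⟩ := hK.2.2 y hy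
  exact h.norm_outerUnitNormal

theorem IsSmoothBody.isCompact_frontier (hK : IsSmoothBody K) : IsCompact (frontier K) :=
  hK.1.of_isClosed_subset isClosed_frontier hK.1.isClosed.frontier_subset

theorem IsSmoothBody.eventually_mem_interior (hK : IsSmoothBody K) (hy : y ∈ frontier K)
    (hv : ⟪outerUnitNormal K y, v⟫ < 0) :
    ∀ᶠ t : ℝ in 𝓝[>] 0, y + t • v ∈ interior K := by
  obtain ⟨φ, h⟩ := hK.2.2 y hy
  have hpos : 0 < ‖∇ φ y‖ := norm_pos_iff.2 h.2.2.1
  have hv' : ⟪∇ φ y, v⟫ < 0 := by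
    rw [h.isOuterUnitNormal, real_inner_smul_left] at hv
    by_contra! hcon
    have := mul_nonneg (inv_nonneg.2 hpos.le) hcon
    linarith
  have hc : Tendsto (fun t : ℝ => y + t • v) (𝓝[>] 0) (𝓝 y) := by
    have : Continuous (fun t : ℝ => y + t • v) := by fun_prop
    have h0 := this.tendsto 0
    simp only [zero_smul, add_zero] at h0
    exact h0.mono_left nhdsWithin_le_nhds
  filter_upwards [eventually_neg_of_inner_neg h.1 h.2.1 hv',
    hc.eventually h.2.2.2.eventually_nhds] with t ht ht'
  rw [mem_interior_iff_mem_nhds]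
  filter_upwards [ht', h.1.continuous.continuousAt.eventually_lt_const ht] with w hw hw'
  exact hw.2 hw'.le

theorem IsSmoothBody.eventually_notMem (hK : IsSmoothBody K) (hy : y ∈ frontier K)
    (hv : 0 < ⟪outerUnitNormal K y, v⟫) :
    ∀ᶠ t : ℝ in 𝓝[>] 0, y + t • v ∉ K := by
  obtain ⟨φ, h⟩ := hK.2.2 y hy
  have hpos : 0 < ‖∇ φ y‖ := norm_pos_iff.2 h.2.2.1
  have hv' : ⟪∇ (fun z => -φ z) y, v⟫ < 0 := by
    have hg : ∇ (fun z => -φ z) y = -∇ φ y := by simp [gradient, fderiv_fun_neg]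
    rw [hg, inner_neg_left]
    rw [h.isOuterUnitNormal, real_inner_smul_left] at hv
    have := (mul_pos_iff_of_pos_left (inv_pos.2 hpos)).1 hv
    linarith
  have hc : Tendsto (fun t : ℝ => y + t • v) (𝓝[>] 0) (𝓝 y) := by
    have : Continuous (fun t : ℝ => y + t • v) := by fun_prop
    have h0 := this.tendsto 0
    simp only [zero_smul, add_zero] at h0
    exact h0.mono_left nhdsWithin_le_nhds
  filter_upwards [eventually_neg_of_inner_neg (φ := fun z => -φ z) h.1.neg (by simp [h.2.1]) hv',
    hc.eventually h.2.2.2] with t ht ht' hmem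
  have := ht'.1 hmem
  linarith

/-- Local Lipschitz bound for the normal and quadratic bound for the distance to the tangent
plane. -/
theorem IsSmoothBody.local_quadratic (hK : IsSmoothBody K) (hy : y ∈ frontier K) :
    ∃ L r : ℝ, 0 < r ∧ ∀ x ∈ frontier K ∩ Metric.ball y r, ∀ z ∈ frontier K ∩ Metric.ball y r,
      ‖outerUnitNormal K x - outerUnitNormal K z‖ ≤ L * ‖x - z‖ ∧
        |⟪x - z, outerUnitNormal K z⟫| ≤ L * ‖x - z‖ ^ 2 := by
  obtain ⟨φ, h⟩ := hK.2.2 y hy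
  have hpos : 0 < ‖∇ φ y‖ := norm_pos_iff.2 h.2.2.1
  have hN : ContDiffAt ℝ 1 (fun z => ‖∇ φ z‖⁻¹ • ∇ φ z) y := by
    have h1 := (contDiff_gradient h.1).contDiffAt (x := y)
    exact ((h1.norm ℝ h.2.2.1).inv hpos.ne').smul h1
  obtain ⟨L1, t1, ht1, hL1⟩ := hN.exists_lipschitzOnWith
  have hD : ContDiffAt ℝ 1 (fderiv ℝ φ) y :=
    ((contDiff_infty_iff_fderiv.1 h.1).2.of_le (by simp)).contDiffAt
  obtain ⟨L2, t2, ht2, hL2⟩ := hD.exists_lipschitzOnWith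
  have hgb : ∀ᶠ z in 𝓝 y, ‖∇ φ y‖ / 2 < ‖∇ φ z‖ :=
    (continuous_gradient h.1).norm.continuousAt.eventually_const_lt (by linarith)
  obtain ⟨r, hr, hball⟩ := Metric.eventually_nhds_iff_ball.1
    ((h.eventually hK.1.isClosed).and ((eventually_mem_set.2 ht1).and
      ((eventually_mem_set.2 ht2).and hgb)))
  -- `L1` controls the normalized gradient. The other entry is the second-order remainder of φ
  -- divided by |∇φ(z)|, which exceeds half of |∇φ(y)| on the ball.
  refine ⟨max L1 (2 / ‖∇ φ y‖ * L2), r, hr, fun x hx z hz => ?_⟩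
  obtain ⟨dx, x1, x2, -⟩ := hball x hx.2
  obtain ⟨dz, z1, z2, z3⟩ := hball z hz.2
  have dx := dx hx.1
  have dz := dz hz.1
  constructor
  · rw [dx.isOuterUnitNormal, dz.isOuterUnitNormal]
    have := hL1.dist_le_mul x x1 z z1
    rw [dist_eq_norm, dist_eq_norm] at this
    exact this.trans (by gcongr; exact le_max_left _ _)
  · rw [real_inner_comm, dz.inner_outerUnitNormal, abs_mul, abs_of_nonneg (by positivity)]
    have hseg : segment ℝ z x ⊆ Metric.ball y r := (convex_ball y r).segment_subset hz.2 hx.2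
    -- Mean value inequality with the linear part at z subtracted: φ vanishes at both endpoints, so
    -- only Dφ(z)(x - z) survives on the left.
    have key := (convex_segment z x).norm_image_sub_le_of_norm_hasFDerivWithin_le'
      (f := φ) (f' := fderiv ℝ φ) (φ := fderiv ℝ φ z) (C := L2 * ‖x - z‖)
      (fun w _ => ((h.1.differentiable (by simp)) w).hasFDerivAt.hasFDerivWithinAt)
      (fun w hw => by
        have := hL2.dist_le_mul w (hball w (hseg hw)).2.2.1 z z2
        rw [dist_eq_norm, dist_eq_norm] at this
        refine this.trans ?_
        gcongr
        obtain ⟨a, b, ha, hb, hab, rfl⟩ := hw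
        have : a • z + b • x - z = b • (x - z) := by
          rw [← eq_sub_iff_add_eq] at hab; subst hab; module
        rw [this, norm_smul, Real.norm_of_nonneg hb]
        exact mul_le_of_le_one_left (norm_nonneg _) (by linarith))
      (left_mem_segment ℝ z x) (right_mem_segment ℝ z x)
    rw [dx.2.1, dz.2.1, sub_zero, zero_sub, norm_neg, Real.norm_eq_abs] at key
    have hi : ‖∇ φ z‖⁻¹ ≤ 2 / ‖∇ φ y‖ := by
      rw [← one_div, div_le_div_iff₀ (by linarith) hpos]; linarith
    calc ‖∇ φ z‖⁻¹ * |fderiv ℝ φ z (x - z)|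
        ≤ 2 / ‖∇ φ y‖ * (L2 * ‖x - z‖ * ‖x - z‖) := by gcongr
      _ = 2 / ‖∇ φ y‖ * L2 * ‖x - z‖ ^ 2 := by ring
      _ ≤ _ := by gcongr; exact le_max_right _ _

/-- Uniform Lipschitz bound for the normal and quadratic bound for the distance to the tangent
plane. -/
theorem IsSmoothBody.uniform_quadratic (hK : IsSmoothBody K) :
    ∃ L R : ℝ, 0 < L ∧ 0 < R ∧ ∀ x ∈ frontier K, ∀ z ∈ frontier K, ‖x - z‖ < R →
      ‖outerUnitNormal K x - outerUnitNormal K z‖ ≤ L * ‖x - z‖ ∧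
        |⟪x - z, outerUnitNormal K z⟫| ≤ L * ‖x - z‖ ^ 2 := by
  -- Membership of x in the boundary is repeated as a hypothesis so that the set over which x ranges
  -- can vary in the compactness induction while z stays free.
  suffices H : ∃ L R : ℝ, 0 < L ∧ 0 < R ∧ ∀ x ∈ frontier K, ∀ z ∈ frontier K, x ∈ frontier K →
      ‖x - z‖ < R → ‖outerUnitNormal K x - outerUnitNormal K z‖ ≤ L * ‖x - z‖ ∧
        |⟪x - z, outerUnitNormal K z⟫| ≤ L * ‖x - z‖ ^ 2 by
    obtain ⟨L, R, hL, hR, h⟩ := H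
    exact ⟨L, R, hL, hR, fun x hx z hz => h x hx z hz hx⟩
  refine hK.isCompact_frontier.induction_on
    (p := fun S => ∃ L R : ℝ, 0 < L ∧ 0 < R ∧ ∀ x ∈ S, ∀ z ∈ frontier K, x ∈ frontier K →
      ‖x - z‖ < R → ‖outerUnitNormal K x - outerUnitNormal K z‖ ≤ L * ‖x - z‖ ∧
        |⟪x - z, outerUnitNormal K z⟫| ≤ L * ‖x - z‖ ^ 2) ?_ ?_ ?_ ?_
  · exact ⟨1, 1, one_pos, one_pos, by simp⟩
  · rintro S T hST ⟨L, R, hL, hR, h⟩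
    exact ⟨L, R, hL, hR, fun x hx => h x (hST hx)⟩
  · rintro S T ⟨L, R, hL, hR, h⟩ ⟨L', R', hL', hR', h'⟩
    refine ⟨max L L', min R R', lt_max_of_lt_left hL, lt_min hR hR', ?_⟩
    rintro x (hx | hx) z hz hxK hlt
    · obtain ⟨h1, h2⟩ := h x hx z hz hxK (hlt.trans_le (min_le_left _ _))
      exact ⟨h1.trans (by gcongr; exact le_max_left _ _),
        h2.trans (by gcongr; exact le_max_left _ _)⟩
    · obtain ⟨h1, h2⟩ := h' x hx z hz hxK (hlt.trans_le (min_le_right _ _))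
      exact ⟨h1.trans (by gcongr; exact le_max_right _ _),
        h2.trans (by gcongr; exact le_max_right _ _)⟩
  · intro y hy
    obtain ⟨L, r, hr, h⟩ := hK.local_quadratic hy
    refine ⟨Metric.ball y (r / 2), mem_nhdsWithin_of_mem_nhds (Metric.ball_mem_nhds _ (by linarith)),
      max L 1, r / 2, by positivity, by linarith, fun x hx z hz hxK hlt => ?_⟩
    have hx' : dist x y < r / 2 := hx
    obtain ⟨h1, h2⟩ := h x ⟨hxK, Metric.ball_subset_ball (by linarith) hx⟩ z ⟨hz, by
      rw [Metric.mem_ball]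
      calc dist z y ≤ dist z x + dist x y := dist_triangle _ _ _
        _ < r / 2 + r / 2 := by
          gcongr; rwa [dist_comm, dist_eq_norm]
        _ = r := by ring⟩
    exact ⟨h1.trans (by gcongr; exact le_max_left _ _),
        h2.trans (by gcongr; exact le_max_left _ _)⟩

theorem IsSmoothBody.continuousOn_outerUnitNormal (hK : IsSmoothBody K) :
    ContinuousOn (outerUnitNormal K) (frontier K) := by
  obtain ⟨L, R, hL, hR, h⟩ := hK.uniform_quadratic
  intro x hx
  rw [Metric.continuousWithinAt_iff]
  intro ε hε
  refine ⟨min R (ε / L), by positivity, fun z hz hzx => ?_⟩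
  rw [dist_eq_norm] at hzx ⊢
  refine (h z hz x hx (hzx.trans_le (min_le_left _ _))).1.trans_lt ?_
  have := hzx.trans_le (min_le_right _ _)
  rwa [lt_div_iff₀ hL, mul_comm] at this

/-- A segment from a point of `K` to a point outside meets the boundary. -/
theorem exists_mem_frontier_of_segment {a b : E (d + 1)} (ha : a ∈ K) (hb : b ∉ K) :
    ∃ t ∈ Icc (0 : ℝ) 1, a + t • (b - a) ∈ frontier K := by
  have hpre : IsPreconnected (segment ℝ a b) := (convex_segment a b).isPreconnected
  obtain ⟨w, hw, hwK⟩ : (segment ℝ a b ∩ frontier K).Nonempty := by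
    by_contra hne
    rw [not_nonempty_iff_eq_empty] at hne
    have hnot : ∀ w ∈ segment ℝ a b, w ∉ frontier K := fun w hw hw' =>
      (hne.subset ⟨hw, hw'⟩ : w ∈ (∅ : Set _))
    have hcov : ∀ w ∈ segment ℝ a b, w ∈ interior K ∪ (closure K)ᶜ := fun w hw => by
      by_cases hc : w ∈ closure K
      · exact Or.inl (by_contra fun hi => hnot w hw ⟨hc, hi⟩)
      · exact Or.inr hc
    obtain ⟨w, -, hw1, hw2⟩ := hpre (interior K) (closure K)ᶜ isOpen_interior
      isClosed_closure.isOpen_compl hcov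
      ⟨a, left_mem_segment ℝ a b, (hcov a (left_mem_segment ℝ a b)).resolve_right
        fun h => h (subset_closure ha)⟩
      ⟨b, right_mem_segment ℝ a b, (hcov b (right_mem_segment ℝ a b)).resolve_left
        fun h => hb (interior_subset h)⟩
    exact hw2 (subset_closure (interior_subset hw1))
  rw [segment_eq_image'] at hw
  obtain ⟨t, ht, rfl⟩ := hw
  exact ⟨t, ht, hwK⟩

end Normal


/-! ### Orthonormal coordinates adapted to a unit vector -/

section Frame

/-- `J` is a linear isometry of `ℝ^d` onto the orthogonal complement of the unit vector `e`, and
`p` is the orthogonal projection in the coordinates given by `J`. -/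
structure IsFrame (e : E (d + 1)) (J : E d →ₗᵢ[ℝ] E (d + 1)) (p : E (d + 1) →L[ℝ] E d) :
    Prop where
  norm_eq_one : ‖e‖ = 1
  inner_left (u : E d) : ⟪J u, e⟫ = 0
  proj_apply (u : E d) : p (J u) = u
  proj_axis : p e = 0
  decomp (z : E (d + 1)) : J (p z) + ⟪z, e⟫ • e = z
  measurePreserving : MeasurePreserving (fun w : E d × ℝ => J w.1 + w.2 • e)

theorem norm_add_smul_sq {e : E (d + 1)} (he : ‖e‖ = 1) {J : E d →ₗᵢ[ℝ] E (d + 1)}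
    (hJ : ∀ u, ⟪J u, e⟫ = 0) (u : E d) (t : ℝ) : ‖J u + t • e‖ ^ 2 = ‖u‖ ^ 2 + t ^ 2 := by
  rw [norm_add_sq_real, real_inner_smul_right, hJ, norm_smul, he, J.norm_map]
  simp

/-- The map (u, t) ↦ J u + t e is an isometry from the ℓ² product, onto by dimension, hence
preserves Lebesgue measure; the projection is the adjoint of J. -/
theorem exists_isFrame {e : E (d + 1)} (he : ‖e‖ = 1) : ∃ J p, IsFrame e J p := by
  have hfin : Module.finrank ℝ (ℝ ∙ e)ᗮ = d := by
    have : Fact (Module.finrank ℝ (E (d + 1)) = d + 1) := ⟨by simp⟩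
    exact Submodule.finrank_orthogonal_span_singleton (by
      rintro rfl; simp at he)
  let b : OrthonormalBasis (Fin d) ℝ (ℝ ∙ e)ᗮ :=
    (stdOrthonormalBasis ℝ (ℝ ∙ e)ᗮ).reindex (finCongr hfin)
  let J : E d →ₗᵢ[ℝ] E (d + 1) := (ℝ ∙ e)ᗮ.subtypeₗᵢ.comp b.repr.symm.toLinearIsometry
  have hJ : ∀ u, ⟪J u, e⟫ = 0 := fun u => by
    have : (J u) ∈ (ℝ ∙ e)ᗮ := (b.repr.symm u).2
    rw [real_inner_comm]
    exact Submodule.mem_orthogonal_singleton_iff_inner_right.1 this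
  let T : WithLp 2 (E d × ℝ) →ₗᵢ[ℝ] E (d + 1) :=
    { toFun := fun w => J w.fst + w.snd • e
      map_add' := fun a b => by simp [add_smul]; abel
      map_smul' := fun c a => by simp [mul_smul]
      norm_map' := fun w => by
        have h := norm_add_smul_sq he hJ w.fst w.snd
        have h2 := WithLp.prod_norm_sq_eq_of_L2 w
        rw [Real.norm_eq_abs, sq_abs] at h2
        rw [← h2] at h
        exact (pow_left_inj₀ (norm_nonneg _) (norm_nonneg _) two_ne_zero).1 h }
  have hdim : Module.finrank ℝ (WithLp 2 (E d × ℝ)) = Module.finrank ℝ (E (d + 1)) := by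
    rw [LinearEquiv.finrank_eq (WithLp.linearEquiv 2 ℝ (E d × ℝ))]
    simp
  let T' := T.toLinearIsometryEquiv hdim
  have hp1 : ∀ u, (ContinuousLinearMap.adjoint J.toContinuousLinearMap) (J u) = u := fun u => by
    refine ext_inner_right ℝ fun v => ?_
    rw [ContinuousLinearMap.adjoint_inner_left]
    exact J.inner_map_map u v
  have hp2 : (ContinuousLinearMap.adjoint J.toContinuousLinearMap) e = 0 := by
    refine ext_inner_right ℝ fun v => ?_
    rw [ContinuousLinearMap.adjoint_inner_left, inner_zero_left, real_inner_comm]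
    exact hJ v
  refine ⟨J, ContinuousLinearMap.adjoint J.toContinuousLinearMap, he, hJ, hp1, hp2, ?_, ?_⟩
  · intro z
    obtain ⟨w, rfl⟩ := T'.surjective z
    have hw : T' w = J w.fst + w.snd • e := rfl
    rw [hw, map_add, map_smul, hp1, hp2, inner_add_left, hJ, real_inner_smul_left,
      real_inner_self_eq_norm_sq, he]
    simp
  · exact T'.measurePreserving.comp (WithLp.volume_preserving_toLp (E d) ℝ)

variable {e : E (d + 1)} {J : E d →ₗᵢ[ℝ] E (d + 1)} {p : E (d + 1) →L[ℝ] E d}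

theorem IsFrame.norm_sq (F : IsFrame e J p) (z : E (d + 1)) :
    ‖z‖ ^ 2 = ‖p z‖ ^ 2 + ⟪z, e⟫ ^ 2 := by
  conv_lhs => rw [← F.decomp z]
  exact norm_add_smul_sq F.norm_eq_one F.inner_left _ _

theorem IsFrame.norm_proj_le (F : IsFrame e J p) (z : E (d + 1)) : ‖p z‖ ≤ ‖z‖ := by
  have := F.norm_sq z
  exact abs_le_of_sq_le_sq' (by nlinarith [sq_nonneg ⟪z, e⟫]) (norm_nonneg _) |>.2

end Frame

/-! ### Graph charts from flatness and slow variation of the normal -/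

section Chart

variable {K : Set (E (d + 1))} {x e : E (d + 1)} {r R : ℝ} {Φ : E d → E (d + 1)}
  {J : E d →ₗᵢ[ℝ] E (d + 1)} {p : E (d + 1) →L[ℝ] E d}

/-- `Φ` parametrizes the part of `∂K` near `x` as a graph with small slope over the ball of
radius `r` in the hyperplane orthogonal to `e`. -/
structure IsGraphChart (K : Set (E (d + 1))) (x : E (d + 1)) (r : ℝ) (e : E (d + 1))
    (J : E d →ₗᵢ[ℝ] E (d + 1)) (p : E (d + 1) →L[ℝ] E d) (Φ : E d → E (d + 1)) : Prop where
  frame : IsFrame e J p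
  param : IsLocalParametrization K (Metric.ball 0 r) Φ
  measurable : Measurable Φ
  map_zero : Φ 0 = x
  proj (u : E d) (hu : u ∈ Metric.ball 0 r) : p (Φ u - x) = u
  dist_le (u : E d) (hu : u ∈ Metric.ball 0 r) (v : E d) (hv : v ∈ Metric.ball 0 r) :
    dist (Φ u) (Φ v) ≤ 2 * dist u v
  cover : frontier K ∩ Metric.ball x r ⊆ Φ '' Metric.ball 0 r
  half_le_inner (u : E d) (hu : u ∈ Metric.ball 0 r) : 1 / 2 ≤ ⟪outerUnitNormal K (Φ u), e⟫

/-- The projection of the boundary along a transversal direction is open. -/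
theorem IsSmoothBody.isOpen_proj (hK : IsSmoothBody K) (F : IsFrame e J p) {W : Set (E (d + 1))}
    (hW : IsOpen W) (hn : ∀ y ∈ frontier K ∩ W, 0 < ⟪outerUnitNormal K y, e⟫) :
    IsOpen ((fun z => p (z - x)) '' (frontier K ∩ W)) := by
  rw [isOpen_iff_mem_nhds]
  rintro _ ⟨y, hy, rfl⟩
  obtain ⟨δ, hδ, hδW⟩ := Metric.isOpen_iff.1 hW y hy.2
  have h1 := hK.eventually_mem_interior (v := -e) hy.1 (by
    rw [inner_neg_right]; linarith [hn y hy])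
  have h2 := hK.eventually_notMem (v := e) hy.1 (hn y hy)
  have h3 : ∀ᶠ t : ℝ in 𝓝[>] 0, t < δ / 2 :=
    nhdsWithin_le_nhds (gt_mem_nhds (by linarith))
  obtain ⟨t, ht1, ht2, ht3, ht0⟩ := (h1.and (h2.and (h3.and self_mem_nhdsWithin))).exists
  have ht0 : 0 < t := ht0
  -- The line through y in direction e is inside K at height -t and outside at height t. Both
  -- persist on nearby parallel lines, so each of them crosses the boundary near y.
  have c1 : Continuous fun w : E d => y + J w + t • -e := by fun_prop
  have c2 : Continuous fun w : E d => y + J w + t • e := by fun_prop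
  have e1 : ∀ᶠ w : E d in 𝓝 0, y + J w + t • -e ∈ interior K :=
    c1.continuousAt.eventually_mem (isOpen_interior.mem_nhds (by simpa using ht1))
  have e2 : ∀ᶠ w : E d in 𝓝 0, y + J w + t • e ∈ Kᶜ :=
    c2.continuousAt.eventually_mem (hK.1.isClosed.isOpen_compl.mem_nhds (by simpa using ht2))
  have e3 : ∀ᶠ w : E d in 𝓝 0, ‖w‖ < δ / 2 := by
    filter_upwards [Metric.ball_mem_nhds (0 : E d) (half_pos hδ)] with w hw
    simpa using hw
  have ct : Tendsto (fun u : E d => u - p (y - x)) (𝓝 (p (y - x))) (𝓝 0) := by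
    have : Continuous fun u : E d => u - p (y - x) := by fun_prop
    simpa using this.tendsto (p (y - x))
  filter_upwards [ct.eventually (e1.and (e2.and e3))] with u hu
  obtain ⟨u1, u2, u3⟩ := hu
  set w := u - p (y - x) with hw
  obtain ⟨τ, hτ, hmem⟩ := exists_mem_frontier_of_segment (interior_subset u1) u2
  have hrw : y + J w + t • -e + τ • (y + J w + t • e - (y + J w + t • -e)) =
      y + J w + ((2 * τ - 1) * t) • e := by module
  rw [hrw] at hmem
  refine ⟨_, ⟨hmem, hδW ?_⟩, ?_⟩
  · rw [Metric.mem_ball, dist_eq_norm]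
    have : y + J w + ((2 * τ - 1) * t) • e - y = J w + ((2 * τ - 1) * t) • e := by abel
    rw [this]
    refine (norm_add_le _ _).trans_lt ?_
    rw [J.norm_map, norm_smul, F.norm_eq_one, mul_one, Real.norm_eq_abs, abs_mul, abs_of_pos ht0]
    have : |2 * τ - 1| ≤ 1 := abs_le.2 ⟨by linarith [hτ.1], by linarith [hτ.2]⟩
    nlinarith
  · have : y + J w + ((2 * τ - 1) * t) • e - x = (y - x) + J w + ((2 * τ - 1) * t) • e := by abel
    change p _ = u
    rw [this, map_add, map_add, map_smul, F.proj_apply, F.proj_axis, hw, smul_zero]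
    abel

/-- A continuous right inverse of the projection with values in the boundary is smooth. -/
theorem IsSmoothBody.contDiffAt_of_proj (hK : IsSmoothBody K) (F : IsFrame e J p) {u : E d}
    (hΦ : ContinuousAt Φ u) (hmem : ∀ᶠ v in 𝓝 u, Φ v ∈ frontier K)
    (hproj : ∀ᶠ v in 𝓝 u, p (Φ v - x) = v) (hn : 0 < ⟪outerUnitNormal K (Φ u), e⟫) :
    ContDiffAt ℝ ∞ Φ u ∧ ∀ v, ⟪fderiv ℝ Φ u v, outerUnitNormal K (Φ u)⟫ = 0 ∧
      p (fderiv ℝ Φ u v) = v := by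
  have hu := hmem.self_of_nhds
  obtain ⟨φ, h⟩ := hK.2.2 (Φ u) hu
  have hφ0 : ∀ᶠ v in 𝓝 u, φ (Φ v) = 0 := by
    filter_upwards [hΦ.eventually (h.eventually hK.1.isClosed), hmem] with v hv hv'
    exact (hv hv').2.1
  set φ' := fderiv ℝ φ (Φ u)
  have hφ' : HasFDerivAt φ φ' (Φ u) := (h.1.differentiable (by simp) _).hasFDerivAt
  have hφe : φ' e ≠ 0 := by
    intro h0
    rw [h.inner_outerUnitNormal] at hn
    simp only [φ'] at h0
    rw [h0] at hn
    simp at hn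
  -- Tangential coordinates completed by φ form a local diffeomorphism, since φ has non-zero
  -- derivative along e. As φ vanishes on the boundary, Φ is its local inverse composed with J.
  let f : E (d + 1) → E (d + 1) := fun z => J (p (z - x)) + φ z • e
  let f' : E (d + 1) →L[ℝ] E (d + 1) :=
    J.toContinuousLinearMap.comp p + φ'.smulRight e
  have hf' : HasFDerivAt f f' (Φ u) := by
    have h1 : HasFDerivAt (fun z => J (p (z - x))) (J.toContinuousLinearMap.comp p) (Φ u) := by
      have := (J.toContinuousLinearMap.comp p).hasFDerivAt (x := Φ u - x)
      have h2 := this.comp (Φ u) ((hasFDerivAt_id (Φ u)).sub_const x)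
      rwa [ContinuousLinearMap.comp_id] at h2
    exact h1.add (hφ'.smul_const e)
  have hinj : Function.Injective f' := by
    rw [injective_iff_map_eq_zero]
    intro v hv
    have hv' : J (p v) + φ' v • e = 0 := hv
    have a1 : p v = 0 := by
      have := congrArg p hv'
      simpa [F.proj_apply, F.proj_axis] using this
    have a2 : φ' v = 0 := by
      rw [a1, map_zero, zero_add, smul_eq_zero] at hv'
      refine hv'.resolve_right ?_
      rintro rfl
      simpa using F.norm_eq_one
    have a3 := F.decomp v
    rw [a1, map_zero, zero_add] at a3
    rw [← a3, map_smul, smul_eq_mul, mul_eq_zero] at a2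
    rw [← a3, a2.resolve_right hφe, zero_smul]
  let f'' : E (d + 1) ≃L[ℝ] E (d + 1) :=
    (LinearEquiv.ofInjectiveEndo f'.toLinearMap hinj).toContinuousLinearEquiv
  have hf'' : HasFDerivAt f (f'' : E (d + 1) →L[ℝ] E (d + 1)) (Φ u) := by
    have : (f'' : E (d + 1) →L[ℝ] E (d + 1)) = f' := ContinuousLinearMap.ext fun _ => rfl
    rwa [this]
  have hfc : ContDiffAt ℝ ∞ f (Φ u) := by
    have : ContDiff ℝ ∞ f := by
      have h1 : ContDiff ℝ ∞ fun z => J (p (z - x)) :=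
        (J.toContinuousLinearMap.comp p).contDiff.comp (contDiff_id.sub contDiff_const)
      exact h1.add (h.1.smul contDiff_const)
    exact this.contDiffAt
  have hstrict : HasStrictFDerivAt f (f'' : E (d + 1) →L[ℝ] E (d + 1)) (Φ u) :=
    hfc.hasStrictFDerivAt' hf'' (by simp)
  have hinv := hfc.to_localInverse hf'' (by simp)
  have hleft := hstrict.eventually_left_inverse
  have heq : Φ =ᶠ[𝓝 u] fun v => hfc.localInverse hf'' (by simp) (J v) := by
    filter_upwards [hΦ.eventually hleft, hφ0, hproj] with v h1 h2 h3
    have : f (Φ v) = J v := by simp only [f, h2, h3, zero_smul, add_zero]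
    rw [← this]
    exact h1.symm
  have hfu : f (Φ u) = J u := by
    simp only [f, hφ0.self_of_nhds, hproj.self_of_nhds, zero_smul, add_zero]
  have hsm : ContDiffAt ℝ ∞ Φ u := by
    refine ContDiffAt.congr_of_eventuallyEq ?_ heq
    rw [hfu] at hinv
    exact hinv.comp u J.toContinuousLinearMap.contDiff.contDiffAt
  have hd := (hsm.differentiableAt (by simp)).hasFDerivAt
  refine ⟨hsm, fun v => ⟨?_, ?_⟩⟩
  · have h1 := hφ'.comp u hd
    have h2 : HasFDerivAt (φ ∘ Φ) (0 : E d →L[ℝ] ℝ) u :=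
      (hasFDerivAt_const (0 : ℝ) u).congr_of_eventuallyEq hφ0
    have h3 := congrArg (fun T => T v) (h1.unique h2)
    simp only [ContinuousLinearMap.comp_apply, zero_apply] at h3
    rw [real_inner_comm, h.inner_outerUnitNormal, h3, mul_zero]
  · have h1 := (p.hasFDerivAt (x := Φ u - x)).comp u (hd.sub_const x)
    have h2 : HasFDerivAt (fun v => p (Φ v - x)) (ContinuousLinearMap.id ℝ (E d)) u :=
      (hasFDerivAt_id u).congr_of_eventuallyEq hproj
    have h3 := congrArg (fun T => T v) (h1.unique h2)
    simpa using h3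

/-- If the normal is nearly constant on `∂K ∩ B_R(x)` and `∂K ∩ B_R(x)` is nearly flat, then
`∂K` is a graph near `x`. -/
theorem IsSmoothBody.exists_isGraphChart (hK : IsSmoothBody K) (hx : x ∈ frontier K) (hR : 0 < R)
    (h1 : ∀ y ∈ frontier K ∩ Metric.ball x R, ∀ z ∈ frontier K ∩ Metric.ball x R,
      |⟪y - z, outerUnitNormal K z⟫| ≤ ‖y - z‖ / 10)
    (h2 : ∀ y ∈ frontier K ∩ Metric.ball x R,
      ‖outerUnitNormal K y - outerUnitNormal K x‖ ≤ 1 / 10) :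
    ∃ e J p Φ, IsGraphChart K x (R / 2) e J p Φ := by
  set e := outerUnitNormal K x with he
  have hen : ‖e‖ = 1 := hK.norm_outerUnitNormal hx
  obtain ⟨J, p, F⟩ := exists_isFrame hen
  set S := frontier K ∩ Metric.ball x R with hS
  have hxS : x ∈ S := ⟨hx, Metric.mem_ball_self hR⟩
  have hn : ∀ y ∈ S, 1 / 2 ≤ ⟪outerUnitNormal K y, e⟫ := fun y hy => by
    have a1 : ⟪outerUnitNormal K y, e⟫ = 1 + ⟪outerUnitNormal K y - e, e⟫ := by
      rw [inner_sub_left, real_inner_self_eq_norm_sq, hen]; ring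
    have a2 := abs_real_inner_le_norm (outerUnitNormal K y - e) e
    rw [hen, mul_one] at a2
    have a3 := abs_le.1 (a2.trans (h2 y hy))
    rw [a1]; linarith [a3.1]
  -- The e-component of y - z is at most a fifth of its length: one tenth from flatness and one
  -- tenth from the variation of the normal. Pythagoras gives the factor, as 25/24 ≤ (11/10)².
  have key : ∀ y ∈ S, ∀ z ∈ S, ‖y - z‖ ≤ 11 / 10 * ‖p (y - x) - p (z - x)‖ := by
    intro y hy z hz
    have a0 : p (y - x) - p (z - x) = p (y - z) := by rw [← map_sub]; congr 1; abel
    rw [a0]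
    have a1 : |⟪y - z, e⟫| ≤ ‖y - z‖ / 5 := by
      have b1 : ⟪y - z, e⟫ = ⟪y - z, outerUnitNormal K z⟫ -
          ⟪y - z, outerUnitNormal K z - e⟫ := by rw [inner_sub_right]; ring
      have b2 := abs_real_inner_le_norm (y - z) (outerUnitNormal K z - e)
      have b3 := h2 z hz
      have b4 := h1 y hy z hz
      rw [b1]
      refine (abs_sub _ _).trans ?_
      nlinarith [norm_nonneg (y - z)]
    have a2 := F.norm_sq (y - z)
    have a3 : ⟪y - z, e⟫ ^ 2 ≤ (‖y - z‖ / 5) ^ 2 := sq_le_sq' (abs_le.1 a1).1 (abs_le.1 a1).2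
    refine abs_le_of_sq_le_sq' ?_ (by positivity) |>.2
    nlinarith [sq_nonneg ‖p (y - z)‖]
  set D := Metric.ball (0 : E d) (R / 2) with hD
  set q : E (d + 1) → E d := fun z => p (z - x) with hq
  have hqx : q x = 0 := by simp [hq]
  -- Connectedness: the image of S is open, contains 0, and is closed relative to D, because points
  -- of S over D stay within 11/10 · R/2 = 11/20 · R of x and so in a compact part of the boundary.
  have hsub : D ⊆ q '' S := by
    refine (convex_ball (0 : E d) (R / 2)).isPreconnected.subset_of_closure_inter_subset
      (hK.isOpen_proj F Metric.isOpen_ball fun y hy => by linarith [hn y hy]) ?_ ?_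
    · exact ⟨0, Metric.mem_ball_self (by linarith), x, hxS, hqx⟩
    · have hC : IsCompact (q '' (frontier K ∩ Metric.closedBall x (11 / 20 * R))) :=
        (hK.isCompact_frontier.inter_right Metric.isClosed_closedBall).image (by fun_prop)
      have hsubC : q '' S ∩ D ⊆ q '' (frontier K ∩ Metric.closedBall x (11 / 20 * R)) := by
        rintro _ ⟨⟨y, hy, rfl⟩, hyD⟩
        refine ⟨y, ⟨hy.1, ?_⟩, rfl⟩
        rw [Metric.mem_closedBall, dist_eq_norm]
        refine (key y hy x hxS).trans ?_
        have : ‖p (y - x)‖ < R / 2 := by simpa [hD, hq] using hyD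
        simp only [sub_self, map_zero, sub_zero]
        linarith
      rintro w ⟨hw1, hw2⟩
      have hw3 : w ∈ closure (q '' S ∩ D) := by
        rw [inter_comm]
        exact Metric.isOpen_ball.inter_closure ⟨hw2, hw1⟩
      have hw4 := closure_minimal hsubC hC.isClosed hw3
      obtain ⟨y, hy, rfl⟩ := hw4
      exact ⟨y, ⟨hy.1, Metric.closedBall_subset_ball (by linarith) hy.2⟩, rfl⟩
  -- Prescribing the value 0 off D makes the chosen map globally measurable, as charts require.
  have hex : ∀ u : E d, ∃ z, (u ∈ D → z ∈ S ∧ q z = u) ∧ (u ∉ D → z = 0) := fun u => by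
    by_cases hu : u ∈ D
    · obtain ⟨z, hz, hzu⟩ := hsub hu
      exact ⟨z, fun _ => ⟨hz, hzu⟩, fun h => absurd hu h⟩
    · exact ⟨0, fun h => absurd h hu, fun _ => rfl⟩
  choose Φ hΦ' using hex
  have hΦ := fun u => (hΦ' u).1
  have hlip : ∀ u ∈ D, ∀ v ∈ D, dist (Φ u) (Φ v) ≤ 2 * dist u v := by
    intro u hu v hv
    have := key _ (hΦ u hu).1 _ (hΦ v hv).1
    have e1 := (hΦ u hu).2
    have e2 := (hΦ v hv).2
    simp only [hq] at e1 e2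
    rw [e1, e2] at this
    rw [dist_eq_norm, dist_eq_norm]
    linarith [norm_nonneg (u - v)]
  have hcont : ContinuousOn Φ D :=
    (LipschitzOnWith.of_dist_le_mul (K := 2) (by simpa using hlip)).continuousOn
  have hDo : IsOpen D := Metric.isOpen_ball
  have hmeas : Measurable Φ := by
    classical
    have h := hcont.measurable_piecewise (g := fun _ => (0 : E (d + 1))) continuousOn_const
      hDo.measurableSet
    convert! h using 1
    ext1 u
    by_cases hu : u ∈ D
    · rw [piecewise_eq_of_mem _ _ _ hu]
    · rw [piecewise_eq_of_notMem _ _ _ hu, (hΦ' u).2 hu]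
  have hsm : ∀ u ∈ D, ContDiffAt ℝ ∞ Φ u ∧
      ∀ v, ⟪fderiv ℝ Φ u v, outerUnitNormal K (Φ u)⟫ = 0 ∧ p (fderiv ℝ Φ u v) = v := fun u hu =>
    hK.contDiffAt_of_proj F (hcont.continuousAt (hDo.mem_nhds hu))
      (by filter_upwards [hDo.mem_nhds hu] with v hv using (hΦ v hv).1.1)
      (by filter_upwards [hDo.mem_nhds hu] with v hv using (hΦ v hv).2)
      (by linarith [hn _ (hΦ u hu).1])
  have hinjS : ∀ y ∈ S, ∀ z ∈ S, q y = q z → y = z := by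
    intro y hy z hz hyz
    have := key y hy z hz
    simp only [hq] at hyz
    rw [hyz, sub_self, norm_zero, mul_zero] at this
    exact sub_eq_zero.1 (norm_le_zero_iff.1 this)
  have h0D : (0 : E d) ∈ D := Metric.mem_ball_self (by linarith)
  refine ⟨e, J, p, Φ, F, ⟨hDo, fun u hu => (hsm u hu).1.contDiffWithinAt, ?_,
    fun u hu => (hΦ u hu).1.1, ?_⟩, hmeas, ?_,
    fun u hu => (hΦ u hu).2, hlip, ?_, fun u hu => hn _ (hΦ u hu).1⟩
  · intro u hu v hv huv
    rw [← (hΦ u hu).2, ← (hΦ v hv).2, huv]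
  · intro u hu
    exact Function.LeftInverse.injective (g := p) fun v => ((hsm u hu).2 v).2
  · exact hinjS _ (hΦ 0 h0D).1 x hxS ((hΦ 0 h0D).2.trans hqx.symm)
  · rintro y ⟨hyK, hy⟩
    have hyS : y ∈ S := ⟨hyK, Metric.ball_subset_ball (by linarith) hy⟩
    have hqy : q y ∈ D := by
      rw [hD, mem_ball_zero_iff]
      refine (F.norm_proj_le _).trans_lt ?_
      rwa [← dist_eq_norm]
    exact ⟨q y, hqy, hinjS _ (hΦ _ hqy).1 y hyS (hΦ _ hqy).2⟩

end Chart


/-! ### Measurability of the normal and of the kernel -/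

section Measurability

variable {K : Set (E (d + 1))} {x y : E (d + 1)}

/-- A defining function is positive just past y along its gradient, so a point that has one is a
boundary point. Thus the normal is the extension by zero of a continuous field on a closed set,
hence Borel for a smooth body. -/
theorem outerUnitNormal_of_notMem_frontier (hy : y ∉ frontier K) : outerUnitNormal K y = 0 := by
  rw [outerUnitNormal, dif_neg]
  rintro ⟨ν, φ, ⟨hφ, h0, hg, hloc⟩, -⟩
  apply hy
  rw [frontier_eq_closure_inter_closure]
  refine ⟨subset_closure (hloc.self_of_nhds.2 h0.le), ?_⟩
  have hg' : ∇ (fun z => -φ z) y = -∇ φ y := by simp [gradient, fderiv_fun_neg]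
  have hv : ⟪∇ (fun z => -φ z) y, ∇ φ y⟫ < 0 := by
    rw [hg', inner_neg_left, real_inner_self_eq_norm_sq]
    have := norm_pos_iff.2 hg
    nlinarith
  have hc : Tendsto (fun t : ℝ => y + t • ∇ φ y) (𝓝[>] 0) (𝓝 y) := by
    have : Continuous (fun t : ℝ => y + t • ∇ φ y) := by fun_prop
    have h0 := this.tendsto 0
    simp only [zero_smul, add_zero] at h0
    exact h0.mono_left nhdsWithin_le_nhds
  refine mem_closure_of_tendsto hc ?_
  filter_upwards [eventually_neg_of_inner_neg (φ := fun z => -φ z) hφ.neg (by simp [h0]) hv,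
    hc.eventually hloc] with t ht ht' hmem
  have := ht'.1 hmem
  linarith

theorem IsSmoothBody.measurable_outerUnitNormal (hK : IsSmoothBody K) :
    Measurable (outerUnitNormal K) := by
  classical
  have h := hK.continuousOn_outerUnitNormal.measurable_piecewise
    (g := fun _ => (0 : E (d + 1))) continuousOn_const isClosed_frontier.measurableSet
  convert! h using 1
  ext1 u
  by_cases hu : u ∈ frontier K
  · rw [piecewise_eq_of_mem _ _ _ hu]
  · rw [piecewise_eq_of_notMem _ _ _ hu, outerUnitNormal_of_notMem_frontier hu]

theorem IsSmoothBody.measurable_curvatureKernel (hK : IsSmoothBody K) (s : ℝ) (x : E (d + 1)) :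
    Measurable (curvatureKernel K s x) := by
  have := hK.measurable_outerUnitNormal
  unfold curvatureKernel
  fun_prop

end Measurability

/-! ### Surface measure in a chart, up to constants -/

section ChartMeasure

theorem euclideanHausdorffMeasure_image_le {X Y : Type*} [MetricSpace X] [MetricSpace Y]
    [MeasurableSpace X] [BorelSpace X] [MeasurableSpace Y] [BorelSpace Y] {f : X → Y} {s : Set X}
    {L : ℝ≥0} (h : LipschitzOnWith L f s) :
    (μHE[d] : Measure Y) (f '' s) ≤ (L : ℝ≥0∞) ^ d * (μHE[d] : Measure X) s := by
  rw [Measure.euclideanHausdorffMeasure_def, Measure.euclideanHausdorffMeasure_def,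
    Measure.smul_apply, Measure.smul_apply]
  have := h.hausdorffMeasure_image_le (d := d) (by positivity)
  rw [ENNReal.rpow_natCast] at this
  simp only [ENNReal.smul_def, smul_eq_mul]
  calc _ ≤ _ * ((L : ℝ≥0∞) ^ d * μH[d] s) := by gcongr
    _ = _ := by ring

variable {K : Set (E (d + 1))} {x e : E (d + 1)} {r : ℝ} {Φ : E d → E (d + 1)}
  {J : E d →ₗᵢ[ℝ] E (d + 1)} {p : E (d + 1) →L[ℝ] E d}

namespace IsGraphChart

theorem image_subset (h : IsGraphChart K x r e J p Φ) :
    Φ '' Metric.ball 0 r ⊆ frontier K := by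
  rintro _ ⟨u, hu, rfl⟩
  exact h.param.2.2.2.1 hu

/-- The projection is a 1-Lipschitz left inverse of Φ. With the Lipschitz constant 2 of Φ for the
converse bound, this two-sided comparison takes the place of an area formula. -/
theorem volume_le (h : IsGraphChart K x r e J p Φ) {V : Set (E d)} (hV : V ⊆ Metric.ball 0 r) :
    volume V ≤ μHE[d] (Φ '' V) := by
  have hL : LipschitzOnWith 1 (fun z => p (z - x)) (Φ '' V) := by
    refine LipschitzWith.lipschitzOnWith (LipschitzWith.of_dist_le_mul fun a b => ?_)
    rw [dist_eq_norm, dist_eq_norm, ← map_sub]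
    simpa using h.frame.norm_proj_le (a - b)
  have h1 := euclideanHausdorffMeasure_image_le (d := d) hL
  have h2 : (fun z => p (z - x)) '' (Φ '' V) = V := by
    rw [image_image]
    ext u
    constructor
    · rintro ⟨w, hw, rfl⟩
      simpa [h.proj w (hV hw)] using hw
    · exact fun hu => ⟨u, hu, h.proj u (hV hu)⟩
  rw [h2, EuclideanSpace.euclideanHausdorffMeasure_eq_volume] at h1
  simpa using h1

theorem le_volume (h : IsGraphChart K x r e J p Φ) {V : Set (E d)} (hV : V ⊆ Metric.ball 0 r) :
    μHE[d] (Φ '' V) ≤ 2 ^ d * volume V := by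
  have hL : LipschitzOnWith 2 Φ V := LipschitzOnWith.of_dist_le_mul fun a ha b hb => by
    simpa using h.dist_le a (hV ha) b (hV hb)
  have h1 := euclideanHausdorffMeasure_image_le (d := d) hL
  rw [EuclideanSpace.euclideanHausdorffMeasure_eq_volume] at h1
  simpa using h1

theorem map_le (h : IsGraphChart K x r e J p Φ) :
    (volume.restrict (Metric.ball 0 r)).map Φ ≤ (μHE[d]).restrict (Φ '' Metric.ball 0 r) := by
  refine Measure.le_iff.2 fun S hS => ?_
  rw [Measure.map_apply h.measurable hS, Measure.restrict_apply (h.measurable hS),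
    Measure.restrict_apply hS]
  refine (h.volume_le inter_subset_right).trans (measure_mono ?_)
  rintro _ ⟨u, ⟨hu1, hu2⟩, rfl⟩
  exact ⟨hu1, u, hu2, rfl⟩

theorem le_map (h : IsGraphChart K x r e J p Φ) :
    (μHE[d]).restrict (Φ '' Metric.ball 0 r) ≤
      (2 ^ d : ℝ≥0∞) • (volume.restrict (Metric.ball 0 r)).map Φ := by
  refine Measure.le_iff.2 fun S hS => ?_
  rw [Measure.smul_apply, Measure.map_apply h.measurable hS,
    Measure.restrict_apply (h.measurable hS), Measure.restrict_apply hS]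
  refine le_trans (measure_mono ?_) (h.le_volume inter_subset_right)
  rintro _ ⟨hu1, u, hu2, rfl⟩
  exact ⟨u, ⟨hu1, hu2⟩, rfl⟩

theorem map_le_surfaceMeasure (h : IsGraphChart K x r e J p Φ) :
    (volume.restrict (Metric.ball 0 r)).map Φ ≤ surfaceMeasure K :=
  h.map_le.trans (Measure.restrict_mono h.image_subset le_rfl)

theorem lintegral_le (h : IsGraphChart K x r e J p Φ) {g : E (d + 1) → ℝ≥0∞} (hg : Measurable g) :
    ∫⁻ u in Metric.ball 0 r, g (Φ u) ≤ ∫⁻ y, g y ∂(surfaceMeasure K) := by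
  rw [← lintegral_map hg h.measurable]
  exact lintegral_mono' h.map_le_surfaceMeasure le_rfl

/-- The chart structure records only injectivity of the derivative; tangency of its image to the
boundary and the fact that the projection inverts it are recovered from the implicit function
argument. -/
theorem fderiv_spec (hK : IsSmoothBody K) (h : IsGraphChart K x r e J p Φ) {u : E d}
    (hu : u ∈ Metric.ball 0 r) :
    ContDiffAt ℝ ∞ Φ u ∧ ∀ v, ⟪fderiv ℝ Φ u v, outerUnitNormal K (Φ u)⟫ = 0 ∧
      p (fderiv ℝ Φ u v) = v := by
  have hn : Metric.ball (0 : E d) r ∈ 𝓝 u := Metric.isOpen_ball.mem_nhds hu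
  refine hK.contDiffAt_of_proj (x := x) h.frame ((h.param.2.1.contDiffAt hn).continuousAt) ?_ ?_ ?_
  · filter_upwards [hn] with v hv using h.param.2.2.2.1 hv
  · filter_upwards [hn] with v hv using h.proj v hv
  · linarith [h.half_le_inner u hu]

end IsGraphChart

end ChartMeasure

/-! ### Shadows and the nonlocal curvature -/

section Cone

variable {K : Set (E (d + 1))} {x e : E (d + 1)} {r : ℝ} {Φ : E d → E (d + 1)}
  {J : E d →ₗᵢ[ℝ] E (d + 1)} {p : E (d + 1) →L[ℝ] E d}

/-- The determinant of the derivative of the map that parametrizes a cone over a graph. -/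
theorem IsFrame.det_cone (F : IsFrame e J p) {D : E d →L[ℝ] E (d + 1)} {n w : E (d + 1)} {t : ℝ}
    (ht : t ≠ 0) (hD : ∀ v, ⟪D v, n⟫ = 0) (hpD : ∀ v, p (D v) = v) (hn : ⟪n, e⟫ ≠ 0) :
    (t • D.comp p + (innerSL ℝ e).smulRight w).det = t ^ d * (⟪w, n⟫ / ⟪n, e⟫) := by
  let f : Module.Dual ℝ (E (d + 1)) :=
    ((innerSL ℝ e).comp (D.comp p) : E (d + 1) →L[ℝ] ℝ).toLinearMap
  let g : Module.Dual ℝ (E (d + 1)) := (⟪n, e⟫⁻¹ • innerSL ℝ n : E (d + 1) →L[ℝ] ℝ).toLinearMap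
  have hf : ∀ v, f v = ⟪e, D (p v)⟫ := fun v => rfl
  have hg : ∀ v, g v = ⟪n, e⟫⁻¹ * ⟪n, v⟫ := fun v => rfl
  -- A shear by e of determinant 1, then a transvection of determinant ⟨w,n⟩ / (t⟨n,e⟩), then the
  -- dilation by t, which contributes t^(d+1).
  have hfac : (t • D.comp p + (innerSL ℝ e).smulRight w : E (d + 1) →L[ℝ] E (d + 1)).toLinearMap =
      (t • LinearMap.transvection g (t⁻¹ • w - e)) ∘ₗ LinearMap.transvection f e := by
    ext1 v
    have h1 : LinearMap.transvection f e v = D (p v) + ⟪e, v⟫ • e := by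
      rw [LinearMap.transvection.apply, hf]
      have a1 := F.decomp (D (p v))
      have a2 := F.decomp v
      rw [hpD, real_inner_comm] at a1
      rw [real_inner_comm] at a2
      linear_combination (norm := module) a1 - a2
    have h2 : ⟪n, D (p v)⟫ = 0 := by rw [real_inner_comm, hD]
    rw [LinearMap.comp_apply, h1, LinearMap.smul_apply, LinearMap.transvection.apply, hg,
      inner_add_right, h2, real_inner_smul_right, zero_add,
      mul_comm ⟪e, v⟫, inv_mul_cancel_left₀ hn]
    change t • D (p v) + ⟪e, v⟫ • w = _
    rw [smul_sub, smul_smul, smul_add, smul_sub, smul_smul, smul_smul,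
      show t * (⟪e, v⟫ * t⁻¹) = ⟪e, v⟫ by field_simp]
    module
  rw [ContinuousLinearMap.det, hfac, LinearMap.det_comp, LinearMap.det_smul,
    LinearMap.transvection.det, LinearMap.transvection.det, hf, F.proj_axis, map_zero,
    inner_zero_right, add_zero, mul_one, hg, inner_sub_right, real_inner_smul_right,
    real_inner_comm n w]
  simp only [finrank_euclideanSpace, Fintype.card_fin]
  field_simp
  ring

/-- The points of the ball `B_ρ(x)` other than `x` for which the segment from `x` meets `S`. -/
def shadow (x : E (d + 1)) (ρ : ℝ) (S : Set (E (d + 1))) : Set (E (d + 1)) :=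
  {z | z ∈ Metric.ball x ρ ∧ z ≠ x ∧ ∃ t ∈ Ioc (0 : ℝ) 1, x + t • (z - x) ∈ S}

theorem shadow_union (x : E (d + 1)) (ρ : ℝ) (S T : Set (E (d + 1))) :
    shadow x ρ (S ∪ T) = shadow x ρ S ∪ shadow x ρ T := by
  ext z
  simp only [shadow, mem_ofPred_eq, mem_union]
  grind

/-- Radial part of the cone integral, with b the distance to the boundary point on the ray: for a >
0, the length of [1, ρ/b] times the largest value of the integrand is enough. -/
theorem inner_integral_le {a b ρ : ℝ} (hb : 0 < b) (hbρ : b < ρ) :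
    ∫⁻ t : ℝ, {t : ℝ | 1 ≤ t ∧ t * b < ρ}.indicator
      (fun t => ENNReal.ofReal (2 * t ^ d * a)) t ≤
      ENNReal.ofReal (2 * (ρ / b) ^ (d + 1) * a) := by
  have hρ : 0 < ρ := hb.trans hbρ
  rcases le_or_gt a 0 with ha | ha
  · refine (le_of_eq ?_).trans zero_le
    rw [lintegral_eq_zero_iff']
    · refine Eventually.of_forall fun t => ?_
      by_cases ht : t ∈ {t : ℝ | 1 ≤ t ∧ t * b < ρ}
      · rw [indicator_of_mem ht]
        have : 0 ≤ t := zero_le_one.trans ht.1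
        exact ENNReal.ofReal_of_nonpos (mul_nonpos_of_nonneg_of_nonpos (by positivity) ha)
      · rw [indicator_of_notMem ht]; rfl
    · refine Measurable.aemeasurable (Measurable.indicator (by fun_prop) ?_)
      exact (measurableSet_le measurable_const measurable_id).inter
        (measurableSet_lt (f := fun t : ℝ => t * b) (by fun_prop) measurable_const)
  · calc _ ≤ ∫⁻ t : ℝ, (Icc 1 (ρ / b)).indicator
          (fun _ => ENNReal.ofReal (2 * (ρ / b) ^ d * a)) t := by
          refine lintegral_mono fun t => ?_
          by_cases ht : t ∈ {t : ℝ | 1 ≤ t ∧ t * b < ρ}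
          · have ht2 : t ≤ ρ / b := (le_div_iff₀ hb).2 ht.2.le
            have : 0 ≤ t := zero_le_one.trans ht.1
            rw [indicator_of_mem ht, indicator_of_mem (show t ∈ Icc 1 (ρ / b) from ⟨ht.1, ht2⟩)]
            exact ENNReal.ofReal_le_ofReal (by gcongr)
          · rw [indicator_of_notMem ht]; exact zero_le
      _ ≤ ENNReal.ofReal (2 * (ρ / b) ^ d * a) * ENNReal.ofReal (ρ / b) := by
          rw [lintegral_indicator_const measurableSet_Icc, Real.volume_Icc]
          gcongr
          linarith
      _ = _ := by
          rw [← ENNReal.ofReal_mul (by positivity)]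
          congr 1; ring

/-- The volume of the shadow of a subset of a graph chart. -/
theorem IsGraphChart.volume_shadow_le (hK : IsSmoothBody K) (h : IsGraphChart K x r e J p Φ)
    {x₀ : E (d + 1)} {s ρ : ℝ} (hs : 0 < s) (hρ : 0 < ρ) {S : Set (E (d + 1))}
    (hS : MeasurableSet S) (hSr : S ⊆ Φ '' Metric.ball 0 r) :
    volume (shadow x₀ ρ S) ≤ ENNReal.ofReal (2 * ρ ^ ((d : ℝ) + 1 + s)) *
      ∫⁻ y in S, ‖curvatureKernel K s x₀ y‖ₑ ∂(surfaceMeasure K) := by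
  set A : Set (E (d + 1)) := {v | (p v ∈ Metric.ball 0 r ∧ Φ (p v) ∈ S ∧ Φ (p v) ≠ x₀) ∧
    (1 ≤ ⟪v, e⟫ ∧ ⟪v, e⟫ * ‖Φ (p v) - x₀‖ < ρ)} with hA
  -- For v = J u + t e this is the point at parameter t on the ray from x₀ through Φ(u). In `A`, t ≥
  -- 1 means that the boundary point comes first, and the last condition keeps the image in B_ρ(x₀).
  let G : E (d + 1) → E (d + 1) := fun v => x₀ + ⟪v, e⟫ • (Φ (p v) - x₀)
  let G' : E (d + 1) → E (d + 1) →L[ℝ] E (d + 1) := fun v =>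
    ⟪v, e⟫ • (fderiv ℝ Φ (p v)).comp p + (innerSL ℝ e).smulRight (Φ (p v) - x₀)
  have hΦp : Measurable fun v => Φ (p v) := h.measurable.comp p.continuous.measurable
  have hAm : MeasurableSet A := by
    refine MeasurableSet.inter (MeasurableSet.inter ?_ (MeasurableSet.inter ?_ ?_))
      (MeasurableSet.inter ?_ ?_)
    · exact p.continuous.measurable Metric.isOpen_ball.measurableSet
    · exact hΦp hS
    · exact hΦp (measurableSet_singleton x₀).compl
    · exact measurableSet_le (g := fun v => ⟪v, e⟫) measurable_const (by fun_prop)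
    · exact measurableSet_lt (f := fun v => ⟪v, e⟫ * ‖Φ (p v) - x₀‖)
        (Measurable.mul (by fun_prop) (hΦp.sub_const x₀).norm) measurable_const
  have hsub : shadow x₀ ρ S ⊆ G '' A := by
    rintro z ⟨hz, hzx, t, ht, hzS⟩
    obtain ⟨u, hu, hΦu⟩ := hSr hzS
    have e1 : Φ u - x₀ = t • (z - x₀) := by rw [hΦu]; abel
    have p1 : p (J u + t⁻¹ • e) = u := by
      rw [map_add, map_smul, h.frame.proj_apply, h.frame.proj_axis, smul_zero, add_zero]
    have p2 : ⟪J u + t⁻¹ • e, e⟫ = t⁻¹ := by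
      rw [inner_add_left, h.frame.inner_left, real_inner_smul_left, real_inner_self_eq_norm_sq,
        h.frame.norm_eq_one]; simp
    refine ⟨J u + t⁻¹ • e, ⟨⟨by rwa [p1], by rw [p1, hΦu]; exact hzS, ?_⟩, ?_, ?_⟩, ?_⟩
    · rw [p1, ← sub_ne_zero, e1]
      exact smul_ne_zero ht.1.ne' (sub_ne_zero.2 hzx)
    · rw [p2]; exact (one_le_inv₀ ht.1).2 ht.2
    · rw [p1, p2, e1, norm_smul, Real.norm_of_nonneg ht.1.le, inv_mul_cancel_left₀ ht.1.ne',
        ← dist_eq_norm]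
      exact hz
    · simp only [G]
      rw [p1, p2, e1, inv_smul_smul₀ ht.1.ne']
      abel
  have hderiv : ∀ v ∈ A, HasFDerivWithinAt G (G' v) A v := by
    intro v hv
    have d1 : HasFDerivAt (fun v : E (d + 1) => ⟪v, e⟫) (innerSL ℝ e) v := by
      have := (innerSL ℝ e).hasFDerivAt (x := v)
      refine this.congr_of_eventuallyEq (Eventually.of_forall fun z => ?_)
      simp [real_inner_comm]
    have d2 : HasFDerivAt (fun v => Φ (p v) - x₀) ((fderiv ℝ Φ (p v)).comp p) v := by
      have := (((h.fderiv_spec hK hv.1.1).1.differentiableAt (by simp)).hasFDerivAt).comp v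
        (p.hasFDerivAt (x := v))
      exact this.sub_const x₀
    exact ((d1.smul d2).const_add x₀).hasFDerivWithinAt
  set g : E (d + 1) → ℝ≥0∞ := fun y => ‖curvatureKernel K s x₀ y‖ₑ with hg
  have hgm : Measurable g := (hK.measurable_curvatureKernel s x₀).enorm
  have hn := hK.measurable_outerUnitNormal
  set N : E (d + 1) → ℝ := fun y => |⟪y - x₀, outerUnitNormal K y⟫| with hN
  have hNm : Measurable N := by simp only [hN]; fun_prop
  set H : E (d + 1) → ℝ≥0∞ := A.indicator fun v => ENNReal.ofReal (2 * ⟪v, e⟫ ^ d * N (Φ (p v)))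
    with hH
  have hHm : Measurable H := by
    refine Measurable.indicator ?_ hAm
    have h1 : Measurable fun v => N (Φ (p v)) := hNm.comp hΦp
    exact (Measurable.mul (by fun_prop) h1).ennreal_ofReal
  calc volume (shadow x₀ ρ S) ≤ volume (G '' A) := measure_mono hsub
    _ ≤ ∫⁻ v in A, ENNReal.ofReal |(G' v).det| :=
        addHaar_image_le_lintegral_abs_det_fderiv volume hAm hderiv
    _ ≤ ∫⁻ v in A, ENNReal.ofReal (2 * ⟪v, e⟫ ^ d * N (Φ (p v))) := by
        refine setLIntegral_mono' hAm fun v hv => ENNReal.ofReal_le_ofReal ?_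
        have h1 := h.half_le_inner _ hv.1.1
        have h0 : 0 ≤ ⟪v, e⟫ := zero_le_one.trans hv.2.1
        have hsp := (h.fderiv_spec hK hv.1.1).2
        rw [h.frame.det_cone (by linarith [hv.2.1]) (fun v => (hsp v).1) (fun v => (hsp v).2)
          (by linarith), abs_mul, abs_div, abs_of_nonneg (pow_nonneg h0 d),
          abs_of_nonneg (by linarith : 0 ≤ ⟪outerUnitNormal K (Φ (p v)), e⟫)]
        have : |⟪Φ (p v) - x₀, outerUnitNormal K (Φ (p v))⟫| /
            ⟪outerUnitNormal K (Φ (p v)), e⟫ ≤ 2 * N (Φ (p v)) := by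
          rw [div_le_iff₀ (by linarith)]
          have : 0 ≤ N (Φ (p v)) := abs_nonneg _
          simp only [hN] at this ⊢
          nlinarith
        calc _ ≤ ⟪v, e⟫ ^ d * (2 * N (Φ (p v))) := by gcongr
          _ = _ := by ring
    _ = ∫⁻ v, H v := (lintegral_indicator hAm _).symm
    _ = ∫⁻ w : E d × ℝ, H (J w.1 + w.2 • e) := (h.frame.measurePreserving.lintegral_comp hHm).symm
    _ = ∫⁻ u, ∫⁻ t, H (J u + t • e) := by
        exact lintegral_prod _ (hHm.comp h.frame.measurePreserving.measurable).aemeasurable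
    _ ≤ ∫⁻ u, (Metric.ball 0 r).indicator
          (fun u => ENNReal.ofReal (2 * ρ ^ ((d : ℝ) + 1 + s)) * S.indicator g (Φ u)) u := by
        refine lintegral_mono fun u => ?_
        have p1 : ∀ t : ℝ, p (J u + t • e) = u := fun t => by
          rw [map_add, map_smul, h.frame.proj_apply, h.frame.proj_axis, smul_zero, add_zero]
        have p2 : ∀ t : ℝ, ⟪J u + t • e, e⟫ = t := fun t => by
          rw [inner_add_left, h.frame.inner_left, real_inner_smul_left, real_inner_self_eq_norm_sq,
            h.frame.norm_eq_one]; simp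
        set b := ‖Φ u - x₀‖ with hb
        by_cases hu : (u ∈ Metric.ball 0 r ∧ Φ u ∈ S ∧ Φ u ≠ x₀) ∧ b < ρ
        · obtain ⟨⟨hu1, hu2, hu3⟩, hu4⟩ := hu
          have hb0 : 0 < b := norm_pos_iff.2 (sub_ne_zero.2 hu3)
          rw [indicator_of_mem hu1, indicator_of_mem hu2]
          calc ∫⁻ t, H (J u + t • e) = ∫⁻ t : ℝ, {t : ℝ | 1 ≤ t ∧ t * b < ρ}.indicator
                (fun t => ENNReal.ofReal (2 * t ^ d * N (Φ u))) t := by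
                congr 1; ext t
                by_cases ht : t ∈ {t : ℝ | 1 ≤ t ∧ t * b < ρ}
                · have : J u + t • e ∈ A := by
                    refine ⟨⟨?_, ?_, ?_⟩, ?_, ?_⟩
                    · rwa [p1]
                    · rwa [p1]
                    · rwa [p1]
                    · rw [p2]; exact ht.1
                    · rw [p1, p2]; exact ht.2
                  rw [hH, indicator_of_mem this, indicator_of_mem ht, p1, p2]
                · rw [hH, indicator_of_notMem ht, indicator_of_notMem]
                  rintro ⟨-, h1, h2⟩
                  rw [p1, p2] at h2
                  rw [p2] at h1
                  exact ht ⟨h1, h2⟩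
            _ ≤ ENNReal.ofReal (2 * (ρ / b) ^ (d + 1) * N (Φ u)) := inner_integral_le hb0 hu4
            _ ≤ _ := by
                simp only [hg, curvatureKernel]
                rw [Real.enorm_eq_ofReal_abs, ← ENNReal.ofReal_mul (by positivity)]
                refine ENNReal.ofReal_le_ofReal ?_
                have hNe : |⟪x₀ - Φ u, outerUnitNormal K (Φ u)⟫| = N (Φ u) := by
                  simp only [hN]
                  rw [← abs_neg, ← inner_neg_left, neg_sub]
                have hbe : ‖x₀ - Φ u‖ = b := norm_sub_rev _ _
                rw [abs_div, hNe, hbe, abs_of_nonneg (by positivity : 0 ≤ b ^ ((d : ℝ) + 1 + s))]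
                have hN0 : 0 ≤ N (Φ u) := abs_nonneg _
                -- Since ρ/b > 1, the exponent may be raised by s, which produces the power of the
                -- fractional kernel.
                have e1 : (ρ / b) ^ (d + 1) ≤ (ρ / b) ^ ((d : ℝ) + 1 + s) := by
                  rw [← Real.rpow_natCast]
                  refine Real.rpow_le_rpow_of_exponent_le ((one_le_div hb0).2 hu4.le) ?_
                  push_cast; linarith
                calc 2 * (ρ / b) ^ (d + 1) * N (Φ u) ≤ 2 * (ρ / b) ^ ((d : ℝ) + 1 + s) * N (Φ u) := by
                      gcongr
                  _ = _ := by rw [Real.div_rpow hρ.le hb0.le]; ring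
        · refine (le_of_eq ?_).trans zero_le
          rw [← lintegral_zero (μ := volume (α := ℝ))]
          congr 1; ext t
          apply indicator_of_notMem
          rintro ⟨h1, h2, h3⟩
          rw [p1] at h1 h3
          rw [p2] at h2 h3
          exact hu ⟨h1, lt_of_le_of_lt (le_mul_of_one_le_left (norm_nonneg _) h2) h3⟩
    _ = ENNReal.ofReal (2 * ρ ^ ((d : ℝ) + 1 + s)) *
          ∫⁻ u in Metric.ball 0 r, S.indicator g (Φ u) := by
        rw [lintegral_indicator Metric.isOpen_ball.measurableSet, lintegral_const_mul]
        exact (hgm.indicator hS).comp h.measurable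
    _ ≤ _ := by
        gcongr
        rw [← lintegral_indicator hS]
        exact h.lintegral_le (hgm.indicator hS)

/-- Every boundary point has a graph chart. -/
theorem IsSmoothBody.exists_isGraphChart_small (hK : IsSmoothBody K) :
    ∃ R : ℝ, 0 < R ∧ ∀ x ∈ frontier K, ∃ e J p Φ, IsGraphChart K x R e J p Φ := by
  obtain ⟨L, R, hL, hR, h⟩ := hK.uniform_quadratic
  set R' := min (R / 2) (1 / (20 * L)) with hR'
  have hR'0 : 0 < R' := by positivity
  have h1 : R' ≤ R / 2 := min_le_left _ _
  have h2 : R' * L ≤ 1 / 20 := by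
    have : R' ≤ 1 / (20 * L) := min_le_right _ _
    calc R' * L ≤ 1 / (20 * L) * L := by gcongr
      _ = 1 / 20 := by field_simp
  refine ⟨R' / 2, by positivity, fun x hx => hK.exists_isGraphChart hx hR'0 ?_ ?_⟩
  · rintro y ⟨hy, hyx⟩ z ⟨hz, hzx⟩
    have hd : ‖y - z‖ < 2 * R' := by
      rw [← dist_eq_norm]
      calc dist y z ≤ dist y x + dist z x := dist_triangle_right _ _ _
        _ < R' + R' := add_lt_add hyx hzx
        _ = _ := by ring
    refine (h y hy z hz (by linarith)).2.trans ?_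
    have := norm_nonneg (y - z)
    calc L * ‖y - z‖ ^ 2 = (L * ‖y - z‖) * ‖y - z‖ := by ring
      _ ≤ (1 / 10) * ‖y - z‖ := by gcongr; nlinarith
      _ = _ := by ring
  · rintro y ⟨hy, hyx⟩
    rw [Metric.mem_ball, dist_eq_norm] at hyx
    refine (h y hy x hx (by linarith)).1.trans ?_
    nlinarith

/-- The volume of the shadow of the boundary is controlled by the nonlocal curvature. -/
theorem IsSmoothBody.volume_shadow_le (hK : IsSmoothBody K) (x₀ : E (d + 1)) {s ρ : ℝ}
    (hs : 0 < s) (hρ : 0 < ρ) :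
    volume (shadow x₀ ρ (frontier K)) ≤ ENNReal.ofReal (2 * ρ ^ ((d : ℝ) + 1 + s)) *
      ∫⁻ y, ‖curvatureKernel K s x₀ y‖ₑ ∂(surfaceMeasure K) := by
  set k : E (d + 1) → ℝ≥0∞ := fun y => ‖curvatureKernel K s x₀ y‖ₑ
  obtain ⟨R, hR, hchart⟩ := hK.exists_isGraphChart_small
  -- The estimate is stated for all measurable pieces T so that overlapping charts can be made
  -- disjoint; otherwise the constant would count the charts.
  have main : ∃ S', MeasurableSet S' ∧ frontier K ⊆ S' ∧ ∀ T, MeasurableSet T → T ⊆ frontier K →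
      T ⊆ S' → volume (shadow x₀ ρ T) ≤ ENNReal.ofReal (2 * ρ ^ ((d : ℝ) + 1 + s)) *
        ∫⁻ y in T, k y ∂(surfaceMeasure K) := by
    refine hK.isCompact_frontier.induction_on (p := fun S => ∃ S', MeasurableSet S' ∧ S ⊆ S' ∧
      ∀ T, MeasurableSet T → T ⊆ frontier K → T ⊆ S' → volume (shadow x₀ ρ T) ≤
        ENNReal.ofReal (2 * ρ ^ ((d : ℝ) + 1 + s)) * ∫⁻ y in T, k y ∂(surfaceMeasure K))
      ?_ ?_ ?_ ?_
    · refine ⟨∅, MeasurableSet.empty, Subset.rfl, fun T _ _ hT => ?_⟩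
      rw [subset_empty_iff.1 hT]
      simp [shadow]
    · rintro S T hST ⟨S', h1, h2, h3⟩
      exact ⟨S', h1, hST.trans h2, h3⟩
    · rintro S₁ S₂ ⟨S₁', h1, h2, h3⟩ ⟨S₂', h1', h2', h3'⟩
      refine ⟨S₁' ∪ S₂', h1.union h1', union_subset_union h2 h2', fun T hT hTK hTS => ?_⟩
      have hTu : T = (T ∩ S₁') ∪ (T \ S₁') := (inter_union_sdiff T S₁').symm
      calc volume (shadow x₀ ρ T)
          = volume (shadow x₀ ρ (T ∩ S₁') ∪ shadow x₀ ρ (T \ S₁')) := by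
            rw [← shadow_union, ← hTu]
        _ ≤ volume (shadow x₀ ρ (T ∩ S₁')) + volume (shadow x₀ ρ (T \ S₁')) :=
            measure_union_le _ _
        _ ≤ _ := add_le_add
            (h3 _ (hT.inter h1) (inter_subset_left.trans hTK) inter_subset_right)
            (h3' _ (hT.diff h1) (sdiff_subset.trans hTK)
              fun z hz => (hTS hz.1).resolve_left hz.2)
        _ = _ := by rw [← mul_add, lintegral_inter_add_sdiff k T h1]
    · intro y hy
      obtain ⟨e, J, p, Φ, h⟩ := hchart y hy
      exact ⟨Metric.ball y R, mem_nhdsWithin_of_mem_nhds (Metric.ball_mem_nhds _ hR),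
        Metric.ball y R, Metric.isOpen_ball.measurableSet, Subset.rfl, fun T hT hTK hTS =>
        h.volume_shadow_le hK hs hρ hT ((subset_inter hTK hTS).trans h.cover)⟩
  obtain ⟨S', -, h2, h3⟩ := main
  refine (h3 _ isClosed_frontier.measurableSet Subset.rfl h2).trans ?_
  gcongr
  exact Measure.restrict_le_self

end Cone


/-! ### Comparison of tangent half-spaces through small shadows -/

section Comparison

variable {K : Set (E (d + 1))} {x y : E (d + 1)}

/-- The segment from x to z starts in the interior of K; leaving K before z would cross the boundary
and put z in the shadow. The companion for the outer side is symmetric. -/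
theorem IsSmoothBody.mem_of_inner_neg (hK : IsSmoothBody K) (hx : x ∈ frontier K) {ρ : ℝ}
    {z : E (d + 1)} (hz : z ∈ Metric.ball x ρ) (hzs : z ∉ shadow x ρ (frontier K))
    (hneg : ⟪outerUnitNormal K x, z - x⟫ < 0) : z ∈ K := by
  by_contra hzK
  have hzx : z ≠ x := by rintro rfl; simp at hneg
  have h1 : ∀ᶠ t : ℝ in 𝓝[>] 0, t < 1 := nhdsWithin_le_nhds (gt_mem_nhds one_pos)
  obtain ⟨t, ht, ht1, ht0⟩ :=
    ((hK.eventually_mem_interior hx hneg).and (h1.and self_mem_nhdsWithin)).exists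
  have ht0 : 0 < t := ht0
  obtain ⟨τ, hτ, hmem⟩ := exists_mem_frontier_of_segment (interior_subset ht) hzK
  have hrw : x + t • (z - x) + τ • (z - (x + t • (z - x))) =
      x + (t + τ * (1 - t)) • (z - x) := by module
  rw [hrw] at hmem
  refine hzs ⟨hz, hzx, _, ⟨?_, ?_⟩, hmem⟩
  · nlinarith [mul_nonneg hτ.1 (sub_nonneg.2 ht1.le)]
  · nlinarith [mul_nonneg (sub_nonneg.2 hτ.2) (sub_nonneg.2 ht1.le)]

theorem IsSmoothBody.notMem_of_inner_pos (hK : IsSmoothBody K) (hx : x ∈ frontier K) {ρ : ℝ}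
    {z : E (d + 1)} (hz : z ∈ Metric.ball x ρ) (hzs : z ∉ shadow x ρ (frontier K))
    (hpos : 0 < ⟪outerUnitNormal K x, z - x⟫) : z ∉ K := by
  intro hzK
  have hzx : z ≠ x := by rintro rfl; simp at hpos
  have h1 : ∀ᶠ t : ℝ in 𝓝[>] 0, t < 1 := nhdsWithin_le_nhds (gt_mem_nhds one_pos)
  obtain ⟨t, ht, ht1, ht0⟩ :=
    ((hK.eventually_notMem hx hpos).and (h1.and self_mem_nhdsWithin)).exists
  have ht0 : 0 < t := ht0
  obtain ⟨τ, hτ, hmem⟩ := exists_mem_frontier_of_segment hzK ht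
  have hrw : z + τ • (x + t • (z - x) - z) = x + (1 - τ * (1 - t)) • (z - x) := by module
  rw [hrw] at hmem
  refine hzs ⟨hz, hzx, _, ⟨?_, ?_⟩, hmem⟩
  · nlinarith [mul_nonneg (sub_nonneg.2 hτ.2) (sub_nonneg.2 ht1.le)]
  · nlinarith [mul_nonneg hτ.1 (sub_nonneg.2 ht1.le)]

/-- The unit vector in the direction `n' - n` makes opposite angles with the unit vectors `n` and
`n'`. -/
theorem inner_unit_sub {n n' : E (d + 1)} (hn : ‖n‖ = 1) (hn' : ‖n'‖ = 1) :
    ⟪n, ‖n - n'‖⁻¹ • (n' - n)⟫ = -‖n - n'‖ / 2 ∧ ⟪n', ‖n - n'‖⁻¹ • (n' - n)⟫ = ‖n - n'‖ / 2 := by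
  have hNN : ‖n - n'‖ ^ 2 = 2 - 2 * ⟪n, n'⟫ := by
    rw [norm_sub_sq_real, hn, hn']; ring
  have hττ : ‖n - n'‖⁻¹ * ‖n - n'‖ ^ 2 = ‖n - n'‖ := by
    rcases (norm_nonneg (n - n')).eq_or_lt with h | h
    · rw [← h]; simp
    · field_simp
  constructor
  · rw [real_inner_smul_right, inner_sub_right, real_inner_self_eq_norm_sq, hn]
    have : ⟪n, n'⟫ - 1 ^ 2 = -‖n - n'‖ ^ 2 / 2 := by rw [hNN]; ring
    rw [this, mul_div_assoc', mul_neg, hττ]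
  · rw [real_inner_smul_right, inner_sub_right, real_inner_self_eq_norm_sq, hn',
      real_inner_comm]
    have : 1 ^ 2 - ⟪n, n'⟫ = ‖n - n'‖ ^ 2 / 2 := by rw [hNN]; ring
    rw [this, mul_div_assoc', hττ]

/-- If the shadows of two boundary points are too small to contain a ball of radius `δ`, then the
two tangent half-spaces are `δ`-close. -/
theorem IsSmoothBody.halfspace_comparison (hK : IsSmoothBody K) (hx : x ∈ frontier K)
    (hy : y ∈ frontier K) {m δ : ℝ} (hm : 0 < m) (hδm : δ ≤ m) (hxy : ‖x - y‖ ≤ 2 * m)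
    (hvol : volume (shadow x (8 * m) (frontier K)) + volume (shadow y (8 * m) (frontier K)) <
      volume (Metric.ball (0 : E (d + 1)) δ)) :
    m * ‖outerUnitNormal K x - outerUnitNormal K y‖ ≤ δ ∧
      |⟪x - y, outerUnitNormal K x⟫| ≤ 4 * δ := by
  have nx := hK.norm_outerUnitNormal hx
  have ny := hK.norm_outerUnitNormal hy
  set N := outerUnitNormal K x with hN
  set N' := outerUnitNormal K y with hN'
  set τ := ‖N - N'‖ with hτ
  set c := (2⁻¹ : ℝ) • (x + y) with hc
  set v := τ⁻¹ • (N' - N) with hv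
  set a := ⟪N, y - x⟫ / 2 with ha
  set b := ⟪N', x - y⟫ / 2 with hb
  have hδ : 0 < δ := by
    by_contra! h
    rw [Metric.ball_eq_empty.2 h, measure_empty] at hvol
    exact not_lt_zero hvol
  have hτ0 : 0 ≤ τ := norm_nonneg _
  obtain ⟨hNv, hNv'⟩ := inner_unit_sub nx ny
  have hvn : ‖v‖ ≤ 1 := by
    rw [hv, norm_smul, norm_sub_rev, ← hτ, norm_inv, Real.norm_of_nonneg hτ0]
    exact inv_mul_le_one
  have hcx : c - x = (2⁻¹ : ℝ) • (y - x) := by rw [hc]; module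
  have hcy : c - y = (2⁻¹ : ℝ) • (x - y) := by rw [hc]; module
  have hcx' : ‖c - x‖ = ‖x - y‖ / 2 := by
    rw [hcx, norm_smul, norm_sub_rev]; norm_num; ring
  have hcy' : ‖c - y‖ = ‖x - y‖ / 2 := by
    rw [hcy, norm_smul]; norm_num; ring
  have hab : |a + b| ≤ m * τ := by
    have : a + b = ⟪N - N', y - x⟫ / 2 := by
      rw [ha, hb, inner_sub_left, ← neg_sub y x, inner_neg_right]; ring
    rw [this, abs_div, abs_two, div_le_iff₀ two_pos]
    refine (abs_real_inner_le_norm _ _).trans ?_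
    rw [← hτ, norm_sub_rev y x]
    nlinarith
  obtain ⟨hab1, hab2⟩ := abs_le.1 hab
  -- A δ-ball on which the two half-spaces disagree would be covered by the two shadows, against the
  -- volume bound. With |l| ≤ 4m it stays within m + 4m + δ ≤ 6m of both points, inside the balls of
  -- radius 8m.
  have hnot : ∀ l : ℝ, |l| ≤ 4 * m → ¬ ((∀ w : E (d + 1), ‖w‖ < δ →
      (⟪N, c + l • v + w - x⟫ < 0 ∧ 0 < ⟪N', c + l • v + w - y⟫) ∨
      (0 < ⟪N, c + l • v + w - x⟫ ∧ ⟪N', c + l • v + w - y⟫ < 0))) := by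
    intro l hl hcon
    have hsub : Metric.ball (c + l • v) δ ⊆
        shadow x (8 * m) (frontier K) ∪ shadow y (8 * m) (frontier K) := by
      intro z hz
      by_contra hzs
      rw [mem_union, not_or] at hzs
      rw [Metric.mem_ball, dist_eq_norm] at hz
      have hlv : ‖l • v‖ ≤ 4 * m := by
        rw [norm_smul, Real.norm_eq_abs]
        nlinarith [norm_nonneg v, abs_nonneg l]
      have hzx : z ∈ Metric.ball x (8 * m) := by
        rw [Metric.mem_ball, dist_eq_norm]
        have : z - x = (z - (c + l • v)) + l • v + (c - x) := by abel
        rw [this]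
        refine (norm_add₃_le).trans_lt ?_
        linarith
      have hzy : z ∈ Metric.ball y (8 * m) := by
        rw [Metric.mem_ball, dist_eq_norm]
        have : z - y = (z - (c + l • v)) + l • v + (c - y) := by abel
        rw [this]
        refine (norm_add₃_le).trans_lt ?_
        linarith
      have h := hcon (z - (c + l • v)) hz
      rw [add_sub_cancel] at h
      rcases h with ⟨h1, h2⟩ | ⟨h1, h2⟩
      · exact hK.notMem_of_inner_pos hy hzy hzs.2 h2 (hK.mem_of_inner_neg hx hzx hzs.1 h1)
      · exact hK.notMem_of_inner_pos hx hzx hzs.1 h1 (hK.mem_of_inner_neg hy hzy hzs.2 h2)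
    have h1 := (measure_mono (μ := volume) hsub).trans (measure_union_le _ _)
    rw [Measure.addHaar_ball_center] at h1
    exact absurd h1 (not_le.2 hvol)
  have ex : ∀ (l : ℝ) (w : E (d + 1)), ⟪N, c + l • v + w - x⟫ = a - l * τ / 2 + ⟪N, w⟫ := by
    intro l w
    have : c + l • v + w - x = (c - x) + l • v + w := by abel
    rw [this, hcx, inner_add_right, inner_add_right, real_inner_smul_right, real_inner_smul_right,
      hNv, ha]
    ring
  have ey : ∀ (l : ℝ) (w : E (d + 1)), ⟪N', c + l • v + w - y⟫ = b + l * τ / 2 + ⟪N', w⟫ := by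
    intro l w
    have : c + l • v + w - y = (c - y) + l • v + w := by abel
    rw [this, hcy, inner_add_right, inner_add_right, real_inner_smul_right, real_inner_smul_right,
      hNv', hb]
    ring
  have iw : ∀ w : E (d + 1), ‖w‖ < δ → |⟪N, w⟫| < δ ∧ |⟪N', w⟫| < δ := fun w hw =>
    ⟨(abs_real_inner_le_norm _ _).trans_lt (by rwa [nx, one_mul]),
      (abs_real_inner_le_norm _ _).trans_lt (by rwa [ny, one_mul])⟩
  have W1 : ∀ l : ℝ, |l| ≤ 4 * m → ¬ (a - l * τ / 2 ≤ -δ ∧ δ ≤ b + l * τ / 2) := by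
    rintro l hl ⟨h1, h2⟩
    refine hnot l hl fun w hw => Or.inl ?_
    rw [ex, ey]
    obtain ⟨i1, i2⟩ := iw w hw
    exact ⟨by linarith [(abs_lt.1 i1).2], by linarith [(abs_lt.1 i2).1]⟩
  have W2 : ∀ l : ℝ, |l| ≤ 4 * m → ¬ (δ ≤ a - l * τ / 2 ∧ b + l * τ / 2 ≤ -δ) := by
    rintro l hl ⟨h1, h2⟩
    refine hnot l hl fun w hw => Or.inr ?_
    rw [ex, ey]
    obtain ⟨i1, i2⟩ := iw w hw
    exact ⟨by linarith [(abs_lt.1 i1).1], by linarith [(abs_lt.1 i2).2]⟩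
  have hmτ : 0 ≤ m * τ := by positivity
  -- Moving by 4m along v changes the two affine functions by 2mτ in opposite directions, and |a +
  -- b| ≤ mτ supplies the second inequality needed. The sandwich mτ - δ ≤ a ≤ δ - mτ yields both
  -- conclusions.
  have c1 : m * τ - δ ≤ a := by
    by_contra! hlt
    have e4 : 4 * m * τ / 2 = 2 * (m * τ) := by ring
    refine W1 (4 * m) (by rw [abs_of_pos (by linarith)]) ?_
    rw [e4]
    exact ⟨by linarith, by linarith⟩
  have c2 : a ≤ δ - m * τ := by
    by_contra! hlt
    have e4 : -(4 * m) * τ / 2 = -(2 * (m * τ)) := by ring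
    refine W2 (-(4 * m)) (by rw [abs_neg, abs_of_pos (by linarith)]) ?_
    rw [e4]
    exact ⟨by linarith, by linarith⟩
  have hfin : m * τ ≤ δ := by linarith
  refine ⟨hfin, ?_⟩
  have h3 : ⟪x - y, N⟫ = -(2 * a) := by
    rw [ha, real_inner_comm, ← neg_sub y x, inner_neg_right]; ring
  rw [h3, abs_neg, abs_le]
  constructor <;> linarith

end Comparison

/-! ### Hölder bound for the normal at a uniform scale -/

section Bootstrap

variable {K : Set (E (d + 1))} {x y : E (d + 1)}

/-- Hölder bound for the normal and for the distance to the tangent plane, at scales up to `R`. -/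
def NormalHolder (K : Set (E (d + 1))) (M γ R : ℝ) : Prop :=
  ∀ x ∈ frontier K, ∀ y ∈ frontier K, ‖x - y‖ ≤ R →
    ‖outerUnitNormal K x - outerUnitNormal K y‖ ≤ M * ‖x - y‖ ^ γ ∧
      |⟪x - y, outerUnitNormal K x⟫| ≤ M * (‖x - y‖ * ‖x - y‖ ^ γ)

/-- Two points of B_{R/2}(x) are within R of each other, so the Hölder bound gives flatness 1/10 on
that ball; the graph construction halves the radius once more. -/
theorem NormalHolder.exists_isGraphChart (hK : IsSmoothBody K) {M γ R : ℝ} (hM : 0 ≤ M)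
    (hγ : 0 < γ) (hR : 0 < R) (h : NormalHolder K M γ R) (hsmall : M * R ^ γ ≤ 1 / 10)
    (hx : x ∈ frontier K) : ∃ e J p Φ, IsGraphChart K x (R / 4) e J p Φ := by
  have h4 : R / 4 = R / 2 / 2 := by ring
  have hb : ∀ t : ℝ, 0 ≤ t → t ≤ R → M * t ^ γ ≤ 1 / 10 := fun t h0 ht =>
    (mul_le_mul_of_nonneg_left (Real.rpow_le_rpow h0 ht hγ.le) hM).trans hsmall
  rw [h4]
  refine hK.exists_isGraphChart hx (by positivity) ?_ ?_
  · rintro y ⟨hy, hyx⟩ z ⟨hz, hzx⟩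
    have hd : ‖z - y‖ ≤ R := by
      rw [← dist_eq_norm]
      refine (dist_triangle_right z y x).trans ?_
      have h1 : dist y x < R / 2 := hyx
      have h2 : dist z x < R / 2 := hzx
      linarith
    have h1 := (h z hz y hy hd).2
    rw [← neg_sub, inner_neg_left, abs_neg, norm_neg]
    refine h1.trans ?_
    have := hb _ (norm_nonneg _) hd
    have h0 := norm_nonneg (z - y)
    nlinarith
  · rintro y ⟨hy, hyx⟩
    rw [Metric.mem_ball, dist_eq_norm] at hyx
    exact (h y hy x hx (by linarith)).1.trans (hb _ (norm_nonneg _) (by linarith))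

/-- Φ is 2-Lipschitz, so it maps the ball of radius t/2 into B_t(x). This supplies the mass for
Chebyshev's inequality and, later, the lower density. -/
theorem IsGraphChart.volume_ball_le {e : E (d + 1)} {r t : ℝ} {Φ : E d → E (d + 1)}
    {J : E d →ₗᵢ[ℝ] E (d + 1)} {p : E (d + 1) →L[ℝ] E d} (h : IsGraphChart K x r e J p Φ)
    (ht0 : 0 < t) (ht : t ≤ r) :
    volume (Metric.ball (0 : E d) (t / 2)) ≤ surfaceMeasure K (Metric.ball x t) := by
  have hsub : Metric.ball (0 : E d) (t / 2) ⊆ Metric.ball 0 r :=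
    Metric.ball_subset_ball (by linarith)
  refine (h.volume_le hsub).trans ?_
  rw [surfaceMeasure, Measure.restrict_apply Metric.isOpen_ball.measurableSet]
  refine measure_mono ?_
  rintro _ ⟨u, hu, rfl⟩
  refine ⟨?_, h.param.2.2.2.1 (hsub hu)⟩
  have h1 := h.dist_le u (hsub hu) 0 (Metric.mem_ball_self (by linarith))
  rw [h.map_zero] at h1
  rw [Metric.mem_ball] at hu ⊢
  linarith

/-- The volume of the unit ball. -/
def unitBallVolume (n : ℕ) : ℝ := (volume (Metric.ball (0 : E n) 1)).toReal

theorem unitBallVolume_pos (n : ℕ) : 0 < unitBallVolume n :=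
  ENNReal.toReal_pos (Metric.measure_ball_pos volume 0 one_pos).ne' measure_ball_lt_top.ne

theorem volume_ball_eq {n : ℕ} (x : E n) {r : ℝ} (hr : 0 < r) :
    volume (Metric.ball x r) = ENNReal.ofReal (r ^ n * unitBallVolume n) := by
  rw [Measure.addHaar_ball_of_pos volume x hr, unitBallVolume, finrank_euclideanSpace,
    Fintype.card_fin, ENNReal.ofReal_mul (by positivity),
    ENNReal.ofReal_toReal measure_ball_lt_top.ne]

/-- In a ball that carries enough surface measure there is a point of small curvature. -/
theorem exists_fracAbsCurvature_le {c s p Λ V : ℝ} (hp : 0 < p) (hΛ : 0 < Λ) (hV : 0 < V)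
    (hB : bendingEnergy c s p K ≤ ENNReal.ofReal Λ) {t : ℝ}
    (ht : ENNReal.ofReal V ≤ surfaceMeasure K (Metric.ball x t)) :
    ∃ x₀ ∈ frontier K, x₀ ∈ Metric.ball x t ∧
      fracAbsCurvature c s K x₀ ≤ ENNReal.ofReal ((2 * Λ / V) ^ p⁻¹) := by
  by_contra! hcon
  -- Chebyshev; the factor 2 makes the contradiction 2Λ ≤ Λ.
  have h1 : ENNReal.ofReal (2 * Λ / V) * surfaceMeasure K (Metric.ball x t) ≤
      bendingEnergy c s p K := by
    have hm : MeasurableSet (Metric.ball x t ∩ frontier K) :=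
      Metric.isOpen_ball.measurableSet.inter isClosed_frontier.measurableSet
    have hle : surfaceMeasure K (Metric.ball x t) = surfaceMeasure K (Metric.ball x t ∩ frontier K)
      := by
      rw [surfaceMeasure, Measure.restrict_apply Metric.isOpen_ball.measurableSet,
        Measure.restrict_apply hm, inter_assoc, inter_self]
    rw [hle, ← setLIntegral_const, bendingEnergy]
    refine (setLIntegral_mono' hm fun z hz => ?_).trans (setLIntegral_le_lintegral _ _)
    have := (hcon z hz.2 hz.1).le
    have h2 := ENNReal.rpow_le_rpow this hp.le
    rwa [ENNReal.ofReal_rpow_of_nonneg (by positivity) hp.le, Real.rpow_inv_rpow (by positivity)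
      hp.ne'] at h2
  have h2 : ENNReal.ofReal (2 * Λ) ≤ ENNReal.ofReal Λ := by
    calc ENNReal.ofReal (2 * Λ) = ENNReal.ofReal (2 * Λ / V) * ENNReal.ofReal V := by
          rw [← ENNReal.ofReal_mul (by positivity)]; congr 1; field_simp
      _ ≤ _ := by gcongr
      _ ≤ _ := h1.trans hB
  rw [ENNReal.ofReal_le_ofReal_iff hΛ.le] at h2
  linarith

/-- The shadow of the boundary at a point of small curvature. -/
theorem IsSmoothBody.volume_shadow_le_of_fracAbsCurvature (hK : IsSmoothBody K) {c s B ρ : ℝ}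
    (hc : c ≠ 0) (hs : 0 < s) (hρ : 0 < ρ)
    (h : fracAbsCurvature c s K x ≤ ENNReal.ofReal B) :
    volume (shadow x ρ (frontier K)) ≤ ENNReal.ofReal (2 * ρ ^ ((d : ℝ) + 1 + s) * (B / |c|)) := by
  refine (hK.volume_shadow_le x hs hρ).trans ?_
  rw [ENNReal.ofReal_mul (p := 2 * ρ ^ ((d : ℝ) + 1 + s)) (by positivity)]
  gcongr
  have hc' : 0 < |c| := abs_pos.2 hc
  rw [fracAbsCurvature, Real.enorm_eq_ofReal_abs, mul_comm] at h
  rw [ENNReal.ofReal_div_of_pos hc', ENNReal.le_div_iff_mul_le (by simp [hc]) (by simp)]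
  exact h

/-- The volume of the shadows is smaller than the volume of a ball of radius `C ρ ^ (1 + γ)`. -/
theorem shadow_volume_lt {a s p Λ γ κ C ρ w w' : ℝ} (hρ : 0 < ρ) (hκ : 0 < κ) (hΛ : 0 < Λ)
    (hw : 0 < w) (hγs : γ * (d + 1) = s - d / p)
    (hC : 2 * (2 * 8 ^ ((d : ℝ) + 1 + s) * ((2 * Λ / ((κ / 2) ^ d * w)) ^ p⁻¹ / a)) <
      C ^ (d + 1) * w') :
    2 * (8 * ρ) ^ ((d : ℝ) + 1 + s) * ((2 * Λ / ((κ * ρ / 2) ^ d * w)) ^ p⁻¹ / a) +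
      2 * (8 * ρ) ^ ((d : ℝ) + 1 + s) * ((2 * Λ / ((κ * ρ / 2) ^ d * w)) ^ p⁻¹ / a) <
        (C * (ρ * ρ ^ γ)) ^ (d + 1) * w' := by
  have hBe : (2 * Λ / ((κ * ρ / 2) ^ d * w)) ^ p⁻¹ =
      (2 * Λ / ((κ / 2) ^ d * w)) ^ p⁻¹ * ρ ^ (-((d : ℝ) / p)) := by
    have e1 : 2 * Λ / ((κ * ρ / 2) ^ d * w) = 2 * Λ / ((κ / 2) ^ d * w) * ρ ^ (-(d : ℝ)) := by
      have e2 : κ * ρ / 2 = ρ * (κ / 2) := by ring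
      rw [Real.rpow_neg hρ.le, Real.rpow_natCast, e2, mul_pow, div_mul_eq_mul_div,
        ← div_eq_mul_inv, div_div, ← mul_assoc]
    rw [e1, Real.mul_rpow (by positivity) (by positivity), ← Real.rpow_mul hρ.le]
    congr 2; ring
  -- This identity of exponents dictates the choice of γ.
  have hpow : ρ ^ ((d : ℝ) + 1 + s) * ρ ^ (-((d : ℝ) / p)) = (ρ * ρ ^ γ) ^ (d + 1) := by
    rw [← Real.rpow_add hρ, mul_pow, ← Real.rpow_natCast (ρ ^ γ), ← Real.rpow_mul hρ.le,
      ← Real.rpow_natCast ρ, ← Real.rpow_add hρ]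
    congr 1
    push_cast
    rw [hγs]; ring
  have e8 : (8 * ρ) ^ ((d : ℝ) + 1 + s) = 8 ^ ((d : ℝ) + 1 + s) * ρ ^ ((d : ℝ) + 1 + s) :=
    Real.mul_rpow (by norm_num) hρ.le
  have hpos : 0 < (ρ * ρ ^ γ) ^ (d + 1) := by positivity
  calc _ = (2 * (2 * 8 ^ ((d : ℝ) + 1 + s) * ((2 * Λ / ((κ / 2) ^ d * w)) ^ p⁻¹ / a))) *
          (ρ ^ ((d : ℝ) + 1 + s) * ρ ^ (-((d : ℝ) / p))) := by
        rw [hBe, e8]; ring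
    _ < C ^ (d + 1) * w' * (ρ * ρ ^ γ) ^ (d + 1) := by
        rw [hpow]; exact mul_lt_mul_of_pos_right hC hpos
    _ = _ := by rw [mul_pow C]; ring

/-- Transfer of the comparison of two half-spaces to nearby points. -/
theorem normal_comparison_transfer {x y x₀ y₀ n n' m m' : E (d + 1)} {M ρ g : ℝ} (hM : 0 < M)
    (hρ : 0 < ρ) (hg : 0 < g)
    (hyy : ‖y - y₀‖ ≤ ρ / 16) (hxy : ‖x₀ - y₀‖ ≤ 2 * ρ)
    (x1 : ‖n - m‖ ≤ M * g / 10) (y1 : ‖n' - m'‖ ≤ M * g / 10)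
    (x2 : |⟪x - x₀, n⟫| ≤ ρ / 16 * (M * g / 10)) (y2 : |⟪y - y₀, n'⟫| ≤ ρ / 16 * (M * g / 10))
    (k1 : ‖m - m'‖ ≤ M * g / 10) (k2 : |⟪x₀ - y₀, m⟫| ≤ 4 * (ρ * (M * g / 10))) :
    ‖n - n'‖ ≤ M * g ∧ |⟪x - y, n⟫| ≤ M * (ρ * g) := by
  have hMg : 0 < M * g := mul_pos hM hg
  have hn : ‖n - n'‖ ≤ M * g := by
    have : n - n' = (n - m) + (m - m') - (n' - m') := by abel
    rw [this]
    have h1 := norm_sub_le ((n - m) + (m - m')) (n' - m')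
    have h2 := norm_add_le (n - m) (m - m')
    linarith
  refine ⟨hn, ?_⟩
  have e1 : ⟪x - y, n⟫ = ⟪x - x₀, n⟫ + (⟪x₀ - y₀, m⟫ + ⟪x₀ - y₀, n - m⟫) -
      (⟪y - y₀, n'⟫ + ⟪y - y₀, n - n'⟫) := by
    simp only [inner_sub_left, inner_sub_right]; ring
  have b1 : |⟪x₀ - y₀, n - m⟫| ≤ 2 * ρ * (M * g / 10) :=
    (abs_real_inner_le_norm _ _).trans (by gcongr)
  have b2 : |⟪y - y₀, n - n'⟫| ≤ ρ / 16 * (M * g) :=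
    (abs_real_inner_le_norm _ _).trans (by gcongr)
  have hpos : 0 < ρ * (M * g) := by positivity
  have e2 : M * (ρ * g) = ρ * (M * g) := by ring
  rw [e1, e2, abs_le]
  rw [abs_le] at x2 y2 k2 b1 b2
  constructor <;> linarith

/-- One doubling step of the bootstrap for the Hölder bound of the normal. -/
theorem NormalHolder.double (hK : IsSmoothBody K) {c s p Λ γ κ M C R : ℝ} (hc : c ≠ 0)
    (hs : 0 < s) (hp : 0 < p) (hΛ : 0 < Λ) (hB : bendingEnergy c s p K ≤ ENNReal.ofReal Λ)
    (hγ : 0 < γ) (hγs : γ * (d + 1) = s - d / p) (hκ0 : 0 < κ) (hκ : κ ≤ 1 / 16)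
    (hκγ : κ ^ γ ≤ 1 / 10) (hC : 0 < C) (hM : M = 10 * C)
    (hCbig : 2 * (2 * 8 ^ ((d : ℝ) + 1 + s) *
      ((2 * Λ / ((κ / 2) ^ d * unitBallVolume d)) ^ p⁻¹ / |c|)) <
        C ^ (d + 1) * unitBallVolume (d + 1))
    (hR : 0 < R) (hsmall : M * (2 * R) ^ γ ≤ 1 / 10) (h : NormalHolder K M γ R) :
    NormalHolder K M γ (2 * R) := by
  intro x hx y hy hxy
  rcases le_or_gt ‖x - y‖ R with hle | hgt
  · exact h x hx y hy hle
  set ρ := ‖x - y‖ with hρ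
  have hρ0 : 0 < ρ := hR.trans hgt
  have hM0 : 0 < M := by rw [hM]; positivity
  have hκ16 : κ * ρ ≤ ρ / 16 :=
    (mul_le_mul_of_nonneg_right hκ hρ0.le).trans_eq (by ring)
  have hsmallρ : M * ρ ^ γ ≤ 1 / 10 :=
    (mul_le_mul_of_nonneg_left (Real.rpow_le_rpow hρ0.le hxy hγ.le) hM0.le).trans hsmall
  have hsmallR : M * R ^ γ ≤ 1 / 10 :=
    (mul_le_mul_of_nonneg_left (Real.rpow_le_rpow hR.le (by linarith) hγ.le) hM0.le).trans hsmall
  set V := (κ * ρ / 2) ^ d * unitBallVolume d with hV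
  have hω := unitBallVolume_pos d
  have hV0 : 0 < V := by positivity
  set B := (2 * Λ / V) ^ p⁻¹ with hBdef
  have hB0 : 0 ≤ B := by positivity
  -- Charts of radius R/4 are available from the bound at the old scale, and κρ ≤ R/8 because ρ ≤
  -- 2R; so B_{κρ}(z) has mass at least V.
  have good : ∀ z ∈ frontier K, ∃ z₀ ∈ frontier K, z₀ ∈ Metric.ball z (κ * ρ) ∧
      fracAbsCurvature c s K z₀ ≤ ENNReal.ofReal B := by
    intro z hz
    obtain ⟨e, J, P, Φ, hch⟩ := h.exists_isGraphChart hK hM0.le hγ hR hsmallR hz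
    have hv := hch.volume_ball_le (t := κ * ρ) (by positivity) (by linarith)
    rw [volume_ball_eq _ (by positivity)] at hv
    exact exists_fracAbsCurvature_le hp hΛ hV0 hB hv
  obtain ⟨x₀, hx₀, hxx, hAx⟩ := good x hx
  obtain ⟨y₀, hy₀, hyy, hAy⟩ := good y hy
  rw [Metric.mem_ball, dist_comm, dist_eq_norm] at hxx hyy
  set g := ρ ^ γ with hg
  have hg0 : 0 < g := by positivity
  have hκρ : (κ * ρ) ^ γ ≤ g / 10 := by
    rw [Real.mul_rpow hκ0.le hρ0.le]
    exact (mul_le_mul_of_nonneg_right hκγ hg0.le).trans_eq (by ring)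
  have hxy₀ : ‖x₀ - y₀‖ ≤ 2 * ρ := by
    have : x₀ - y₀ = (x - y) - (x - x₀) + (y - y₀) := by abel
    rw [this]
    refine (norm_add_le _ _).trans ?_
    have := norm_sub_le (x - y) (x - x₀)
    linarith
  -- As M = 10C, the half-space comparison uses only a tenth of the bound to be proved.
  set δ := C * (ρ * g) with hδ
  have hCg : C * g ≤ 1 := by
    rw [hM] at hsmallρ; linarith
  have hshadow : ∀ z, fracAbsCurvature c s K z ≤ ENNReal.ofReal B →
      volume (shadow z (8 * ρ) (frontier K)) ≤
        ENNReal.ofReal (2 * (8 * ρ) ^ ((d : ℝ) + 1 + s) * (B / |c|)) := fun z hz =>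
    hK.volume_shadow_le_of_fracAbsCurvature hc hs (by positivity) hz
  have hvol : volume (shadow x₀ (8 * ρ) (frontier K)) +
      volume (shadow y₀ (8 * ρ) (frontier K)) < volume (Metric.ball (0 : E (d + 1)) δ) := by
    refine (add_le_add (hshadow x₀ hAx) (hshadow y₀ hAy)).trans_lt ?_
    rw [volume_ball_eq _ (by positivity), ← ENNReal.ofReal_add (by positivity) (by positivity)]
    have hω' := unitBallVolume_pos (d + 1)
    exact (ENNReal.ofReal_lt_ofReal_iff (by positivity)).2
      (shadow_volume_lt hρ0 hκ0 hΛ hω hγs hCbig)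
  obtain ⟨k1, k2⟩ := hK.halfspace_comparison hx₀ hy₀ hρ0 (by
    calc C * (ρ * g) = ρ * (C * g) := by ring
      _ ≤ ρ := mul_le_of_le_one_right hρ0.le hCg) hxy₀ hvol
  have hC' : C = M / 10 := by rw [hM]; ring
  have k1' : ‖outerUnitNormal K x₀ - outerUnitNormal K y₀‖ ≤ M * g / 10 := by
    rw [hδ, hC'] at k1
    exact le_of_mul_le_mul_left (by linarith) hρ0
  have hκR : κ * ρ ≤ R := by linarith
  -- Passing between the given points and the good ones uses the old bound at distance κρ ≤ R, where
  -- κ^γ ≤ 1/10 again costs only a tenth. This is why M does not grow in the doubling.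
  have near : ∀ a ∈ frontier K, ∀ b ∈ frontier K, ‖a - b‖ < κ * ρ →
      ‖outerUnitNormal K a - outerUnitNormal K b‖ ≤ M * g / 10 ∧
      |⟪a - b, outerUnitNormal K a⟫| ≤ ρ / 16 * (M * g / 10) := by
    intro a ha b hb hab
    obtain ⟨n1, n2⟩ := h a ha b hb (hab.le.trans hκR)
    have n3 : ‖a - b‖ ^ γ ≤ g / 10 := (Real.rpow_le_rpow (norm_nonneg _) hab.le hγ.le).trans hκρ
    have n4 : ‖a - b‖ ≤ ρ / 16 := hab.le.trans hκ16
    refine ⟨n1.trans ?_, n2.trans ?_⟩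
    · rw [mul_div_assoc]; gcongr
    · calc M * (‖a - b‖ * ‖a - b‖ ^ γ) ≤ M * (ρ / 16 * (g / 10)) := by gcongr
        _ = _ := by ring
  obtain ⟨x1, x2⟩ := near x hx x₀ hx₀ hxx
  obtain ⟨y1, y2⟩ := near y hy y₀ hy₀ hyy
  refine normal_comparison_transfer hM0 hρ0 hg0 (hyy.le.trans hκ16) hxy₀
    x1 y1 x2 y2 k1' (k2.trans_eq ?_)
  rw [hδ, hC']; ring

/-- A bound on the bending energy gives graph charts at a uniform scale. -/
theorem exists_uniform_isGraphChart (d : ℕ) {c s p Λ : ℝ} (hc : c ≠ 0) (hs : 0 < s) (hs1 : s < 1)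
    (hp : (d : ℝ) / s < p) (hp0 : 0 < p) (hΛ : 0 < Λ) :
    ∃ r : ℝ, 0 < r ∧ ∀ K : Set (E (d + 1)), IsSmoothBody K →
      bendingEnergy c s p K ≤ ENNReal.ofReal Λ →
      ∀ x ∈ frontier K, ∃ e J P Φ, IsGraphChart K x r e J P Φ := by
  set γ := (s - d / p) / (d + 1) with hγdef
  have hdp : (d : ℝ) / p < s := by
    rw [div_lt_iff₀ hs] at hp
    rw [div_lt_iff₀ hp0]; linarith
  have hγ : 0 < γ := div_pos (by linarith) (by positivity)
  have hγs : γ * (d + 1) = s - d / p := by rw [hγdef]; field_simp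
  have hγ1 : γ < 1 := by
    rw [hγdef, div_lt_one (by positivity)]
    have : 0 ≤ (d : ℝ) / p := by positivity
    have : (0 : ℝ) ≤ d := by positivity
    linarith
  set κ : ℝ := min (1 / 16) ((1 / 10) ^ γ⁻¹) with hκdef
  have hκ0 : 0 < κ := by positivity
  have hκγ : κ ^ γ ≤ 1 / 10 := by
    refine (Real.rpow_le_rpow hκ0.le (min_le_right _ _) hγ.le).trans_eq ?_
    rw [Real.rpow_inv_rpow (by norm_num) hγ.ne']
  set Q := 2 * (2 * 8 ^ ((d : ℝ) + 1 + s) *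
      ((2 * Λ / ((κ / 2) ^ d * unitBallVolume d)) ^ p⁻¹ / |c|)) with hQ
  have hω := unitBallVolume_pos d
  have hω' := unitBallVolume_pos (d + 1)
  have hQ0 : 0 ≤ Q := by positivity
  obtain ⟨C, hC, hCQ⟩ : ∃ C : ℝ, 0 < C ∧ Q < C ^ (d + 1) * unitBallVolume (d + 1) := by
    refine ⟨Q / unitBallVolume (d + 1) + 1, by positivity, ?_⟩
    calc Q < (Q / unitBallVolume (d + 1) + 1) * unitBallVolume (d + 1) := by
          rw [add_mul, div_mul_cancel₀ _ hω'.ne']; linarith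
      _ ≤ _ := by
          gcongr
          exact le_self_pow₀ (by linarith [div_nonneg hQ0 hω'.le]) (by simp)
  set M := 10 * C with hM
  set r₀ := (1 / (10 * M)) ^ γ⁻¹ with hr₀
  have hM0 : 0 < M := by positivity
  have hr₀0 : 0 < r₀ := by positivity
  have hr₀γ : M * r₀ ^ γ = 1 / 10 := by
    rw [hr₀, Real.rpow_inv_rpow (by positivity) hγ.ne']; field_simp
  have hsm : ∀ t : ℝ, 0 ≤ t → t ≤ r₀ → M * t ^ γ ≤ 1 / 10 := fun t h0 ht =>
    (mul_le_mul_of_nonneg_left (Real.rpow_le_rpow h0 ht hγ.le) hM0.le).trans_eq hr₀γ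
  refine ⟨r₀ / 2 / 4, by positivity, fun K hK hB x hx => ?_⟩
  obtain ⟨L, R, hL, hR, hLR⟩ := hK.uniform_quadratic
  -- Start of the induction: the Lipschitz bound L t is below M t^γ once t ≤ (M/L)^(1/(1-γ)). This
  -- scale depends on K, the final one does not.
  obtain ⟨R₁, hR₁, hR₁r, hP₁⟩ : ∃ R₁, 0 < R₁ ∧ R₁ ≤ r₀ ∧ NormalHolder K M γ R₁ := by
    have hγ1' : 0 < 1 - γ := by linarith
    set R₂ := (M / L) ^ (1 - γ)⁻¹ with hR₂
    have hR₂0 : 0 < R₂ := by positivity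
    refine ⟨min (min (R / 2) r₀) R₂, by positivity,
      (min_le_left _ _).trans (min_le_right _ _), fun a ha b hb hab => ?_⟩
    have l1 : ‖a - b‖ < R := by
      have := hab.trans ((min_le_left _ _).trans (min_le_left _ _)); linarith
    have l2 : ‖a - b‖ ≤ R₂ := hab.trans (min_le_right _ _)
    have h0 := norm_nonneg (a - b)
    have l3 : L * ‖a - b‖ ≤ M * ‖a - b‖ ^ γ := by
      rcases h0.eq_or_lt with h00 | h00
      · rw [← h00, Real.zero_rpow hγ.ne']; simp
      have e1 : ‖a - b‖ = ‖a - b‖ ^ (1 - γ) * ‖a - b‖ ^ γ := by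
        rw [← Real.rpow_add h00]; simp
      have e2 : ‖a - b‖ ^ (1 - γ) ≤ M / L := by
        refine (Real.rpow_le_rpow h0 l2 hγ1'.le).trans_eq ?_
        rw [hR₂, Real.rpow_inv_rpow (by positivity) hγ1'.ne']
      calc L * ‖a - b‖ = L * (‖a - b‖ ^ (1 - γ) * ‖a - b‖ ^ γ) := by rw [← e1]
        _ ≤ L * (M / L * ‖a - b‖ ^ γ) := by gcongr
        _ = _ := by field_simp
    refine ⟨(hLR a ha b hb l1).1.trans l3, ?_⟩
    have := (hLR b hb a ha (by rwa [norm_sub_rev])).2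
    rw [← neg_sub, inner_neg_left, abs_neg, norm_neg]
    rw [norm_sub_rev] at l3
    refine this.trans ?_
    nlinarith [norm_nonneg (b - a)]
  have hiter : ∀ k : ℕ, 2 ^ k * R₁ ≤ r₀ → NormalHolder K M γ (2 ^ k * R₁) := by
    intro k
    induction k with
    | zero => intro _; simpa using hP₁
    | succ k ih =>
      intro hk
      have e1 : (2 : ℝ) ^ (k + 1) * R₁ = 2 * (2 ^ k * R₁) := by ring
      rw [e1] at hk ⊢
      have hpos : 0 < 2 ^ k * R₁ := by positivity
      exact (ih (by linarith)).double hK hc hs hp0 hΛ hB hγ hγs hκ0 (min_le_left _ _) hκγ hC hM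
        hCQ hpos (hsm _ (by positivity) hk)
  -- Dyadic multiples of an arbitrary starting scale need not hit r₀, hence the loss of a factor 2.
  obtain ⟨k, hk1, hk2⟩ : ∃ k : ℕ, 2 ^ k * R₁ ≤ r₀ ∧ r₀ / 2 ≤ 2 ^ k * R₁ := by
    obtain ⟨k, hk1, hk2⟩ := exists_nat_pow_near (x := r₀ / R₁) (y := (2 : ℝ))
      ((one_le_div hR₁).2 hR₁r) one_lt_two
    refine ⟨k, (le_div_iff₀ hR₁).1 hk1, ?_⟩
    have := (div_lt_iff₀ hR₁).1 hk2
    rw [pow_succ] at this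
    linarith
  have hfin : NormalHolder K M γ (r₀ / 2) := fun a ha b hb hab =>
    hiter k hk1 a ha b hb (hab.trans hk2)
  exact hfin.exists_isGraphChart hK hM0.le hγ (by positivity)
    (hsm _ (by positivity) (by linarith)) hx

end Bootstrap


/-! ### Optimizing an interpolation inequality over the scale -/

section RealOptimization

/-- Interpolation inequality obtained by optimizing over the scale `t`. -/
theorem rpow_le_of_forall_scale {A t₀ θ F D n T : ℝ} (hA : 0 ≤ A) (ht₀ : 0 < t₀) (hθ0 : 0 < θ)
    (hθ1 : θ < 1) (hF : 0 ≤ F) (hD : 0 ≤ D) (hn : 0 < n) (hT : 0 ≤ T)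
    (h1 : ∀ t, 0 < t → t ≤ t₀ → F ≤ A * (t ^ θ * D + t ^ (θ - 1) * n))
    (h2 : F ≤ A * (D + T)) :
    F ^ (1 - θ)⁻¹ ≤ (2 * A) ^ (1 - θ)⁻¹ * (1 + t₀ ^ (1 - (1 - θ)⁻¹)) *
      (n ^ ((1 - θ)⁻¹ - 1) * D) + (2 * A) ^ ((1 - θ)⁻¹ - 1) * (T ^ ((1 - θ)⁻¹ - 1) * F) := by
  have hθ : 0 < 1 - θ := by linarith
  set κ := (1 - θ)⁻¹ with hκ
  have hκ1 : 1 < κ := by rw [hκ]; exact (one_lt_inv₀ hθ).2 (by linarith)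
  have hκ0 : 0 < κ := by linarith
  have hθκ : θ * κ = κ - 1 := by
    rw [hκ]; field_simp; ring
  have hθκ' : (1 - θ) * κ = 1 := by rw [hκ]; field_simp
  -- The two terms balance at t = n/D. If this exceeds t₀, the bound at full scale is used, and
  -- either T or D dominates there; in the latter case D < n/t₀ restores the form wanted.
  rcases le_or_gt n (t₀ * D) with hcase | hcase
  · have hDpos : 0 < D := by
      by_contra! h
      have := mul_nonpos_of_nonneg_of_nonpos ht₀.le h
      linarith
    have h3 := h1 (n / D) (by positivity) (by rw [div_le_iff₀ hDpos]; exact hcase)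
    have e1 : (n / D) ^ θ * D = n ^ θ * D ^ (1 - θ) := by
      rw [Real.div_rpow hn.le hD, Real.rpow_sub hDpos, Real.rpow_one]; field_simp
    have e2 : (n / D) ^ (θ - 1) * n = n ^ θ * D ^ (1 - θ) := by
      rw [Real.div_rpow hn.le hD, ← neg_sub 1 θ, Real.rpow_neg hn.le, Real.rpow_neg hD,
        Real.rpow_sub hn, Real.rpow_one]
      field_simp
    rw [e1, e2] at h3
    have h4 : F ≤ 2 * A * (n ^ θ * D ^ (1 - θ)) := by linarith
    have h5 := Real.rpow_le_rpow hF h4 hκ0.le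
    rw [Real.mul_rpow (x := 2 * A) (by positivity) (by positivity),
      Real.mul_rpow (x := n ^ θ) (by positivity) (by positivity), ← Real.rpow_mul hn.le, ← Real.rpow_mul hD, hθκ, hθκ', Real.rpow_one] at h5
    have p1 : 0 ≤ (2 * A) ^ κ * t₀ ^ (1 - κ) * (n ^ (κ - 1) * D) := by positivity
    have p2 : 0 ≤ (2 * A) ^ (κ - 1) * (T ^ (κ - 1) * F) := by positivity
    calc F ^ κ ≤ (2 * A) ^ κ * (n ^ (κ - 1) * D) := h5
      _ ≤ _ := by rw [mul_add, mul_one, add_mul]; linarith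
  · rcases le_or_gt F (2 * A * T) with hFT | hFT
    · have h5 : F ^ κ ≤ (2 * A) ^ (κ - 1) * (T ^ (κ - 1) * F) := by
        rcases hF.eq_or_lt with h0 | h0
        · rw [← h0, Real.zero_rpow hκ0.ne']; simp
        calc F ^ κ = F ^ (κ - 1) * F := by
              rw [← Real.rpow_add_one h0.ne']; congr 1; ring
          _ ≤ (2 * A * T) ^ (κ - 1) * F := by
              gcongr
          _ = _ := by rw [Real.mul_rpow (by positivity) hT]; ring
      have p1 : 0 ≤ (2 * A) ^ κ * (1 + t₀ ^ (1 - κ)) * (n ^ (κ - 1) * D) := by positivity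
      linarith
    · have h3 : F ≤ 2 * A * D := by
        rcases le_or_gt D T with h | h
        · have := mul_le_mul_of_nonneg_left h hA
          linarith
        · have := mul_le_mul_of_nonneg_left h.le hA
          linarith
      have hDn : D ≤ t₀⁻¹ * n := by
        rw [inv_mul_eq_div, le_div_iff₀ ht₀]; linarith
      have h5 : F ^ κ ≤ (2 * A) ^ κ * t₀ ^ (1 - κ) * (n ^ (κ - 1) * D) := by
        rcases hD.eq_or_lt with h0 | h0
        · rw [← h0] at h3 ⊢
          have : F = 0 := by linarith
          rw [this, Real.zero_rpow hκ0.ne']; simp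
        calc F ^ κ ≤ (2 * A * D) ^ κ := by gcongr
          _ = (2 * A) ^ κ * (D ^ (κ - 1) * D) := by
              rw [Real.mul_rpow (by positivity) hD, ← Real.rpow_add_one h0.ne']
              congr 2; ring
          _ ≤ (2 * A) ^ κ * ((t₀⁻¹ * n) ^ (κ - 1) * D) := by
              gcongr
          _ = _ := by
              rw [Real.mul_rpow (by positivity) hn.le, Real.inv_rpow ht₀.le, ← Real.rpow_neg ht₀.le,
                neg_sub]; ring
      have p1 : 0 ≤ (2 * A) ^ κ * 1 * (n ^ (κ - 1) * D) := by positivity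
      have p2 : 0 ≤ (2 * A) ^ (κ - 1) * (T ^ (κ - 1) * F) := by positivity
      rw [mul_add, add_mul]
      linarith

end RealOptimization

/-! ### Hölder and Jensen inequalities for powers -/

section Lebesgue

variable {X : Type*} [MeasurableSpace X] {μ : Measure X}

theorem eLpNorm_ofReal_eq {F : Type*} [NormedAddCommGroup F] {q : ℝ} (hq : 0 < q) (f : X → F) :
    eLpNorm f (ENNReal.ofReal q) μ = (∫⁻ x, ‖f x‖ₑ ^ q ∂μ) ^ q⁻¹ := by
  rw [eLpNorm_eq_lintegral_rpow_enorm_toReal (by simpa using hq) ENNReal.ofReal_ne_top,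
    ENNReal.toReal_ofReal hq.le, one_div]

theorem eLpNorm_ofReal_rpow {F : Type*} [NormedAddCommGroup F] {q : ℝ} (hq : 0 < q) (f : X → F) :
    eLpNorm f (ENNReal.ofReal q) μ ^ q = ∫⁻ x, ‖f x‖ₑ ^ q ∂μ := by
  rw [eLpNorm_ofReal_eq hq, ENNReal.rpow_inv_rpow hq.ne']

/-- Hölder's inequality on a set. -/
theorem setLIntegral_rpow_le {f : X → ℝ} (hf : AEStronglyMeasurable f μ) {q Q : ℝ} (hq : 0 < q)
    (hqQ : q ≤ Q) (B : Set X) :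
    ∫⁻ x in B, ‖f x‖ₑ ^ q ∂μ ≤ (∫⁻ x, ‖f x‖ₑ ^ Q ∂μ) ^ (q / Q) * μ B ^ (1 - q / Q) := by
  have hQ : 0 < Q := hq.trans_le hqQ
  have h := eLpNorm'_le_eLpNorm'_mul_rpow_measure_univ hq hqQ (hf.restrict (s := B))
  rw [eLpNorm', eLpNorm', Measure.restrict_apply_univ] at h
  have h2 := ENNReal.rpow_le_rpow h hq.le
  rw [one_div, ENNReal.rpow_inv_rpow hq.ne', ENNReal.mul_rpow_of_nonneg _ _ hq.le,
    ← ENNReal.rpow_mul, ← ENNReal.rpow_mul] at h2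
  have e1 : 1 / Q * q = q / Q := by ring
  have e2 : (q⁻¹ - 1 / Q) * q = 1 - q / Q := by field_simp
  rw [e1, e2] at h2
  refine h2.trans ?_
  gcongr
  exact Measure.restrict_le_self

/-- Jensen's inequality for powers. -/
theorem lintegral_rpow_le_of_isProbabilityMeasure [IsProbabilityMeasure μ] {g : X → ℝ≥0∞}
    (hg : AEMeasurable g μ) {q : ℝ} (hq : 1 ≤ q) : (∫⁻ x, g x ∂μ) ^ q ≤ ∫⁻ x, g x ^ q ∂μ := by
  have hq0 : 0 < q := by linarith
  have h := eLpNorm'_le_eLpNorm'_of_exponent_le one_pos hq μ hg.aestronglyMeasurable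
  rw [eLpNorm', eLpNorm'] at h
  simp only [enorm_eq_self, ENNReal.rpow_one, div_one] at h
  have h2 := ENNReal.rpow_le_rpow h hq0.le
  rwa [one_div, ENNReal.rpow_inv_rpow hq0.ne'] at h2

end Lebesgue

/-! ### Fractional Sobolev inequality from lower density -/

section FractionalSobolev

variable {n : ℕ} {σ : Measure (E n)} {S : Set (E n)}

/-- The Gagliardo energy density of `f` at `x`. -/
def gagliardoDensity (σ : Measure (E n)) (κ q : ℝ) (f : E n → ℝ) (x : E n) : ℝ≥0∞ :=
  ∫⁻ y, ‖f x - f y‖ₑ ^ q / ‖x - y‖ₑ ^ κ ∂σ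

/-- On the ball |x - y|^κ ≤ r^κ, and the integrand vanishes at y = x, where the quotient is
degenerate. -/
theorem setLIntegral_sub_rpow_le {κ q r : ℝ} (hκ : 0 < κ) (hq : 0 < q) (f : E n → ℝ)
    (x : E n) :
    ∫⁻ y in Metric.closedBall x r, ‖f x - f y‖ₑ ^ q ∂σ ≤
      ENNReal.ofReal r ^ κ * gagliardoDensity σ κ q f x := by
  rw [gagliardoDensity, ← lintegral_const_mul' _ _
    (ENNReal.rpow_ne_top_of_nonneg hκ.le ENNReal.ofReal_ne_top)]
  refine (setLIntegral_mono' Metric.isClosed_closedBall.measurableSet fun y hy => ?_).trans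
    (setLIntegral_le_lintegral _ _)
  rcases eq_or_ne x y with rfl | hxy
  · simp [hq]
  have h0 : ‖x - y‖ₑ ≠ 0 := by simpa [sub_eq_zero] using hxy
  have h1 : ‖x - y‖ₑ ^ κ ≠ 0 := by simp [h0]
  have h2 : ‖x - y‖ₑ ^ κ ≠ ⊤ := ENNReal.rpow_ne_top_of_nonneg hκ.le (by simp)
  have h3 : ‖x - y‖ₑ ≤ ENNReal.ofReal r := by
    rw [← ofReal_norm]
    refine ENNReal.ofReal_le_ofReal ?_
    rw [Metric.mem_closedBall, dist_comm, dist_eq_norm] at hy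
    exact hy
  calc ‖f x - f y‖ₑ ^ q = ‖x - y‖ₑ ^ κ * (‖f x - f y‖ₑ ^ q / ‖x - y‖ₑ ^ κ) :=
        (ENNReal.mul_div_cancel h1 h2).symm
    _ ≤ _ := by gcongr

/-- Lower density of a measure on a set: balls of radius at most `r₀` around points of the set have
measure at least `c r ^ d`. -/
def LowerDensity (σ : Measure (E n)) (S : Set (E n)) (d : ℕ) (c r₀ : ℝ) : Prop :=
  ∀ x ∈ S, ∀ r : ℝ, 0 < r → r ≤ r₀ → ENNReal.ofReal (c * r ^ d) ≤ σ (Metric.closedBall x r)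

theorem measure_mul_rpow_le (f : E n → ℝ) (hf : Measurable f) {q : ℝ} (hq : 1 ≤ q) (x : E n)
    (r : ℝ) :
    σ (Metric.closedBall x r) * ‖f x‖ₑ ^ q ≤
      2 ^ q * (∫⁻ y in Metric.closedBall x r, ‖f x - f y‖ₑ ^ q ∂σ +
        ∫⁻ y in Metric.closedBall x r, ‖f y‖ₑ ^ q ∂σ) := by
  have hm : Measurable fun y => ‖f x - f y‖ₑ ^ q := by fun_prop
  rw [mul_comm, ← setLIntegral_const, ← lintegral_add_left hm, ← lintegral_const_mul]
  · refine lintegral_mono fun y => ?_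
    calc ‖f x‖ₑ ^ q = ‖(f x - f y) + f y‖ₑ ^ q := by rw [sub_add_cancel]
      _ ≤ (‖f x - f y‖ₑ + ‖f y‖ₑ) ^ q := by gcongr; exact enorm_add_le _ _
      _ ≤ 2 ^ (q - 1) * (‖f x - f y‖ₑ ^ q + ‖f y‖ₑ ^ q) :=
          ENNReal.rpow_add_le_mul_rpow_add_rpow _ _ hq
      _ ≤ _ := by
          gcongr
          · exact one_le_two
          · linarith
  · fun_prop

/-- Pointwise bounds at a given scale. -/
theorem rpow_le_scale [IsFiniteMeasure σ] {d : ℕ} {c r₀ α q : ℝ} (hd : 0 < d) (hc : 0 < c)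
    (hα : 0 < α) (hq : 1 ≤ q) (hqd : α * q < d) (hdens : LowerDensity σ S d c r₀) {f : E n → ℝ}
    (hf : Measurable f) {x : E n} (hx : x ∈ S) {r : ℝ} (hr0 : 0 < r) (hr : r ≤ r₀) {D N T : ℝ}
    (hD0 : 0 ≤ D) (hN0 : 0 ≤ N) (hT0 : 0 ≤ T)
    (hD : gagliardoDensity σ ((d : ℝ) + α * q) q f x = ENNReal.ofReal D)
    (hN : (∫⁻ y, ‖f y‖ₑ ^ (d * q / (d - α * q)) ∂σ) ^ (q / (d * q / (d - α * q))) =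
      ENNReal.ofReal N)
    (hT : ∫⁻ y, ‖f y‖ₑ ^ q ∂σ = ENNReal.ofReal T) :
    |f x| ^ q ≤ 2 ^ q * (c⁻¹ * (r ^ (α * q) * D) +
        c ^ (α * q / d - 1) * ((r ^ d) ^ (α * q / d - 1) * N)) ∧
      |f x| ^ q ≤ 2 ^ q * (c⁻¹ * (r ^ (α * q) * D) + c⁻¹ * ((r ^ d)⁻¹ * T)) := by
  have hd0 : (0 : ℝ) < d := by exact_mod_cast hd
  have hq0 : 0 < q := by linarith
  have hdq : 0 < (d : ℝ) - α * q := by linarith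
  set m := (σ (Metric.closedBall x r)).toReal with hm
  have hmσ : σ (Metric.closedBall x r) = ENNReal.ofReal m :=
    (ENNReal.ofReal_toReal (measure_ne_top _ _)).symm
  have hmc : c * r ^ d ≤ m := by
    have := hdens x hx r hr0 hr
    rwa [hmσ, ENNReal.ofReal_le_ofReal_iff ENNReal.toReal_nonneg] at this
  have hcr : 0 < c * r ^ d := by positivity
  have hm0 : 0 < m := hcr.trans_le hmc
  have hF : ‖f x‖ₑ ^ q = ENNReal.ofReal (|f x| ^ q) := by
    rw [Real.enorm_eq_ofReal_abs, ENNReal.ofReal_rpow_of_nonneg (abs_nonneg _) hq0.le]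
  have h2q : (2 : ℝ≥0∞) ^ q = ENNReal.ofReal (2 ^ q) := by
    rw [← ENNReal.ofReal_rpow_of_nonneg zero_le_two hq0.le]; simp
  have key := measure_mul_rpow_le (σ := σ) f hf hq x r
  have k1 := setLIntegral_sub_rpow_le (σ := σ) (κ := (d : ℝ) + α * q) (r := r) (by positivity) hq0
    f x
  rw [hD, ENNReal.ofReal_rpow_of_nonneg hr0.le (by positivity),
    ← ENNReal.ofReal_mul (by positivity)] at k1
  have hrD : r ^ ((d : ℝ) + α * q) = r ^ d * r ^ (α * q) := by
    rw [Real.rpow_add hr0, Real.rpow_natCast]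
  -- The two bounds differ only in how the mass of |f|^q on the ball is estimated: by Hölder with
  -- the critical exponent, or by the full L^q norm. The lower density then replaces m by c r^d.
  have general : ∀ Y Y' : ℝ, 0 ≤ Y → (∫⁻ y in Metric.closedBall x r, ‖f y‖ₑ ^ q ∂σ ≤ ENNReal.ofReal Y) →
      Y / m ≤ Y' → |f x| ^ q ≤ 2 ^ q * (c⁻¹ * (r ^ (α * q) * D) + Y') := by
    intro Y Y' hY0 hY hYY
    have h3 := key.trans (mul_le_mul_right (add_le_add k1 hY) _)
    rw [hmσ, hF, h2q, ← ENNReal.ofReal_add (by positivity) hY0, ← ENNReal.ofReal_mul hm0.le,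
      ← ENNReal.ofReal_mul (by positivity), ENNReal.ofReal_le_ofReal_iff (by positivity),
      mul_comm, ← le_div_iff₀ hm0] at h3
    refine h3.trans ?_
    rw [mul_div_assoc, add_div]
    gcongr
    rw [hrD, div_le_iff₀ hm0]
    calc r ^ d * r ^ (α * q) * D = c⁻¹ * (r ^ (α * q) * D) * (c * r ^ d) := by field_simp
      _ ≤ _ := by gcongr
  constructor
  · have hQ : q ≤ d * q / (d - α * q) := by
      rw [le_div_iff₀ hdq]; nlinarith [mul_pos hα hq0]
    have h3 := setLIntegral_rpow_le hf.aestronglyMeasurable hq0 hQ (Metric.closedBall x r) (μ := σ)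
    have e1 : 1 - q / (d * q / (d - α * q)) = α * q / d := by field_simp; ring
    rw [hN, e1, hmσ, ENNReal.ofReal_rpow_of_nonneg hm0.le (by positivity),
      ← ENNReal.ofReal_mul hN0] at h3
    refine general _ _ (by positivity) h3 ?_
    have e2 : N * m ^ (α * q / d) / m = m ^ (α * q / d - 1) * N := by
      rw [Real.rpow_sub hm0, Real.rpow_one]; ring
    rw [e2, ← mul_assoc, ← Real.mul_rpow hc.le (by positivity)]
    gcongr ?_ * _
    refine Real.rpow_le_rpow_of_nonpos hcr hmc ?_
    have : α * q / d < 1 := by rwa [div_lt_one hd0]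
    linarith
  · refine general T _ hT0 ((setLIntegral_le_lintegral _ _).trans_eq hT) ?_
    rw [div_le_iff₀ hm0]
    calc T = c⁻¹ * ((r ^ d)⁻¹ * T) * (c * r ^ d) := by field_simp
      _ ≤ _ := by gcongr

/-- The fractional Sobolev inequality for functions with finite `L^Q` norm, where `Q` is the
critical exponent. -/
theorem fractional_sobolev_aux {n d : ℕ} {c r₀ α q : ℝ} (hd : 0 < d) (hc : 0 < c) (hr₀ : 0 < r₀)
    (hα : 0 < α) (hq : 1 ≤ q) (hqd : α * q < d) :
    ∃ C : ℝ≥0, ∀ (σ : Measure (E n)) [IsFiniteMeasure σ] (S : Set (E n)),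
      LowerDensity σ S d c r₀ → (∀ᵐ x ∂σ, x ∈ S) → ∀ f : E n → ℝ, Measurable f →
      ∫⁻ y, ‖f y‖ₑ ^ (d * q / (d - α * q)) ∂σ ≠ ⊤ → ∫⁻ y, ‖f y‖ₑ ^ q ∂σ ≠ ⊤ →
      ∫⁻ y, ‖f y‖ₑ ^ (d * q / (d - α * q)) ∂σ ≤ C *
        ((∫⁻ y, ‖f y‖ₑ ^ (d * q / (d - α * q)) ∂σ) ^ (α * q / d) *
          ∫⁻ x, gagliardoDensity σ (d + α * q) q f x ∂σ +
          (∫⁻ y, ‖f y‖ₑ ^ q ∂σ) ^ ((d : ℝ) / (d - α * q))) := by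
  have hd0 : (0 : ℝ) < d := by exact_mod_cast hd
  have hq0 : 0 < q := by linarith
  have hdq : 0 < (d : ℝ) - α * q := by linarith
  set θ := α * q / d with hθ
  have hθ0 : 0 < θ := by positivity
  have hθ1 : θ < 1 := by rwa [hθ, div_lt_one hd0]
  have hκ : (1 - θ)⁻¹ = d / (d - α * q) := by rw [hθ]; field_simp
  set Q := d * q / (d - α * q) with hQ
  have hQ0 : 0 < Q := by positivity
  set A := 2 ^ q * (c⁻¹ + c ^ (θ - 1) + c⁻¹ * r₀ ^ (α * q) + c⁻¹ * (r₀ ^ d)⁻¹) with hA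
  have hA0 : 0 ≤ A := by positivity
  set C₁ := (2 * A) ^ (1 - θ)⁻¹ * (1 + (r₀ ^ d) ^ (1 - (1 - θ)⁻¹)) with hC₁
  set C₂ := (2 * A) ^ ((1 - θ)⁻¹ - 1) with hC₂
  have hC₁0 : 0 ≤ C₁ := by positivity
  have hC₂0 : 0 ≤ C₂ := by positivity
  refine ⟨(C₁ + C₂).toNNReal, fun σ _ S hdens hS f hf hfin hfin2 => ?_⟩
  set I := ∫⁻ y, ‖f y‖ₑ ^ Q ∂σ with hI
  set T := ∫⁻ y, ‖f y‖ₑ ^ q ∂σ with hT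
  rcases eq_or_ne I 0 with hI0 | hI0
  · rw [hI0]; exact zero_le
  have hCC : (((C₁ + C₂).toNNReal : ℝ≥0) : ℝ≥0∞) = ENNReal.ofReal C₁ + ENNReal.ofReal C₂ := by
    rw [← ENNReal.ofReal_add hC₁0 hC₂0]; rfl
  have hIpow : I ^ (q / Q) ≠ 0 := by simp [hI0, hfin]
  have hIpow' : I ^ (q / Q) ≠ ⊤ := ENNReal.rpow_ne_top_of_nonneg (by positivity) hfin
  set N := (I ^ (q / Q)).toReal with hN
  have hN0 : 0 < N := ENNReal.toReal_pos hIpow hIpow'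
  have hNI : I ^ (q / Q) = ENNReal.ofReal N := (ENNReal.ofReal_toReal hIpow').symm
  have hθI : I ^ θ = ENNReal.ofReal (N ^ ((1 - θ)⁻¹ - 1)) := by
    rw [← ENNReal.ofReal_rpow_of_pos hN0, ← hNI, ← ENNReal.rpow_mul]
    congr 1
    rw [hκ, hQ, hθ]; field_simp; ring
  have hTT : T = ENNReal.ofReal T.toReal := (ENNReal.ofReal_toReal hfin2).symm
  have hpt : ∀ x ∈ S, ‖f x‖ₑ ^ Q ≤ ENNReal.ofReal C₁ * (I ^ θ * gagliardoDensity σ (d + α * q) q f x)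
      + ENNReal.ofReal C₂ * (T ^ ((1 - θ)⁻¹ - 1) * ‖f x‖ₑ ^ q) := by
    intro x hx
    have hIθ : I ^ θ ≠ 0 := by simp [hI0, hfin]
    rcases eq_or_ne (gagliardoDensity σ (d + α * q) q f x) ⊤ with htop | htop
    · have hC₁' : 0 < C₁ := by
        have : 0 < A := by positivity
        positivity
      rw [htop, ENNReal.mul_top hIθ, ENNReal.mul_top (by simpa using hC₁'), top_add]
      exact le_top
    set D := (gagliardoDensity σ (d + α * q) q f x).toReal with hD
    have hDD : gagliardoDensity σ (d + α * q) q f x = ENNReal.ofReal D :=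
      (ENNReal.ofReal_toReal htop).symm
    have hD0 : 0 ≤ D := ENNReal.toReal_nonneg
    have hT0 : 0 ≤ T.toReal := ENNReal.toReal_nonneg
    have hF0 : 0 ≤ |f x| ^ q := by positivity
    have scale := fun (r : ℝ) (hr0 : 0 < r) (hr : r ≤ r₀) => rpow_le_scale hd hc hα hq hqd hdens hf
      hx hr0 hr hD0 hN0.le hT0 hDD hNI hTT
    -- With t = r^d the exponents become θ = αq/d and θ - 1, and |f|^q raised to 1/(1-θ) is |f|^Q.
    have opt := rpow_le_of_forall_scale hA0 (t₀ := r₀ ^ d) (by positivity) hθ0 hθ1 hF0 hD0 hN0 hT0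
      (fun t ht0 ht => by
        have hr0 : 0 < t ^ (d : ℝ)⁻¹ := by positivity
        have hrd : (t ^ (d : ℝ)⁻¹) ^ d = t := Real.rpow_inv_natCast_pow ht0.le hd.ne'
        have hr : t ^ (d : ℝ)⁻¹ ≤ r₀ := by
          rw [← hrd] at ht
          exact (pow_le_pow_iff_left₀ hr0.le hr₀.le hd.ne').1 ht
        have h := (scale _ hr0 hr).1
        have e : (t ^ (d : ℝ)⁻¹) ^ (α * q) = t ^ θ := by
          rw [← Real.rpow_mul ht0.le]; congr 1; rw [hθ]; field_simp
        rw [hrd, e] at h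
        refine h.trans ?_
        rw [hA, mul_assoc, mul_add (_ + _ + _ + _)]
        gcongr
        · have : 0 ≤ c ^ (θ - 1) + c⁻¹ * r₀ ^ (α * q) + c⁻¹ * (r₀ ^ d)⁻¹ := by positivity
          linarith
        · have : 0 ≤ c⁻¹ + c⁻¹ * r₀ ^ (α * q) + c⁻¹ * (r₀ ^ d)⁻¹ := by positivity
          linarith)
      (by
        have h := (scale r₀ hr₀ le_rfl).2
        refine h.trans ?_
        rw [hA, mul_assoc, mul_add (_ + _ + _ + _), ← mul_assoc c⁻¹, ← mul_assoc c⁻¹]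
        gcongr
        · have : 0 ≤ c⁻¹ + c ^ (θ - 1) + c⁻¹ * (r₀ ^ d)⁻¹ := by positivity
          linarith
        · have : 0 ≤ c⁻¹ + c ^ (θ - 1) + c⁻¹ * r₀ ^ (α * q) := by positivity
          linarith)
    have hκ0 : 0 < (1 - θ)⁻¹ := inv_pos.2 (by linarith)
    have hκ1 : 0 ≤ (1 - θ)⁻¹ - 1 := by
      have := (one_lt_inv₀ (by linarith : 0 < 1 - θ)).2 (by linarith)
      linarith
    have hFQ : ‖f x‖ₑ ^ Q = ENNReal.ofReal ((|f x| ^ q) ^ (1 - θ)⁻¹) := by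
      rw [Real.enorm_eq_ofReal_abs, ENNReal.ofReal_rpow_of_nonneg (abs_nonneg _) hQ0.le,
        ← Real.rpow_mul (abs_nonneg _)]
      congr 2
      rw [hκ, hQ]; ring
    have hFq : ‖f x‖ₑ ^ q = ENNReal.ofReal (|f x| ^ q) := by
      rw [Real.enorm_eq_ofReal_abs, ENNReal.ofReal_rpow_of_nonneg (abs_nonneg _) hq0.le]
    rw [hFQ, hθI, hDD, hTT, hFq, ENNReal.ofReal_rpow_of_nonneg hT0 hκ1,
      ← ENNReal.ofReal_mul (by positivity), ← ENNReal.ofReal_mul hC₁0,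
      ← ENNReal.ofReal_mul (by positivity), ← ENNReal.ofReal_mul hC₂0,
      ← ENNReal.ofReal_add (by positivity) (by positivity)]
    exact ENNReal.ofReal_le_ofReal opt
  have hTpow : T ^ ((d : ℝ) / (d - α * q)) = T ^ ((1 - θ)⁻¹ - 1) * T := by
    have hκ1 : 0 ≤ (1 - θ)⁻¹ - 1 := by
      have := (one_lt_inv₀ (by linarith : 0 < 1 - θ)).2 (by linarith)
      linarith
    conv_rhs => rw [← ENNReal.rpow_one T, ← ENNReal.rpow_mul, one_mul]
    rw [← ENNReal.rpow_add_of_nonneg _ _ hκ1 zero_le_one, ← hκ]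
    congr 1; ring
  calc I ≤ ∫⁻ x, (ENNReal.ofReal C₁ * (I ^ θ * gagliardoDensity σ (d + α * q) q f x)
      + ENNReal.ofReal C₂ * (T ^ ((1 - θ)⁻¹ - 1) * ‖f x‖ₑ ^ q)) ∂σ :=
        lintegral_mono_ae (hS.mono hpt)
    _ = ENNReal.ofReal C₁ * (I ^ θ * ∫⁻ x, gagliardoDensity σ (d + α * q) q f x ∂σ) +
        ENNReal.ofReal C₂ * (T ^ ((1 - θ)⁻¹ - 1) * T) := by
        have hκ1 : 0 ≤ (1 - θ)⁻¹ - 1 := by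
          have := (one_lt_inv₀ (by linarith : 0 < 1 - θ)).2 (by linarith)
          linarith
        rw [lintegral_add_right _ (by fun_prop), lintegral_const_mul' _ _ ENNReal.ofReal_ne_top,
          lintegral_const_mul' _ _ (ENNReal.rpow_ne_top_of_nonneg hθ0.le hfin),
          lintegral_const_mul' _ _ ENNReal.ofReal_ne_top,
          lintegral_const_mul' _ _ (ENNReal.rpow_ne_top_of_nonneg hκ1 hfin2)]
    _ ≤ _ := by
        rw [hCC, hTpow, mul_add]
        gcongr
        · exact le_self_add
        · exact le_add_self

end FractionalSobolev


/-! ### Absorption, Fatou, and differences of averages -/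

section Limits

variable {X : Type*} [MeasurableSpace X] {μ : Measure X}

/-- Absorption of a sublinear term. -/
theorem le_of_le_mul_rpow_add {I a b : ℝ≥0∞} {θ : ℝ} (hI : I ≠ ⊤) (hθ1 : θ < 1)
    (h : I ≤ a * I ^ θ + b) : I ≤ (2 * a) ^ (1 - θ)⁻¹ + 2 * b := by
  rcases eq_or_ne I 0 with rfl | hI0
  · exact zero_le
  have hθ : 0 < 1 - θ := by linarith
  rcases le_total (a * I ^ θ) b with hab | hab
  · calc I ≤ a * I ^ θ + b := h
      _ ≤ 2 * b := by rw [two_mul]; gcongr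
      _ ≤ _ := le_add_self
  · have h1 : I ≤ 2 * a * I ^ θ := by
      calc I ≤ a * I ^ θ + b := h
        _ ≤ a * I ^ θ + a * I ^ θ := by gcongr
        _ = _ := by ring
    have h2 : I ^ (1 - θ) ≤ 2 * a := by
      rw [ENNReal.rpow_sub _ _ hI0 hI, ENNReal.rpow_one]
      exact ENNReal.div_le_of_le_mul h1
    calc I = (I ^ (1 - θ)) ^ (1 - θ)⁻¹ := (ENNReal.rpow_rpow_inv hθ.ne' _).symm
      _ ≤ (2 * a) ^ (1 - θ)⁻¹ := by gcongr
      _ ≤ _ := le_self_add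

/-- Fatou's lemma for `eLpNorm`. -/
theorem eLpNorm_le_of_tendsto {F : Type*} [NormedAddCommGroup F] {p B : ℝ≥0∞} {f : X → F}
    {g : ℕ → X → F} (hg : ∀ k, AEStronglyMeasurable (g k) μ)
    (hlim : ∀ᵐ x ∂μ, Tendsto (fun k => g k x) atTop (𝓝 (f x)))
    (hB : ∀ k, eLpNorm (g k) p μ ≤ B) : eLpNorm f p μ ≤ B := by
  refine (Lp.eLpNorm_lim_le_liminf_eLpNorm hg f hlim).trans ?_
  exact (liminf_le_liminf (Eventually.of_forall hB)).trans (by simp)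

/-- Jensen's inequality for the integral of a function. -/
theorem enorm_integral_rpow_le [IsProbabilityMeasure μ] {f : X → ℝ}
    (hf : AEStronglyMeasurable f μ) {q : ℝ} (hq : 1 ≤ q) :
    ‖∫ x, f x ∂μ‖ₑ ^ q ≤ ∫⁻ x, ‖f x‖ₑ ^ q ∂μ :=
  (ENNReal.rpow_le_rpow (enorm_integral_le_lintegral_enorm f) (by linarith)).trans
    (lintegral_rpow_le_of_isProbabilityMeasure hf.enorm hq)

theorem enorm_integral_sub_integral_rpow_le {ν : Measure X} [IsProbabilityMeasure μ]
    [IsProbabilityMeasure ν] {f : X → ℝ} (hμ : Integrable f μ) (hν : Integrable f ν) {q : ℝ}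
    (hq : 1 ≤ q) :
    ‖∫ x, f x ∂μ - ∫ x, f x ∂ν‖ₑ ^ q ≤ ∫⁻ x, ∫⁻ y, ‖f x - f y‖ₑ ^ q ∂ν ∂μ := by
  have e1 : ∫ x, f x ∂μ - ∫ x, f x ∂ν = ∫ x, (f x - ∫ y, f y ∂ν) ∂μ := by
    rw [integral_sub hμ (integrable_const _)]; simp
  have e2 : ∀ x, f x - ∫ y, f y ∂ν = ∫ y, (f x - f y) ∂ν := fun x => by
    rw [integral_sub (integrable_const _) hν]; simp
  rw [e1]
  refine (enorm_integral_rpow_le (hμ.1.sub aestronglyMeasurable_const) hq).trans ?_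
  refine lintegral_mono fun x => ?_
  rw [Pi.sub_apply, e2]
  exact enorm_integral_rpow_le (aestronglyMeasurable_const.sub hν.1) hq

theorem enorm_setAverage_sub_setAverage_rpow_le {f : X → ℝ} (hf : Integrable f μ) {s t b : Set X}
    (hs : s ⊆ b) (ht : t ⊆ b) (hs0 : μ s ≠ 0) (ht0 : μ t ≠ 0) (hs1 : μ s ≠ ⊤) (ht1 : μ t ≠ ⊤)
    {q : ℝ} (hq : 1 ≤ q) :
    ‖(⨍ x in s, f x ∂μ) - ⨍ x in t, f x ∂μ‖ₑ ^ q ≤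
      (μ s)⁻¹ * (μ t)⁻¹ * ∫⁻ x in b, ∫⁻ y in b, ‖f x - f y‖ₑ ^ q ∂μ ∂μ := by
  have : IsProbabilityMeasure ((μ s)⁻¹ • μ.restrict s) :=
    ⟨by simp [ENNReal.inv_mul_cancel hs0 hs1]⟩
  have : IsProbabilityMeasure ((μ t)⁻¹ • μ.restrict t) :=
    ⟨by simp [ENNReal.inv_mul_cancel ht0 ht1]⟩
  have hfs : Integrable f ((μ s)⁻¹ • μ.restrict s) :=
    hf.restrict.smul_measure (ENNReal.inv_ne_top.2 hs0)
  have hft : Integrable f ((μ t)⁻¹ • μ.restrict t) :=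
    hf.restrict.smul_measure (ENNReal.inv_ne_top.2 ht0)
  have h := enorm_integral_sub_integral_rpow_le hfs hft hq
  rw [average, average, Measure.restrict_apply_univ, Measure.restrict_apply_univ]
  refine h.trans ?_
  simp only [lintegral_smul_measure, smul_eq_mul]
  rw [lintegral_const_mul' _ _ (ENNReal.inv_ne_top.2 ht0), mul_assoc]
  gcongr

end Limits

/-! ### General fractional Sobolev inequality and Campanato's theorem -/

section SobolevHolder

variable {n : ℕ}

/-- The fractional Sobolev inequality on sets with lower density bounds. -/
theorem fractional_sobolev {n d : ℕ} {c r₀ α q : ℝ} (hd : 0 < d) (hc : 0 < c) (hr₀ : 0 < r₀)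
    (hα : 0 < α) (hq : 1 ≤ q) (hqd : α * q < d) :
    ∃ C : ℝ≥0, ∀ (σ : Measure (E n)) [IsFiniteMeasure σ] (S : Set (E n)),
      LowerDensity σ S d c r₀ → (∀ᵐ x ∂σ, x ∈ S) → ∀ f : E n → ℝ, AEStronglyMeasurable f σ →
      eLpNorm f (ENNReal.ofReal (d * q / (d - α * q))) σ ≤ C *
        ((∫⁻ x, gagliardoDensity σ (d + α * q) q f x ∂σ) ^ (1 / q) +
          eLpNorm f (ENNReal.ofReal q) σ) := by
  obtain ⟨C, hC⟩ := fractional_sobolev_aux (n := n) hd hc hr₀ hα hq hqd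
  have hd0 : (0 : ℝ) < d := by exact_mod_cast hd
  have hq0 : 0 < q := by linarith
  have hdq : 0 < (d : ℝ) - α * q := by linarith
  set Q := d * q / (d - α * q) with hQ
  have hQ0 : 0 < Q := by positivity
  have hqQ : q ≤ Q := by rw [hQ, le_div_iff₀ hdq]; nlinarith [mul_pos hα hq0]
  set θ := α * q / d with hθ
  have hθ0 : 0 < θ := by positivity
  have hθ1 : θ < 1 := by rwa [hθ, div_lt_one hd0]
  have hκ : (1 - θ)⁻¹ = d / (d - α * q) := by rw [hθ]; field_simp
  -- The summand 1 keeps the constant non-zero, so the right side is ∞ when the L^q norm is.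
  refine ⟨(2 * C) ^ (1 / q) + (2 * C) ^ (1 / Q) + 1, fun σ _ S hdens hS f₀ hf₀ => ?_⟩
  obtain ⟨f, hfm, hff⟩ := hf₀
  have hf : Measurable f := hfm.measurable
  have hgag : ∫⁻ x, gagliardoDensity σ (d + α * q) q f₀ x ∂σ =
      ∫⁻ x, gagliardoDensity σ (d + α * q) q f x ∂σ := by
    refine lintegral_congr_ae (hff.mono fun x hx => ?_)
    refine lintegral_congr_ae (hff.mono fun y hy => ?_)
    simp only [hx, hy]
  rw [hgag, eLpNorm_congr_ae hff, eLpNorm_congr_ae hff]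
  set G := ∫⁻ x, gagliardoDensity σ (d + α * q) q f x ∂σ with hG
  set T := ∫⁻ y, ‖f y‖ₑ ^ q ∂σ with hT
  rw [eLpNorm_ofReal_eq hq0 f]
  rcases eq_or_ne T ⊤ with hTt | hTt
  · rw [← hT, hTt, ENNReal.top_rpow_of_pos (by positivity), add_top, ENNReal.mul_top]
    · exact le_top
    · norm_cast; positivity
  -- Truncations are bounded, so their L^Q norms are finite and absorption is legitimate; they
  -- increase neither |f| nor differences, and Fatou removes them.
  set g : ℕ → E n → ℝ := fun k x => max (-(k : ℝ)) (min (f x) k) with hg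
  have hgm : ∀ k, Measurable (g k) := fun k => by fun_prop
  have hgd : ∀ k x y, |g k x - g k y| ≤ |f x - f y| := fun k x y => by
    refine (abs_max_sub_max_le_max _ _ _ _).trans ?_
    rw [sub_self, abs_zero, max_eq_right (abs_nonneg _)]
    refine (abs_min_sub_min_le_max _ _ _ _).trans ?_
    rw [sub_self, abs_zero, max_eq_left (abs_nonneg _)]
  have hgf : ∀ k x, |g k x| ≤ |f x| := fun k x => by
    have hk : (0 : ℝ) ≤ k := Nat.cast_nonneg k
    have h := (abs_max_sub_max_le_max (-(k : ℝ)) (min (f x) k) (-(k : ℝ)) (min 0 k))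
    have h0 : max (-(k : ℝ)) (min 0 k) = 0 := by
      rw [min_eq_left hk, max_eq_right (by linarith)]
    rw [sub_self, abs_zero, max_eq_right (abs_nonneg (min (f x) (k : ℝ) - min (0 : ℝ) k)), h0, min_eq_left hk, sub_zero,
      sub_zero] at h
    refine h.trans ?_
    have h' := abs_min_sub_min_le_max (f x) (k : ℝ) 0 k
    rwa [sub_self, abs_zero, max_eq_left (abs_nonneg _), min_eq_left hk, sub_zero, sub_zero] at h'
  have hgk : ∀ k x, |g k x| ≤ k := fun k x => by
    have hk : (0 : ℝ) ≤ k := Nat.cast_nonneg k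
    rw [abs_le]
    exact ⟨le_max_left _ _, max_le (by linarith) (min_le_right _ _)⟩
  have henorm : ∀ a b : ℝ, |a| ≤ |b| → ‖a‖ₑ ≤ ‖b‖ₑ := fun a b h => by
    rw [Real.enorm_eq_ofReal_abs, Real.enorm_eq_ofReal_abs]
    exact ENNReal.ofReal_le_ofReal h
  refine eLpNorm_le_of_tendsto (fun k => (hgm k).aestronglyMeasurable)
    (Eventually.of_forall fun x => ?_) fun k => ?_
  · refine tendsto_const_nhds.congr' ?_
    filter_upwards [eventually_ge_atTop ⌈|f x|⌉₊] with k hk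
    have hk' : |f x| ≤ k := Nat.ceil_le.1 hk
    rw [abs_le] at hk'
    simp only [hg]
    rw [min_eq_left hk'.2, max_eq_right hk'.1]
  · have hT' : ∫⁻ y, ‖g k y‖ₑ ^ q ∂σ ≤ T :=
      lintegral_mono fun y => ENNReal.rpow_le_rpow (henorm _ _ (hgf k y)) hq0.le
    have hG' : ∫⁻ x, gagliardoDensity σ (d + α * q) q (g k) x ∂σ ≤ G := by
      refine lintegral_mono fun x => lintegral_mono fun y => ?_
      gcongr
      exact henorm _ _ (hgd k x y)
    have hI' : ∫⁻ y, ‖g k y‖ₑ ^ Q ∂σ ≠ ⊤ := by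
      refine ((lintegral_mono fun y => ?_).trans_lt (b := ∫⁻ _, ENNReal.ofReal k ^ Q ∂σ) ?_).ne
      · rw [Real.enorm_eq_ofReal_abs]
        gcongr
        exact hgk k y
      · rw [lintegral_const]
        exact ENNReal.mul_lt_top (ENNReal.rpow_lt_top_of_nonneg hQ0.le ENNReal.ofReal_ne_top)
          (measure_lt_top _ _)
    have h := hC σ S hdens hS (g k) (hgm k) hI' (ne_top_of_le_ne_top hTt hT')
    set I := ∫⁻ y, ‖g k y‖ₑ ^ Q ∂σ with hI
    have h1 : I ≤ (C * G) * I ^ θ + C * T ^ ((d : ℝ) / (d - α * q)) := by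
      refine h.trans ?_
      rw [mul_add, mul_comm (I ^ _), ← mul_assoc]
      gcongr
    have h2 := le_of_le_mul_rpow_add hI' hθ1 h1
    rw [eLpNorm_ofReal_eq hQ0, ← hI]
    have hκQ : (1 - θ)⁻¹ * Q⁻¹ = q⁻¹ := by
      rw [hκ, hQ]; field_simp
    have hκQ' : (d : ℝ) / (d - α * q) * Q⁻¹ = q⁻¹ := by rw [← hκ, hκQ]
    have hQ1 : Q⁻¹ ≤ 1 := inv_le_one_of_one_le₀ (hq.trans hqQ)
    calc I ^ Q⁻¹ ≤ ((2 * (C * G)) ^ (1 - θ)⁻¹ + 2 * (C * T ^ ((d : ℝ) / (d - α * q)))) ^ Q⁻¹ := by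
          gcongr
      _ ≤ ((2 * (C * G)) ^ (1 - θ)⁻¹) ^ Q⁻¹ + (2 * (C * T ^ ((d : ℝ) / (d - α * q)))) ^ Q⁻¹ :=
          ENNReal.rpow_add_le_add_rpow _ _ (by positivity) hQ1
      _ = (2 * C : ℝ≥0∞) ^ (1 / q) * G ^ (1 / q) + (2 * C : ℝ≥0∞) ^ (1 / Q) * T ^ q⁻¹ := by
          rw [← ENNReal.rpow_mul, hκQ, ← mul_assoc, ← mul_assoc,
            ENNReal.mul_rpow_of_nonneg (2 * C) G (by positivity),
            ENNReal.mul_rpow_of_nonneg (2 * C) (T ^ _) (by positivity), ← ENNReal.rpow_mul, hκQ',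
            one_div, one_div]
      _ ≤ _ := by
          have e1 : (((2 * C) ^ (1 / q) + (2 * C) ^ (1 / Q) + 1 : ℝ≥0) : ℝ≥0∞) =
              (2 * C : ℝ≥0∞) ^ (1 / q) + (2 * C : ℝ≥0∞) ^ (1 / Q) + 1 := by
            rw [ENNReal.coe_add, ENNReal.coe_add, ENNReal.coe_rpow_of_nonneg _ (by positivity),
              ENNReal.coe_rpow_of_nonneg _ (by positivity), ENNReal.coe_mul]
            rfl
          rw [e1, mul_add]
          gcongr
          · rw [add_assoc]; exact le_self_add
          · rw [add_assoc, add_left_comm]; exact le_self_add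

/-- Morrey-Campanato condition: mean oscillations on small balls centered on `S` are controlled. -/
def OscillationBound (σ : Measure (E n)) (S : Set (E n)) (κ q A N r₀ : ℝ) (f : E n → ℝ) : Prop :=
  ∀ z ∈ S, ∀ r : ℝ, 0 < r → r ≤ r₀ →
    ∫⁻ x in Metric.closedBall z r, ∫⁻ y in Metric.closedBall z r, ‖f x - f y‖ₑ ^ q ∂σ ∂σ ≤
      ENNReal.ofReal (A * r ^ κ * N ^ q)

/-- Both balls lie in B_R(x) and have mass at least c(R/2)^d, so the two normalizations cancel
R^(2d) in the oscillation bound and leave R^(βq). -/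
theorem abs_average_sub_average_le {n d : ℕ} {σ : Measure (E n)} [IsFiniteMeasure σ]
    {S : Set (E n)} {c r₀ β q A N : ℝ} (hc : 0 < c) (hq : 1 ≤ q) (hA : 0 ≤ A) (hN : 0 ≤ N)
    {f : E n → ℝ} (hf : Integrable f σ) (hdens : LowerDensity σ S d c r₀)
    (hosc : OscillationBound σ S (2 * d + β * q) q A N r₀ f) {x y : E n} (hx : x ∈ S) (hy : y ∈ S)
    {r ρ R : ℝ} (hR0 : 0 < R) (hR : R ≤ r₀) (hr : r ≤ R) (hr2 : R / 2 ≤ r)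
    (hρ2 : R / 2 ≤ ρ) (hρ : dist y x + ρ ≤ R) :
    |(⨍ u in Metric.closedBall x r, f u ∂σ) - ⨍ u in Metric.closedBall y ρ, f u ∂σ| ≤
      ((c * (1 / 2) ^ d)⁻¹ ^ 2 * A) ^ q⁻¹ * (R ^ β * N) := by
  have hq0 : 0 < q := by linarith
  have hm : 0 < c * (R / 2) ^ d := by positivity
  have hdist : (0 : ℝ) ≤ dist y x := dist_nonneg
  have h1 : ENNReal.ofReal (c * (R / 2) ^ d) ≤ σ (Metric.closedBall x r) :=
    (hdens x hx (R / 2) (by positivity) (by linarith)).trans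
      (measure_mono (Metric.closedBall_subset_closedBall hr2))
  have h2 : ENNReal.ofReal (c * (R / 2) ^ d) ≤ σ (Metric.closedBall y ρ) :=
    (hdens y hy (R / 2) (by positivity) (by linarith)).trans
      (measure_mono (Metric.closedBall_subset_closedBall hρ2))
  have hm' : 0 < ENNReal.ofReal (c * (R / 2) ^ d) := ENNReal.ofReal_pos.2 hm
  have h := enorm_setAverage_sub_setAverage_rpow_le hf (Metric.closedBall_subset_closedBall hr)
    (Metric.closedBall_subset_closedBall' (by linarith)) (hm'.trans_le h1).ne'
    (hm'.trans_le h2).ne' (measure_ne_top _ _) (measure_ne_top _ _) hq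
  have h3 := h.trans (mul_le_mul' (mul_le_mul' (ENNReal.inv_le_inv.2 h1) (ENNReal.inv_le_inv.2 h2))
    (hosc x hx R hR0 hR))
  rw [Real.enorm_eq_ofReal_abs, ENNReal.ofReal_rpow_of_nonneg (abs_nonneg _) hq0.le,
    ← ENNReal.ofReal_inv_of_pos hm, ← ENNReal.ofReal_mul (by positivity),
    ← ENNReal.ofReal_mul (by positivity), ENNReal.ofReal_le_ofReal_iff (by positivity)] at h3
  have h4 : (c * (R / 2) ^ d)⁻¹ * (c * (R / 2) ^ d)⁻¹ * (A * R ^ (2 * d + β * q) * N ^ q) =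
      ((c * (1 / 2) ^ d)⁻¹ ^ 2 * A) * (R ^ β * N) ^ q := by
    rw [Real.mul_rpow (by positivity) hN, ← Real.rpow_mul hR0.le, Real.rpow_add hR0,
      mul_comm (2 : ℝ) (d : ℝ), Real.rpow_mul hR0.le, Real.rpow_natCast, Real.rpow_ofNat, div_pow,
      div_pow]
    field_simp
    try ring
  rw [h4] at h3
  have h5 := Real.rpow_le_rpow (by positivity) h3 (inv_nonneg.2 hq0.le)
  rwa [Real.rpow_rpow_inv (abs_nonneg _) hq0.ne', Real.mul_rpow (by positivity) (by positivity),
    Real.rpow_rpow_inv (by positivity) hq0.ne'] at h5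

/-- The limit of the averages of `f` over small balls around `x`. -/
def ballAverageLimit (σ : Measure (E n)) (r₀ : ℝ) (f : E n → ℝ) (x : E n) : ℝ :=
  limUnder atTop fun k : ℕ => ⨍ u in Metric.closedBall x (r₀ * (1 / 2) ^ k), f u ∂σ

/-- Lebesgue differentiation for the Besicovitch family, along dyadic radii. -/
theorem ballAverageLimit_ae_eq {n : ℕ} {σ : Measure (E n)} [IsFiniteMeasure σ] {r₀ : ℝ}
    (hr₀ : 0 < r₀) {f : E n → ℝ} (hf : Integrable f σ) : ballAverageLimit σ r₀ f =ᵐ[σ] f := by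
  filter_upwards [(Besicovitch.vitaliFamily σ).ae_tendsto_average hf.locallyIntegrable] with x hx
  have h1 : Tendsto (fun k : ℕ => r₀ * (1 / 2 : ℝ) ^ k) atTop (𝓝[>] 0) := by
    refine tendsto_nhdsWithin_iff.2 ⟨?_, Eventually.of_forall fun k => ?_⟩
    · simpa using (tendsto_pow_atTop_nhds_zero_of_lt_one (r := (1 / 2 : ℝ)) (by norm_num)
        (by norm_num)).const_mul r₀
    · exact mem_Ioi.2 (by positivity)
  exact (hx.comp ((Besicovitch.tendsto_filterAt σ x).comp h1)).limUnder_eq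

/-- Campanato's characterization of Hölder continuity. -/
theorem exists_holder_bound {n d : ℕ} {c r₀ β q A : ℝ} (hc : 0 < c) (hr₀ : 0 < r₀) (hβ : 0 < β)
    (hq : 1 ≤ q) (hA : 0 ≤ A) :
    ∃ C : ℝ, 0 ≤ C ∧ ∀ (σ : Measure (E n)) [IsFiniteMeasure σ] (S : Set (E n)),
      LowerDensity σ S d c r₀ → ∀ (f : E n → ℝ) (N L : ℝ), 0 ≤ N → 0 ≤ L → Integrable f σ →
      ∫⁻ x, ‖f x‖ₑ ^ q ∂σ ≤ ENNReal.ofReal (L ^ q) →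
      OscillationBound σ S (2 * d + β * q) q A N r₀ f →
      (∀ x ∈ S, |ballAverageLimit σ r₀ f x| ≤ C * (N + L)) ∧
      ∀ x ∈ S, ∀ y ∈ S, |ballAverageLimit σ r₀ f x - ballAverageLimit σ r₀ f y| ≤
        C * (N + L) * dist x y ^ β := by
  have hq0 : 0 < q := by linarith
  set C₁ := ((c * (1 / 2) ^ d)⁻¹ ^ 2 * A) ^ q⁻¹ with hC₁
  have hC₁0 : 0 ≤ C₁ := by positivity
  set τ : ℝ := (1 / 2) ^ β with hτ
  have hτ0 : 0 < τ := by positivity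
  have hτ1 : τ < 1 := Real.rpow_lt_one (by norm_num) (by norm_num) hβ
  have hτ1' : 0 < 1 - τ := by linarith
  set C₂ := C₁ / (1 - τ) with hC₂
  have hC₂0 : 0 ≤ C₂ := by positivity
  set C₃ := (c * r₀ ^ d)⁻¹ ^ q⁻¹ + C₂ * r₀ ^ β with hC₃
  have hC₃0 : 0 ≤ C₃ := by positivity
  set C₄ := C₁ * 4 ^ β + 2 * (C₂ * 2 ^ β) with hC₄
  have hC₄0 : 0 ≤ C₄ := by positivity
  set C₅ := 2 * C₃ * (2 / r₀) ^ β with hC₅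
  have hC₅0 : 0 ≤ C₅ := by positivity
  refine ⟨C₃ + C₄ + C₅, by positivity, fun σ _ S hdens f N L hN hL hf hfL hosc => ?_⟩
  set a : E n → ℕ → ℝ := fun x k => ⨍ u in Metric.closedBall x (r₀ * (1 / 2) ^ k), f u ∂σ with ha
  have hrk : ∀ k : ℕ, 0 < r₀ * (1 / 2 : ℝ) ^ k := fun k => by positivity
  have hrk' : ∀ k : ℕ, r₀ * (1 / 2 : ℝ) ^ k ≤ r₀ := fun k =>
    mul_le_of_le_one_right hr₀.le (pow_le_one₀ (by norm_num) (by norm_num))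
  have hrkβ : ∀ k : ℕ, (r₀ * (1 / 2 : ℝ) ^ k) ^ β = r₀ ^ β * τ ^ k := fun k => by
    rw [Real.mul_rpow hr₀.le (by positivity), hτ, Real.rpow_pow_comm (by norm_num)]
  have hstep : ∀ x ∈ S, ∀ k, dist (a x k) (a x (k + 1)) ≤ C₁ * r₀ ^ β * N * τ ^ k := by
    intro x hx k
    rw [Real.dist_eq]
    refine (abs_average_sub_average_le hc hq hA hN hf hdens hosc hx hx (hrk k) (hrk' k) le_rfl
      (by linarith [hrk k]) ?_ ?_).trans_eq ?_
    · rw [pow_succ]; linarith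
    · rw [dist_self, pow_succ]; linarith [hrk k]
    · rw [hrkβ]; ring
  have htend : ∀ x ∈ S, Tendsto (a x) atTop (𝓝 (ballAverageLimit σ r₀ f x)) := fun x hx =>
    CauchySeq.tendsto_limUnder (cauchySeq_of_le_geometric _ _ hτ1 (hstep x hx))
  have hlim : ∀ x ∈ S, ∀ k, |a x k - ballAverageLimit σ r₀ f x| ≤
      C₂ * N * (r₀ * (1 / 2 : ℝ) ^ k) ^ β := by
    intro x hx k
    have := dist_le_of_le_geometric_of_tendsto _ _ hτ1 (hstep x hx) (htend x hx) k
    rw [Real.dist_eq] at this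
    refine this.trans_eq ?_
    rw [hrkβ, hC₂]; ring
  have hsup : ∀ x ∈ S, |ballAverageLimit σ r₀ f x| ≤ C₃ * (N + L) := by
    intro x hx
    have h0 := hlim x hx 0
    have hm := hdens x hx r₀ hr₀ le_rfl
    have hm0 : 0 < c * r₀ ^ d := by positivity
    have h1 : |a x 0| ≤ (c * r₀ ^ d)⁻¹ ^ q⁻¹ * L := by
      have hm1 : σ (Metric.closedBall x r₀) ≠ 0 :=
        ((ENNReal.ofReal_pos.2 hm0).trans_le hm).ne'
      have : IsProbabilityMeasure
          ((σ (Metric.closedBall x r₀))⁻¹ • σ.restrict (Metric.closedBall x r₀)) :=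
        ⟨by simp [ENNReal.inv_mul_cancel hm1 (measure_ne_top _ _)]⟩
      have h2 := enorm_integral_rpow_le
        (μ := (σ (Metric.closedBall x r₀))⁻¹ • σ.restrict (Metric.closedBall x r₀))
        (hf.1.restrict.smul_measure _) hq
      have h3 : ‖a x 0‖ₑ ^ q ≤ (ENNReal.ofReal (c * r₀ ^ d))⁻¹ * ENNReal.ofReal (L ^ q) := by
        simp only [ha, pow_zero, mul_one, average, Measure.restrict_apply_univ]
        refine h2.trans ?_
        rw [lintegral_smul_measure, smul_eq_mul]
        gcongr
        exact (setLIntegral_le_lintegral _ _).trans hfL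
      rw [Real.enorm_eq_ofReal_abs, ENNReal.ofReal_rpow_of_nonneg (abs_nonneg _) hq0.le,
        ← ENNReal.ofReal_inv_of_pos hm0, ← ENNReal.ofReal_mul (by positivity),
        ENNReal.ofReal_le_ofReal_iff (by positivity)] at h3
      have h5 := Real.rpow_le_rpow (by positivity) h3 (inv_nonneg.2 hq0.le)
      rwa [Real.rpow_rpow_inv (abs_nonneg _) hq0.ne', Real.mul_rpow (by positivity) (by positivity),
        Real.rpow_rpow_inv (by positivity) hq0.ne'] at h5
    rw [pow_zero, mul_one] at h0
    have h6 : |ballAverageLimit σ r₀ f x| ≤ |a x 0| + |a x 0 - ballAverageLimit σ r₀ f x| := by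
      have := abs_sub_abs_le_abs_sub (ballAverageLimit σ r₀ f x) (a x 0)
      rw [abs_sub_comm] at this
      linarith
    have p1 : 0 ≤ (c * r₀ ^ d)⁻¹ ^ q⁻¹ * N := by positivity
    have p2 : 0 ≤ C₂ * r₀ ^ β * L := by positivity
    rw [hC₃]
    linarith
  refine ⟨fun x hx => (hsup x hx).trans ?_, fun x hx y hy => ?_⟩
  · have : 0 ≤ (C₄ + C₅) * (N + L) := by positivity
    linarith
  rcases eq_or_ne x y with rfl | hxy
  · rw [sub_self, abs_zero]; positivity
  set ρ := dist x y with hρ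
  have hρ0 : 0 < ρ := dist_pos.2 hxy
  have hNL : 0 ≤ N + L := by linarith
  rcases le_or_gt ρ (r₀ / 2) with hcase | hcase
  -- The averages are compared at a dyadic radius between ρ and 2ρ. Since ρ ≤ r₀/2 the index is at
  -- least 1, so the ball of twice that radius, which contains both, is still admissible.
  · obtain ⟨k, hk1, hk2⟩ := exists_nat_pow_near_of_lt_one (x := ρ / r₀) (y := (1 / 2 : ℝ))
      (by positivity) (by rw [div_le_one hr₀]; linarith) (by norm_num) (by norm_num)
    rw [lt_div_iff₀ hr₀] at hk1
    rw [div_le_iff₀ hr₀] at hk2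
    obtain ⟨j, rfl⟩ : ∃ j, k = j + 1 := by
      refine Nat.exists_eq_succ_of_ne_zero ?_
      rintro rfl
      norm_num at hk1
      linarith
    have hR := hrk j
    have e1 : r₀ * (1 / 2 : ℝ) ^ (j + 1) = r₀ * (1 / 2 : ℝ) ^ j / 2 := by rw [pow_succ]; ring
    have hR4 : r₀ * (1 / 2 : ℝ) ^ j ≤ 4 * ρ := by
      rw [pow_succ, pow_succ] at hk1; linarith
    have hR2 : r₀ * (1 / 2 : ℝ) ^ (j + 1) ≤ 2 * ρ := by rw [e1]; linarith
    have h1 : |a x (j + 1) - a y (j + 1)| ≤ C₁ * ((r₀ * (1 / 2 : ℝ) ^ j) ^ β * N) := by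
      refine abs_average_sub_average_le hc hq hA hN hf hdens hosc hx hy hR (hrk' j) ?_ ?_ ?_ ?_
      · rw [e1]; linarith
      · rw [e1]
      · rw [e1]
      · rw [e1, dist_comm, ← hρ]
        have : ρ ≤ r₀ * (1 / 2 : ℝ) ^ j / 2 := by rw [← e1, mul_comm]; exact hk2
        linarith
    have h2 := hlim x hx (j + 1)
    have h3 := hlim y hy (j + 1)
    have b1 : (r₀ * (1 / 2 : ℝ) ^ j) ^ β ≤ 4 ^ β * ρ ^ β := by
      rw [← Real.mul_rpow (by norm_num) hρ0.le]; gcongr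
    have b2 : (r₀ * (1 / 2 : ℝ) ^ (j + 1)) ^ β ≤ 2 ^ β * ρ ^ β := by
      rw [← Real.mul_rpow (by norm_num) hρ0.le]; gcongr
    have b1' : C₁ * ((r₀ * (1 / 2 : ℝ) ^ j) ^ β * N) ≤ C₁ * (4 ^ β * ρ ^ β * N) := by gcongr
    have b2' : C₂ * N * (r₀ * (1 / 2 : ℝ) ^ (j + 1)) ^ β ≤ C₂ * N * (2 ^ β * ρ ^ β) := by gcongr
    have tri : |ballAverageLimit σ r₀ f x - ballAverageLimit σ r₀ f y| ≤
        |a x (j + 1) - ballAverageLimit σ r₀ f x| + |a x (j + 1) - a y (j + 1)| +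
          |a y (j + 1) - ballAverageLimit σ r₀ f y| := by
      have t1 := abs_sub_le (ballAverageLimit σ r₀ f x) (a x (j + 1)) (ballAverageLimit σ r₀ f y)
      have t2 := abs_sub_le (a x (j + 1)) (a y (j + 1)) (ballAverageLimit σ r₀ f y)
      rw [abs_sub_comm (ballAverageLimit σ r₀ f x) (a x (j + 1))] at t1
      linarith
    calc _ ≤ C₄ * N * ρ ^ β := by rw [hC₄]; linarith
      _ ≤ (C₃ + C₄ + C₅) * (N + L) * ρ ^ β := by
        gcongr <;> linarith
  · have h1 := hsup x hx
    have h2 := hsup y hy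
    have h3 := abs_sub (ballAverageLimit σ r₀ f x) (ballAverageLimit σ r₀ f y)
    have h4 : 1 ≤ (2 / r₀) ^ β * ρ ^ β := by
      -- For distant points the sup bound suffices, because 2ρ/r₀ > 1.
      rw [← Real.mul_rpow (by positivity) hρ0.le]
      refine Real.one_le_rpow ?_ hβ.le
      rw [div_mul_eq_mul_div, le_div_iff₀ hr₀]; linarith
    calc _ ≤ 2 * (C₃ * (N + L)) * 1 := by linarith
      _ ≤ 2 * (C₃ * (N + L)) * ((2 / r₀) ^ β * ρ ^ β) := by gcongr
      _ = C₅ * (N + L) * ρ ^ β := by rw [hC₅]; ring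
      _ ≤ _ := by gcongr; linarith

end SobolevHolder

/-! ### Mollification of functions with a weak gradient bound -/

section WeakGradientBound

variable {n : ℕ}

/-- The function `h` dominates the weak gradient of `F` on `ball 0 ρ`. -/
def WeakGradientBound (ρ : ℝ) (F : E n → ℝ) (h : E n → ℝ≥0∞) : Prop :=
  ∀ ψ : E n → ℝ, ContDiff ℝ ∞ ψ → HasCompactSupport ψ → tsupport ψ ⊆ Metric.ball 0 ρ → ∀ v : E n,
    ‖∫ x, F x * fderiv ℝ ψ x v‖ₑ ≤ ‖v‖ₑ * ∫⁻ x, h x * ‖ψ x‖ₑ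

/-- Young's inequality for the convolution with a probability density. -/
theorem lintegral_convolution_rpow_le {h k : E n → ℝ≥0∞} (hh : Measurable h) (hk : Measurable k)
    (hk1 : ∫⁻ x, k x = 1) {q : ℝ} (hq : 1 ≤ q) :
    ∫⁻ z, (∫⁻ t, h t * k (z - t)) ^ q ≤ ∫⁻ t, h t ^ q := by
  have hkz : ∀ z : E n, Measurable fun t => k (z - t) := fun z => by fun_prop
  have h1 : ∀ z, (∫⁻ t, h t * k (z - t)) ^ q ≤ ∫⁻ t, h t ^ q * k (z - t) := by
    intro z
    have hprob : IsProbabilityMeasure ((volume : Measure (E n)).withDensity fun t => k (z - t)) := by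
      refine ⟨?_⟩
      rw [withDensity_apply _ MeasurableSet.univ, Measure.restrict_univ,
        lintegral_sub_left_eq_self k z, hk1]
    have h2 := lintegral_rpow_le_of_isProbabilityMeasure
      (μ := (volume : Measure (E n)).withDensity fun t => k (z - t)) hh.aemeasurable hq
    rw [lintegral_withDensity_eq_lintegral_mul _ (hkz z) hh,
      lintegral_withDensity_eq_lintegral_mul _ (hkz z) (hh.pow_const q)] at h2
    simpa only [Pi.mul_apply, mul_comm (k _)] using h2
  calc ∫⁻ z, (∫⁻ t, h t * k (z - t)) ^ q ≤ ∫⁻ z, ∫⁻ t, h t ^ q * k (z - t) := lintegral_mono h1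
    _ = ∫⁻ t, ∫⁻ z, h t ^ q * k (z - t) := by
        refine lintegral_lintegral_swap (Measurable.aemeasurable ?_)
        fun_prop
    _ = ∫⁻ t, h t ^ q := by
        refine lintegral_congr fun t => ?_
        rw [lintegral_const_mul _ (by fun_prop), lintegral_sub_right_eq_self k t, hk1, mul_one]

open ContinuousLinearMap in
theorem fderiv_mollification_apply (φ : ContDiffBump (0 : E n)) {F : E n → ℝ} (hF : Integrable F)
    (z v : E n) :
    fderiv ℝ (convolution (φ.normed volume) F (lsmul ℝ ℝ) volume) z v =
      ∫ t, F t * fderiv ℝ (φ.normed volume) (z - t) v := by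
  have hc : ContDiff ℝ 1 (φ.normed (volume : Measure (E n))) := φ.contDiff_normed
  have h1 := (φ.hasCompactSupport_normed.hasFDerivAt_convolution_left (lsmul ℝ ℝ) hc
    hF.locallyIntegrable z).fderiv
  have h2 := ((φ.hasCompactSupport_normed (μ := (volume : Measure (E n)))).fderiv
    (𝕜 := ℝ)).convolutionExists_left
    ((lsmul ℝ ℝ : ℝ →L[ℝ] ℝ →L[ℝ] ℝ).precompL (E n)) (hc.continuous_fderiv one_ne_zero)
    hF.locallyIntegrable z
  rw [h1, convolution_eq_swap, ContinuousLinearMap.integral_apply h2.integrable_swap]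
  refine integral_congr_ae (Eventually.of_forall fun t => ?_)
  simp [precompL_apply, mul_comm]

/-- The derivative of the mollification at z tests F against the derivative of k(z - ·), up to sign;
this function is admissible because its support lies in the closed ball of radius `φ.rOut` about z,
inside the ball of radius ρ. -/
theorem enorm_fderiv_mollification_le {ρ : ℝ} {F : E n → ℝ} {h : E n → ℝ≥0∞} (hF : Integrable F)
    (hw : WeakGradientBound ρ F h) (φ : ContDiffBump (0 : E n)) {z : E n}
    (hz : ‖z‖ + φ.rOut < ρ) :
    ‖fderiv ℝ (convolution (φ.normed volume) F (ContinuousLinearMap.lsmul ℝ ℝ) volume) z‖ₑ ≤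
      ∫⁻ t, h t * ‖φ.normed volume (z - t)‖ₑ := by
  set k := φ.normed (volume : Measure (E n)) with hk
  rcases eq_or_ne (∫⁻ t, h t * ‖k (z - t)‖ₑ) ⊤ with htop | htop
  · rw [htop]; exact le_top
  have hkc : ContDiff ℝ ∞ k := φ.contDiff_normed
  have key : ∀ v : E n, ‖fderiv ℝ (convolution k F (ContinuousLinearMap.lsmul ℝ ℝ) volume) z v‖ ≤
      (∫⁻ t, h t * ‖k (z - t)‖ₑ).toReal * ‖v‖ := by
    intro v
    have hsupp : Function.support (fun t => k (z - t)) ⊆ Metric.closedBall z φ.rOut := by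
      intro t ht
      have h1 : z - t ∈ Function.support k := ht
      rw [hk, φ.support_normed_eq, Metric.mem_ball, dist_zero_right] at h1
      rw [Metric.mem_closedBall, dist_comm, dist_eq_norm]
      exact h1.le
    have hts : tsupport (fun t => k (z - t)) ⊆ Metric.closedBall z φ.rOut :=
      closure_minimal hsupp Metric.isClosed_closedBall
    have h1 := hw (fun t => k (z - t)) (by fun_prop)
      (HasCompactSupport.of_support_subset_isCompact (isCompact_closedBall _ _) hsupp)
      (hts.trans (Metric.closedBall_subset_ball' (by simpa [dist_zero_right, add_comm] using hz))) v
    have hd : ∀ t, fderiv ℝ (fun t => k (z - t)) t v = -(fderiv ℝ k (z - t) v) := by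
      intro t
      have a1 : HasFDerivAt k (fderiv ℝ k (z - t)) (z - t) :=
        (hkc.differentiable (by simp) _).hasFDerivAt
      have a2 : HasFDerivAt (fun t : E n => z - t) (-(ContinuousLinearMap.id ℝ (E n))) t :=
        (hasFDerivAt_id t).const_sub z
      have a3 : HasFDerivAt (fun t : E n => k (z - t))
        ((fderiv ℝ k (z - t)).comp (-(ContinuousLinearMap.id ℝ (E n)))) t := a1.comp t a2
      rw [a3.fderiv]
      simp
    have h2 : ‖fderiv ℝ (convolution k F (ContinuousLinearMap.lsmul ℝ ℝ) volume) z v‖ₑ ≤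
        ‖v‖ₑ * ∫⁻ t, h t * ‖k (z - t)‖ₑ := by
      rw [fderiv_mollification_apply φ hF]
      simp only [hd, mul_neg, integral_neg, enorm_neg] at h1
      exact h1
    have h3 := ENNReal.toReal_mono (ENNReal.mul_ne_top (by simp) htop) h2
    rw [ENNReal.toReal_mul, toReal_enorm, toReal_enorm, mul_comm] at h3
    exact h3
  have h4 := ContinuousLinearMap.opNorm_le_bound _ ENNReal.toReal_nonneg key
  rw [← ofReal_norm]
  exact ENNReal.ofReal_le_of_le_toReal h4

/-- Smooth approximation of functions with a weak gradient bound. -/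
theorem WeakGradientBound.exists_approx {ρ q : ℝ} (hρ : 0 < ρ) (hq : 1 ≤ q) {F : E n → ℝ}
    {h : E n → ℝ≥0∞} (hF : Integrable F) (hFm : Measurable F) (hh : Measurable h)
    (hw : WeakGradientBound ρ F h) :
    ∃ u : ℕ → E n → ℝ, (∀ k, ContDiff ℝ 1 (u k)) ∧
      (∀ᵐ x, Tendsto (fun k => u k x) atTop (𝓝 (F x))) ∧
      (∀ k, ∫⁻ x in Metric.ball 0 (ρ / 2), ‖fderiv ℝ (u k) x‖ₑ ^ q ≤ ∫⁻ x, h x ^ q) ∧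
      ∀ k, ∫⁻ x, ‖u k x‖ₑ ^ q ≤ ∫⁻ x, ‖F x‖ₑ ^ q := by
  -- Outer radii at most ρ/4 keep the mollification on the half ball inside the domain; the constant
  -- ratio 2 of the radii is what a.e. convergence requires.
  let φ : ℕ → ContDiffBump (0 : E n) := fun k =>
    ⟨ρ / 8 * (1 / ((k : ℝ) + 1)), ρ / 4 * (1 / ((k : ℝ) + 1)), by positivity, by
      have : 0 < 1 / ((k : ℝ) + 1) := by positivity
      gcongr; norm_num⟩
  have hq0 : 0 ≤ q := by linarith
  have hout : ∀ k, (φ k).rOut = ρ / 4 * (1 / ((k : ℝ) + 1)) := fun k => rfl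
  have hin : ∀ k, (φ k).rIn = ρ / 8 * (1 / ((k : ℝ) + 1)) := fun k => rfl
  have hlt : ∀ k, (φ k).rOut < ρ / 2 := fun k => by
    have : 1 / ((k : ℝ) + 1) ≤ 1 := by
      rw [div_le_one (by positivity)]; linarith [Nat.cast_nonneg (α := ℝ) k]
    rw [hout]
    nlinarith
  have hk1 : ∀ k, ∫⁻ x, ‖(φ k).normed volume x‖ₑ = 1 := fun k => by
    have h1 : ∀ x, ‖(φ k).normed (volume : Measure (E n)) x‖ₑ =
        ENNReal.ofReal ((φ k).normed volume x) := fun x =>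
      Real.enorm_of_nonneg ((φ k).nonneg_normed x)
    simp only [h1]
    rw [← ofReal_integral_eq_lintegral_ofReal (φ k).integrable_normed
      (Eventually.of_forall (φ k).nonneg_normed), (φ k).integral_normed, ENNReal.ofReal_one]
  have hkm : ∀ k, Measurable fun x => ‖(φ k).normed (volume : Measure (E n)) x‖ₑ := fun k =>
    (φ k).continuous_normed.enorm.measurable
  refine ⟨fun k => convolution ((φ k).normed volume) F (ContinuousLinearMap.lsmul ℝ ℝ) volume,
    fun k => ?_, ?_, fun k => ?_, fun k => ?_⟩
  · exact_mod_cast (φ k).hasCompactSupport_normed.contDiff_convolution_left (n := 1)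
      (ContinuousLinearMap.lsmul ℝ ℝ) (φ k).contDiff_normed hF.locallyIntegrable
  · refine ContDiffBump.ae_convolution_tendsto_right_of_locallyIntegrable (K := 2) ?_ ?_
      hF.locallyIntegrable
    · simp only [hout]
      simpa using tendsto_one_div_add_atTop_nhds_zero_nat.const_mul (ρ / 4)
    · refine Eventually.of_forall fun k => ?_
      rw [hout, hin]; apply le_of_eq; ring
  · refine le_trans ?_ (lintegral_convolution_rpow_le hh (hkm k) (hk1 k) hq)
    refine (setLIntegral_mono' Metric.isOpen_ball.measurableSet fun z hz => ?_).trans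
      (setLIntegral_le_lintegral _ _)
    refine ENNReal.rpow_le_rpow (enorm_fderiv_mollification_le hF hw (φ k) ?_) hq0
    rw [Metric.mem_ball, dist_zero_right] at hz
    linarith [hlt k]
  · refine le_trans ?_ (lintegral_convolution_rpow_le hFm.enorm (hkm k) (hk1 k) hq)
    refine lintegral_mono fun z => ENNReal.rpow_le_rpow ?_ hq0
    simp only [convolution_eq_swap]
    refine (enorm_integral_le_lintegral_enorm _).trans_eq (lintegral_congr fun t => ?_)
    rw [ContinuousLinearMap.lsmul_apply, smul_eq_mul, enorm_mul, mul_comm]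

end WeakGradientBound

/-! ### Poincaré and Sobolev inequalities on Euclidean balls -/

section Poincare

variable {n : ℕ}

/-- A contraction towards a point of the convex set B maps B into itself, and a ≥ 1/2 bounds the
inverse Jacobian by 2^n. -/
theorem setLIntegral_comp_combo_le {φ : E n → ℝ≥0∞} (hφ : Measurable φ) {B : Set (E n)}
    (hB : Convex ℝ B) (hBm : MeasurableSet B) {a : ℝ} (ha : 1 / 2 ≤ a) (ha1 : a ≤ 1) {y : E n}
    (hy : y ∈ B) :
    ∫⁻ x in B, φ (a • x + (1 - a) • y) ≤ 2 ^ n * ∫⁻ z in B, φ z := by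
  have ha0 : 0 < a := by linarith
  have hψ : Measurable (B.indicator φ) := hφ.indicator hBm
  calc ∫⁻ x in B, φ (a • x + (1 - a) • y)
      ≤ ∫⁻ x, B.indicator φ (a • x + (1 - a) • y) := by
        rw [← lintegral_indicator hBm]
        refine lintegral_mono fun x => ?_
        by_cases hx : x ∈ B
        · rw [indicator_of_mem hx, indicator_of_mem (hB hx hy ha0.le (by linarith) (by ring))]
        · rw [indicator_of_notMem hx]; exact zero_le
    _ = ∫⁻ z, B.indicator φ (z + (1 - a) • y) ∂(Measure.map (a • ·) volume) := by
        rw [lintegral_map (by fun_prop) (by fun_prop)]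
    _ = ENNReal.ofReal |(a ^ n)⁻¹| * ∫⁻ z, B.indicator φ z := by
        rw [Measure.map_addHaar_smul volume ha0.ne', lintegral_smul_measure, smul_eq_mul,
          lintegral_add_right_eq_self, finrank_euclideanSpace, Fintype.card_fin]
    _ ≤ 2 ^ n * ∫⁻ z in B, φ z := by
        rw [lintegral_indicator hBm]
        gcongr
        rw [abs_of_pos (by positivity), ← inv_pow, ENNReal.ofReal_pow (by positivity)]
        gcongr
        rw [← ENNReal.ofReal_ofNat 2]
        refine ENNReal.ofReal_le_ofReal ?_
        rw [inv_le_comm₀ ha0 (by norm_num)]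
        linarith

theorem enorm_sub_rpow_le_lintegral {u : E n → ℝ} (hu : ContDiff ℝ 1 u) {q : ℝ} (hq : 1 ≤ q)
    (x y : E n) :
    ‖u x - u y‖ₑ ^ q ≤
      ‖x - y‖ₑ ^ q * ∫⁻ t in Ioc (0 : ℝ) 1, ‖fderiv ℝ u (x + t • (y - x))‖ₑ ^ q := by
  have hq0 : 0 ≤ q := by linarith
  have hc : Continuous fun t : ℝ => fderiv ℝ u (x + t • (y - x)) :=
    (hu.continuous_fderiv one_ne_zero).comp (by fun_prop)
  have hc' : Continuous fun t : ℝ => fderiv ℝ u (x + t • (y - x)) (y - x) :=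
    hc.clm_apply continuous_const
  have hderiv : ∀ t ∈ uIcc (0 : ℝ) 1,
      HasDerivAt (fun t : ℝ => u (x + t • (y - x))) (fderiv ℝ u (x + t • (y - x)) (y - x)) t := by
    intro t _
    have h1 : HasFDerivAt u (fderiv ℝ u (x + t • (y - x))) (x + t • (y - x)) :=
      (hu.differentiable one_ne_zero _).hasFDerivAt
    have h2 : HasDerivAt (fun t : ℝ => x + t • (y - x)) (y - x) t := by
      simpa using ((hasDerivAt_id t).smul_const (y - x)).const_add x
    exact h1.comp_hasDerivAt t h2
  have h1 := intervalIntegral.integral_eq_sub_of_hasDerivAt hderiv (hc'.intervalIntegrable 0 1)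
  simp only [one_smul, add_sub_cancel, zero_smul, add_zero] at h1
  rw [intervalIntegral.integral_of_le zero_le_one] at h1
  have : IsProbabilityMeasure ((volume : Measure ℝ).restrict (Ioc 0 1)) := ⟨by simp⟩
  have h2 := enorm_integral_rpow_le (μ := (volume : Measure ℝ).restrict (Ioc 0 1))
    hc'.aestronglyMeasurable hq
  rw [h1, enorm_sub_rev] at h2
  refine h2.trans ?_
  rw [← lintegral_const_mul' _ _ (ENNReal.rpow_ne_top_of_nonneg hq0 (by simp))]
  refine lintegral_mono fun t => ?_
  rw [← ENNReal.mul_rpow_of_nonneg _ _ hq0]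
  refine ENNReal.rpow_le_rpow ?_ hq0
  rw [mul_comm, enorm_sub_rev x y]
  exact ContinuousLinearMap.le_opENorm _ _

/-- Poincaré's inequality on a ball for functions of class `C¹`. -/
theorem lintegral_lintegral_sub_rpow_le_fderiv {u : E n → ℝ} (hu : ContDiff ℝ 1 u) {q r : ℝ}
    (hq : 1 ≤ q) :
    ∫⁻ x in Metric.ball (0 : E n) r, ∫⁻ y in Metric.ball (0 : E n) r, ‖u x - u y‖ₑ ^ q ≤
      ENNReal.ofReal (2 * r) ^ q * (2 ^ n * volume (Metric.ball (0 : E n) r)) *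
        ∫⁻ z in Metric.ball (0 : E n) r, ‖fderiv ℝ u z‖ₑ ^ q := by
  have hq0 : 0 ≤ q := by linarith
  set B := Metric.ball (0 : E n) r with hB
  have hBm : MeasurableSet B := Metric.isOpen_ball.measurableSet
  have hBc : Convex ℝ B := convex_ball 0 r
  set φ : E n → ℝ≥0∞ := fun z => ‖fderiv ℝ u z‖ₑ ^ q with hφ
  have hφm : Measurable φ := by
    have := (hu.continuous_fderiv one_ne_zero).measurable
    fun_prop
  set R := ENNReal.ofReal (2 * r) ^ q with hR
  have hRt : R ≠ ⊤ := ENNReal.rpow_ne_top_of_nonneg hq0 ENNReal.ofReal_ne_top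
  -- The change of variables is made in y for t ≥ 1/2 and in x for t ≤ 1/2, so that the contraction
  -- factor never falls below 1/2.
  have hslice : ∀ t ∈ Ioc (0 : ℝ) 1, ∫⁻ x in B, ∫⁻ y in B, φ (x + t • (y - x)) ≤
      2 ^ n * volume B * ∫⁻ z in B, φ z := by
    intro t ht
    rcases le_total (1 / 2) t with h | h
    · have e : ∀ x y : E n, x + t • (y - x) = t • y + (1 - t) • x := fun x y => by module
      calc _ ≤ ∫⁻ x in B, 2 ^ n * ∫⁻ z in B, φ z := by
            refine setLIntegral_mono' hBm fun x hx => ?_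
            simp only [e]
            exact setLIntegral_comp_combo_le hφm hBc hBm h ht.2 hx
        _ = _ := by rw [setLIntegral_const]; ring
    · have e : ∀ x y : E n, x + t • (y - x) = (1 - t) • x + (1 - (1 - t)) • y := fun x y => by module
      rw [lintegral_lintegral_swap (Measurable.aemeasurable (by fun_prop))]
      calc _ ≤ ∫⁻ x in B, 2 ^ n * ∫⁻ z in B, φ z := by
            refine setLIntegral_mono' hBm fun x hx => ?_
            simp only [e]
            exact setLIntegral_comp_combo_le hφm hBc hBm (by linarith) (by linarith [ht.1]) hx
        _ = _ := by rw [setLIntegral_const]; ring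
  calc ∫⁻ x in B, ∫⁻ y in B, ‖u x - u y‖ₑ ^ q
      ≤ ∫⁻ x in B, ∫⁻ y in B, R * ∫⁻ t in Ioc (0 : ℝ) 1, φ (x + t • (y - x)) := by
        refine setLIntegral_mono' hBm fun x hx => setLIntegral_mono' hBm fun y hy => ?_
        refine (enorm_sub_rpow_le_lintegral hu hq x y).trans (mul_le_mul_left ?_ _)
        refine ENNReal.rpow_le_rpow ?_ hq0
        rw [← ofReal_norm]
        refine ENNReal.ofReal_le_ofReal ?_
        rw [hB, Metric.mem_ball, dist_zero_right] at hx hy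
        linarith [norm_sub_le x y]
    _ = R * ∫⁻ t in Ioc (0 : ℝ) 1, ∫⁻ x in B, ∫⁻ y in B, φ (x + t • (y - x)) := by
        simp only [lintegral_const_mul' _ _ hRt]
        congr 1
        have e : ∀ x, ∫⁻ y in B, ∫⁻ t in Ioc (0 : ℝ) 1, φ (x + t • (y - x)) =
            ∫⁻ t in Ioc (0 : ℝ) 1, ∫⁻ y in B, φ (x + t • (y - x)) := fun x =>
          lintegral_lintegral_swap (Measurable.aemeasurable (by fun_prop))
        simp only [e]
        refine lintegral_lintegral_swap (Measurable.aemeasurable ?_)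
        have : Measurable fun p : (E n × ℝ) × E n => φ (p.1.1 + p.1.2 • (p.2 - p.1.1)) := by
          fun_prop
        exact this.lintegral_prod_right'
    _ ≤ R * ∫⁻ t in Ioc (0 : ℝ) 1, 2 ^ n * volume B * ∫⁻ z in B, φ z := by
        gcongr R * ?_
        exact setLIntegral_mono' measurableSet_Ioc hslice
    _ = _ := by
        rw [setLIntegral_const, Real.volume_Ioc]
        simp [mul_assoc]

/-- Poincaré's inequality on a ball for functions with a weak gradient bound. -/
theorem WeakGradientBound.poincare {ρ q r : ℝ} (hρ : 0 < ρ) (hq : 1 ≤ q) (hr : r ≤ ρ / 2)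
    {F : E n → ℝ} {h : E n → ℝ≥0∞} (hF : Integrable F) (hFm : Measurable F) (hh : Measurable h)
    (hw : WeakGradientBound ρ F h) :
    ∫⁻ x in Metric.ball (0 : E n) r, ∫⁻ y in Metric.ball (0 : E n) r, ‖F x - F y‖ₑ ^ q ≤
      ENNReal.ofReal (2 * r) ^ q * (2 ^ n * volume (Metric.ball (0 : E n) r)) *
        ∫⁻ x, h x ^ q := by
  have hq0 : 0 < q := by linarith
  obtain ⟨u, hu, hlim, hgrad, -⟩ := hw.exists_approx hρ hq hF hFm hh
  set B := Metric.ball (0 : E n) r with hB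
  set ν := (volume.restrict B : Measure (E n)).prod (volume.restrict B) with hν
  have hprod : ∀ w : E n → ℝ, Measurable w →
      ∫⁻ x in B, ∫⁻ y in B, ‖w x - w y‖ₑ ^ q =
        eLpNorm (fun p : E n × E n => w p.1 - w p.2) (ENNReal.ofReal q) ν ^ q := fun w hw => by
    rw [eLpNorm_ofReal_rpow hq0, hν, lintegral_prod _ (Measurable.aemeasurable (by fun_prop))]
  rw [hprod F hFm, ← ENNReal.le_rpow_inv_iff hq0]
  refine eLpNorm_le_of_tendsto (g := fun k p => u k p.1 - u k p.2) (fun k => ?_) ?_ fun k => ?_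
  · have := (hu k).continuous
    exact Continuous.aestronglyMeasurable (by fun_prop)
  · have h1 : ∀ᵐ x ∂(volume.restrict B : Measure (E n)), Tendsto (fun k => u k x) atTop (𝓝 (F x)) :=
      ae_restrict_of_ae hlim
    filter_upwards [Measure.quasiMeasurePreserving_fst.ae h1,
      Measure.quasiMeasurePreserving_snd.ae h1] with p hp1 hp2
    exact hp1.sub hp2
  · rw [ENNReal.le_rpow_inv_iff hq0, ← hprod (u k) (hu k).continuous.measurable]
    refine (lintegral_lintegral_sub_rpow_le_fderiv (hu k) hq).trans ?_
    exact mul_le_mul_right ((lintegral_mono_set (Metric.ball_subset_ball hr)).trans (hgrad k)) _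

/-- A local Gagliardo-Nirenberg-Sobolev inequality for functions with a weak gradient bound. -/
theorem WeakGradientBound.sobolev (hn : 0 < n) {ρ q : ℝ} (hρ : 0 < ρ) (hq : 1 ≤ q) (hqn : q < n) :
    ∃ C : ℝ≥0, ∀ (F : E n → ℝ) (h : E n → ℝ≥0∞), Integrable F → Measurable F → Measurable h →
      WeakGradientBound ρ F h →
      eLpNorm F (ENNReal.ofReal (n * q / (n - q))) (volume.restrict (Metric.ball 0 (ρ / 4))) ≤
        C * ((∫⁻ x, h x ^ q) ^ q⁻¹ + (∫⁻ x, ‖F x‖ₑ ^ q) ^ q⁻¹) := by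
  have hq0 : 0 < q := by linarith
  have hn0 : (0 : ℝ) < n := by exact_mod_cast hn
  have hnq : 0 < (n : ℝ) - q := by linarith
  -- The cut-off is 1 on the ball where the inequality is claimed and vanishes off the half ball,
  -- where the approximations have controlled gradients.
  let χ : ContDiffBump (0 : E n) := ⟨ρ / 4, ρ / 2, by positivity, by linarith⟩
  have hχin : χ.rIn = ρ / 4 := rfl
  have hχout : χ.rOut = ρ / 2 := rfl
  have hχ : ContDiff ℝ 1 χ := χ.contDiff
  obtain ⟨M, hM⟩ := (χ.hasCompactSupport.fderiv (𝕜 := ℝ)).exists_bound_of_continuous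
    (hχ.continuous_fderiv one_ne_zero)
  have hM0 : 0 ≤ M := (norm_nonneg _).trans (hM 0)
  set p : ℝ≥0 := q.toNNReal with hp
  set Q : ℝ≥0 := (n * q / (n - q)).toNNReal with hQ
  have hpq : (p : ℝ) = q := Real.coe_toNNReal _ hq0.le
  have hQq : (Q : ℝ) = n * q / (n - q) := Real.coe_toNNReal _ (by positivity)
  set C₀ := SNormLESNormFDerivOfEqConst ℝ (volume : Measure (E n)) p with hC₀
  clear_value C₀
  refine ⟨C₀ * (1 + M.toNNReal), fun F h hF hFm hh hw => ?_⟩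
  obtain ⟨u, hu, hlim, hgrad, hunorm⟩ := hw.exists_approx hρ hq hF hFm hh
  refine eLpNorm_le_of_tendsto (g := u) (fun k => (hu k).continuous.aestronglyMeasurable)
    (ae_restrict_of_ae hlim) fun k => ?_
  have hw1 : ContDiff ℝ 1 fun x => χ x * u k x := hχ.mul (hu k)
  have hgns := eLpNorm_le_eLpNorm_fderiv_of_eq (F := ℝ) (volume : Measure (E n)) hw1
    (χ.hasCompactSupport.mul_right) (p := p) (p' := Q) (by rw [← NNReal.coe_le_coe, hpq]; exact hq)
    (by simpa using hn) (by
      push_cast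
      rw [hpq, hQq, finrank_euclideanSpace, Fintype.card_fin]; field_simp)
  rw [← hC₀, show (p : ℝ≥0∞) = ENNReal.ofReal q from rfl] at hgns
  have hfd : ∀ x, fderiv ℝ (fun x => χ x * u k x) x = χ x • fderiv ℝ (u k) x + u k x • fderiv ℝ χ x :=
    fun x => fderiv_fun_mul (hχ.differentiable one_ne_zero x) ((hu k).differentiable one_ne_zero x)
  have hcu := (hu k).continuous
  have hcdu := (hu k).continuous_fderiv one_ne_zero
  have hcχ := hχ.continuous
  have hcdχ := hχ.continuous_fderiv one_ne_zero
  have hb1 : eLpNorm (fun x => χ x * ‖fderiv ℝ (u k) x‖) (ENNReal.ofReal q) volume ≤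
      (∫⁻ x, h x ^ q) ^ q⁻¹ := by
    rw [eLpNorm_ofReal_eq hq0]
    refine ENNReal.rpow_le_rpow (le_trans ?_ (hgrad k)) (by positivity)
    rw [← lintegral_indicator Metric.isOpen_ball.measurableSet]
    refine lintegral_mono fun x => ?_
    by_cases hx : x ∈ Metric.ball (0 : E n) (ρ / 2)
    · rw [indicator_of_mem hx]
      refine ENNReal.rpow_le_rpow ?_ hq0.le
      rw [enorm_mul, enorm_norm]
      refine mul_le_of_le_one_left zero_le ?_
      rw [Real.enorm_of_nonneg χ.nonneg, ← ENNReal.ofReal_one]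
      exact ENNReal.ofReal_le_ofReal χ.le_one
    · have : χ x = 0 := by
        refine χ.zero_of_le_dist ?_
        rw [hχout]
        simpa using hx
      rw [this, zero_mul, enorm_zero, ENNReal.zero_rpow_of_pos hq0]
      exact zero_le
  have hb2 : eLpNorm (fun x => M * u k x) (ENNReal.ofReal q) volume ≤
      M.toNNReal * (∫⁻ x, ‖F x‖ₑ ^ q) ^ q⁻¹ := by
    rw [eLpNorm_ofReal_eq hq0, ← ENNReal.rpow_rpow_inv hq0.ne' (M.toNNReal : ℝ≥0∞),
      ← ENNReal.mul_rpow_of_nonneg _ _ (by positivity)]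
    refine ENNReal.rpow_le_rpow ?_ (by positivity)
    refine le_trans ?_ (mul_le_mul_right (hunorm k) _)
    rw [← lintegral_const_mul' _ _ (ENNReal.rpow_ne_top_of_nonneg hq0.le ENNReal.coe_ne_top)]
    refine lintegral_mono fun x => ?_
    rw [← ENNReal.mul_rpow_of_nonneg _ _ hq0.le, enorm_mul, Real.enorm_of_nonneg hM0]
    rfl
  have hb3 : eLpNorm (fderiv ℝ fun x => χ x * u k x) (ENNReal.ofReal q) volume ≤
      (∫⁻ x, h x ^ q) ^ q⁻¹ + M.toNNReal * (∫⁻ x, ‖F x‖ₑ ^ q) ^ q⁻¹ := by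
    have e : ∀ x, ‖fderiv ℝ (fun x => χ x * u k x) x‖ ≤
        ‖χ x * ‖fderiv ℝ (u k) x‖‖ + ‖M * u k x‖ := fun x => by
      rw [hfd]
      refine (norm_add_le _ _).trans (add_le_add ?_ ?_)
      · rw [norm_smul, norm_mul, norm_norm]
      · rw [norm_smul, norm_mul, Real.norm_of_nonneg hM0, mul_comm]
        gcongr
        exact hM x
    have h1 : eLpNorm (fderiv ℝ fun x => χ x * u k x) (ENNReal.ofReal q) volume ≤
        eLpNorm ((fun x => ‖χ x * ‖fderiv ℝ (u k) x‖‖) + fun x => ‖M * u k x‖)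
          (ENNReal.ofReal q) volume := eLpNorm_mono_real e
    refine h1.trans ((eLpNorm_add_le (Continuous.aestronglyMeasurable (by fun_prop))
      (Continuous.aestronglyMeasurable (by fun_prop)) ?_).trans (add_le_add ?_ ?_))
    · simpa using hq
    · rwa [eLpNorm_norm]
    · rwa [eLpNorm_norm]
  calc eLpNorm (u k) (ENNReal.ofReal (n * q / (n - q))) (volume.restrict (Metric.ball 0 (ρ / 4)))
      = eLpNorm (fun x => χ x * u k x) Q (volume.restrict (Metric.ball 0 (ρ / 4))) := by
        refine eLpNorm_congr_ae ?_
        filter_upwards [ae_restrict_mem Metric.isOpen_ball.measurableSet] with x hx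
        rw [χ.one_of_mem_closedBall (Metric.ball_subset_closedBall hx), one_mul]
    _ ≤ eLpNorm (fun x => χ x * u k x) Q volume := eLpNorm_restrict_le _ _ _ _
    _ ≤ C₀ * eLpNorm (fderiv ℝ fun x => χ x * u k x) (ENNReal.ofReal q) volume := hgns
    _ ≤ C₀ * ((∫⁻ x, h x ^ q) ^ q⁻¹ + M.toNNReal * (∫⁻ x, ‖F x‖ₑ ^ q) ^ q⁻¹) := by
        gcongr
    _ ≤ _ := by
        rw [ENNReal.coe_mul, mul_assoc]
        refine mul_le_mul_right ?_ _
        rw [mul_add]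
        refine add_le_add ?_ ?_
        · refine le_mul_of_one_le_left zero_le ?_
          rw [ENNReal.coe_add]; exact le_self_add
        · refine mul_le_mul_left ?_ _
          rw [ENNReal.coe_add]; exact le_add_self

end Poincare

/-! ### Integration over boundary balls in charts; finiteness and lower density -/

section ChartMeasure

variable {K : Set (E (d + 1))} {x e : E (d + 1)} {r : ℝ} {Φ : E d → E (d + 1)}
  {J : E d →ₗᵢ[ℝ] E (d + 1)} {p : E (d + 1) →L[ℝ] E d}

/-- Every boundary point of `K` is the center of a graph chart of radius `r`. -/
def HasUniformCharts (K : Set (E (d + 1))) (r : ℝ) : Prop :=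
  ∀ x ∈ frontier K, ∃ e J p Φ, IsGraphChart K x r e J p Φ

namespace IsGraphChart

theorem mono (h : IsGraphChart K x r e J p Φ) {t : ℝ} (ht : t ≤ r) :
    IsGraphChart K x t e J p Φ := by
  have hsub : Metric.ball (0 : E d) t ⊆ Metric.ball 0 r := Metric.ball_subset_ball ht
  refine ⟨h.frame, ⟨Metric.isOpen_ball, h.param.2.1.mono hsub, h.param.2.2.1.mono hsub,
    h.param.2.2.2.1.mono_left hsub, fun u hu => h.param.2.2.2.2 u (hsub hu)⟩, h.measurable,
    h.map_zero, fun u hu => h.proj u (hsub hu),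
    fun u hu v hv => h.dist_le u (hsub hu) v (hsub hv), ?_,
    fun u hu => h.half_le_inner u (hsub hu)⟩
  rintro y ⟨hyK, hyx⟩
  obtain ⟨u, hu, rfl⟩ := h.cover ⟨hyK, Metric.ball_subset_ball ht hyx⟩
  refine ⟨u, ?_, rfl⟩
  rw [Metric.mem_ball, dist_zero_right]
  have h1 := h.frame.norm_proj_le (Φ u - x)
  rw [h.proj u hu] at h1
  rw [Metric.mem_ball, dist_eq_norm] at hyx
  exact h1.trans_lt hyx

/-- The chart is shrunk to radius 2t, whose image still covers the closed ball of radius t; 2^d is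
the measure distortion of Φ. -/
theorem setLIntegral_closedBall_le (h : IsGraphChart K x r e J p Φ) {t : ℝ} (ht0 : 0 < t)
    (ht : 2 * t ≤ r) {g : E (d + 1) → ℝ≥0∞} (hg : Measurable g) :
    ∫⁻ y in Metric.closedBall x t, g y ∂(surfaceMeasure K) ≤
      2 ^ d * ∫⁻ u in Metric.ball 0 (2 * t), g (Φ u) := by
  have h' := h.mono ht
  rw [← lintegral_map hg h.measurable, ← smul_eq_mul, ← lintegral_smul_measure]
  refine lintegral_mono' (le_trans ?_ h'.le_map) le_rfl
  rw [surfaceMeasure, Measure.restrict_restrict Metric.isClosed_closedBall.measurableSet]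
  refine Measure.restrict_mono (fun y hy => h'.cover ⟨hy.2, ?_⟩) le_rfl
  exact Metric.closedBall_subset_ball (by linarith) hy.1

theorem surfaceMeasure_closedBall_le (h : IsGraphChart K x r e J p Φ) {t : ℝ} (ht0 : 0 < t)
    (ht : 2 * t ≤ r) :
    surfaceMeasure K (Metric.closedBall x t) ≤ 2 ^ d * volume (Metric.ball (0 : E d) (2 * t)) := by
  have := h.setLIntegral_closedBall_le ht0 ht (g := fun _ => 1) measurable_const
  simpa using this

theorem mem_closedBall (h : IsGraphChart K x r e J p Φ) (hr : 0 < r) {u : E d}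
    (hu : u ∈ Metric.ball 0 r) : Φ u ∈ Metric.closedBall x (2 * r) := by
  have h1 := h.dist_le u hu 0 (Metric.mem_ball_self hr)
  rw [h.map_zero] at h1
  rw [Metric.mem_ball] at hu
  rw [Metric.mem_closedBall]
  linarith

theorem setLIntegral_comp_le (h : IsGraphChart K x r e J p Φ) (hr : 0 < r)
    {g : E (d + 1) → ℝ≥0∞} (hg : Measurable g) :
    ∫⁻ u in Metric.ball 0 r, g (Φ u) ≤
      ∫⁻ y in Metric.closedBall x (2 * r), g y ∂(surfaceMeasure K) := by
  have hm := Metric.isClosed_closedBall (x := x) (ε := 2 * r) |>.measurableSet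
  rw [← lintegral_indicator hm]
  refine le_trans ?_ (h.lintegral_le (hg.indicator hm))
  refine setLIntegral_mono' Metric.isOpen_ball.measurableSet fun u hu => ?_
  rw [indicator_of_mem (h.mem_closedBall hr hu)]

theorem ae_comp (h : IsGraphChart K x r e J p Φ) {P : E (d + 1) → Prop}
    (hP : ∀ᵐ y ∂(surfaceMeasure K), P y) :
    ∀ᵐ u ∂(volume.restrict (Metric.ball (0 : E d) r)), P (Φ u) :=
  ae_of_ae_map h.measurable.aemeasurable (ae_mono h.map_le_surfaceMeasure hP)

theorem norm_fderiv_le (h : IsGraphChart K x r e J p Φ) {u : E d} (hu : u ∈ Metric.ball 0 r) :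
    ‖fderiv ℝ Φ u‖ ≤ 2 := by
  have hL : LipschitzOnWith 2 Φ (Metric.ball 0 r) :=
    LipschitzOnWith.of_dist_le_mul fun a ha b hb => by simpa using h.dist_le a ha b hb
  simpa using norm_fderiv_le_of_lipschitzOn ℝ (Metric.isOpen_ball.mem_nhds hu) hL

end IsGraphChart

theorem IsSmoothBody.isFiniteMeasure_surfaceMeasure (hK : IsSmoothBody K) :
    IsFiniteMeasure (surfaceMeasure K) := by
  obtain ⟨R, hR, hchart⟩ := hK.exists_isGraphChart_small
  refine ⟨?_⟩
  have h1 : surfaceMeasure K (frontier K) < ⊤ := by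
    refine hK.isCompact_frontier.measure_lt_top_of_nhdsWithin fun x hx => ?_
    obtain ⟨e, J, p, Φ, h⟩ := hchart x hx
    refine ⟨Metric.closedBall x (R / 2), mem_nhdsWithin_of_mem_nhds
      (Metric.closedBall_mem_nhds x (by positivity)), ?_⟩
    refine (h.surfaceMeasure_closedBall_le (t := R / 2) (by positivity) (by linarith)).trans_lt ?_
    exact ENNReal.mul_lt_top (by simp) Metric.isBounded_ball.measure_lt_top
  rw [surfaceMeasure, Measure.restrict_apply_univ]
  rwa [surfaceMeasure, Measure.restrict_apply isClosed_frontier.measurableSet, inter_self] at h1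

theorem HasUniformCharts.lowerDensity (h : HasUniformCharts K r) :
    LowerDensity (surfaceMeasure K) (frontier K) d ((1 / 2) ^ d * unitBallVolume d) r := by
  intro x hx t ht0 ht
  obtain ⟨e, J, p, Φ, hΦ⟩ := h x hx
  refine le_trans ?_ ((hΦ.volume_ball_le ht0 ht).trans
    (measure_mono Metric.ball_subset_closedBall))
  rw [volume_ball_eq _ (by positivity)]
  refine ENNReal.ofReal_le_ofReal (le_of_eq ?_)
  rw [div_pow, div_pow]; ring

theorem ae_mem_frontier (K : Set (E (d + 1))) : ∀ᵐ x ∂(surfaceMeasure K), x ∈ frontier K :=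
  ae_restrict_mem isClosed_frontier.measurableSet

end ChartMeasure

/-! ### Weak gradients and Poincaré's inequality in charts -/

section ChartGradient

variable {K : Set (E (d + 1))} {x e : E (d + 1)} {r q : ℝ} {Φ : E d → E (d + 1)}
  {J : E d →ₗᵢ[ℝ] E (d + 1)} {p : E (d + 1) →L[ℝ] E d} {f : E (d + 1) → ℝ}
  {g : E (d + 1) → E (d + 1)} {f₁ : E (d + 1) → ℝ} {G : E (d + 1) → ℝ≥0∞}

/-- The representation of a function on the boundary in a chart, extended by zero. -/
def chartFun (r : ℝ) (Φ : E d → E (d + 1)) (f : E (d + 1) → ℝ) : E d → ℝ :=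
  (Metric.ball 0 r).indicator fun u => f (Φ u)

/-- The representation of the modulus of a gradient in a chart, extended by zero. -/
def chartGrad (r : ℝ) (Φ : E d → E (d + 1)) (G : E (d + 1) → ℝ≥0∞) : E d → ℝ≥0∞ :=
  (Metric.ball 0 r).indicator fun u => 2 * G (Φ u)

theorem IsGraphChart.weakGradientBound (h : IsGraphChart K x r e J p Φ)
    (hg : HasWeakGradient K q f g) (hf₁ : f =ᵐ[surfaceMeasure K] f₁)
    (hG : (fun y => ‖g y‖ₑ) =ᵐ[surfaceMeasure K] G) :
    WeakGradientBound r (chartFun r Φ f₁) (chartGrad r Φ G) := by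
  intro ψ hψ hψc hψs v
  have hB : MeasurableSet (Metric.ball (0 : E d) r) := Metric.isOpen_ball.measurableSet
  have h1 := hg.2.2 (Metric.ball 0 r) Φ h.param ψ hψ hψc hψs v
  have e1 : ∫ u, chartFun r Φ f₁ u * fderiv ℝ ψ u v =
      ∫ u in Metric.ball 0 r, f (Φ u) * fderiv ℝ ψ u v := by
    rw [← integral_indicator hB]
    have : ∀ᵐ u, u ∈ Metric.ball (0 : E d) r → f (Φ u) = f₁ (Φ u) :=
      (ae_restrict_iff' hB).1 (h.ae_comp hf₁)
    refine integral_congr_ae ?_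
    filter_upwards [this] with u hu
    by_cases hur : u ∈ Metric.ball (0 : E d) r
    · rw [indicator_of_mem hur, chartFun, indicator_of_mem hur, hu hur]
    · rw [indicator_of_notMem hur, chartFun, indicator_of_notMem hur, zero_mul]
  rw [e1, h1, enorm_neg]
  refine (enorm_integral_le_lintegral_enorm _).trans ?_
  rw [← lintegral_const_mul' _ _ (by simp), ← lintegral_indicator hB]
  refine lintegral_mono_ae ?_
  have : ∀ᵐ u, u ∈ Metric.ball (0 : E d) r → ‖g (Φ u)‖ₑ = G (Φ u) :=
    (ae_restrict_iff' hB).1 (h.ae_comp hG)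
  filter_upwards [this] with u hu
  by_cases hur : u ∈ Metric.ball (0 : E d) r
  · rw [indicator_of_mem hur, chartGrad, indicator_of_mem hur, ← hu hur, enorm_mul, ← mul_assoc]
    gcongr
    -- The factor 2 in `chartGrad` is the bound for the derivative of Φ.
    have h2 : ‖⟪g (Φ u), fderiv ℝ Φ u v⟫‖ ≤ ‖v‖ * (2 * ‖g (Φ u)‖) := by
      calc _ ≤ ‖g (Φ u)‖ * ‖fderiv ℝ Φ u v‖ := norm_inner_le_norm _ _
        _ ≤ ‖g (Φ u)‖ * (2 * ‖v‖) := by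
          gcongr
          exact (ContinuousLinearMap.le_opNorm _ _).trans
            (mul_le_mul_of_nonneg_right (h.norm_fderiv_le hur) (norm_nonneg _))
        _ = _ := by ring
    have h3 := ENNReal.ofReal_le_ofReal h2
    rwa [ENNReal.ofReal_mul (norm_nonneg _), ENNReal.ofReal_mul zero_le_two, ofReal_norm,
      ofReal_norm, ofReal_norm, ENNReal.ofReal_ofNat] at h3
  · rw [indicator_of_notMem hur]; exact zero_le

theorem IsGraphChart.integrable_chartFun (h : IsGraphChart K x r e J p Φ)
    (hf : Integrable f₁ (surfaceMeasure K)) : Integrable (chartFun r Φ f₁) := by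
  rw [chartFun, integrable_indicator_iff Metric.isOpen_ball.measurableSet]
  exact (hf.mono_measure h.map_le_surfaceMeasure).comp_measurable h.measurable

theorem IsGraphChart.measurable_chartFun (h : IsGraphChart K x r e J p Φ) (hf : Measurable f₁) :
    Measurable (chartFun r Φ f₁) :=
  (hf.comp h.measurable).indicator Metric.isOpen_ball.measurableSet

theorem IsGraphChart.measurable_chartGrad (h : IsGraphChart K x r e J p Φ) (hG : Measurable G) :
    Measurable (chartGrad r Φ G) :=
  ((hG.comp h.measurable).const_mul 2).indicator Metric.isOpen_ball.measurableSet

theorem IsGraphChart.lintegral_chartFun_le (h : IsGraphChart K x r e J p Φ) (hr : 0 < r)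
    (hf : Measurable f₁) (hq : 0 < q) :
    ∫⁻ u, ‖chartFun r Φ f₁ u‖ₑ ^ q ≤
      ∫⁻ y in Metric.closedBall x (2 * r), ‖f₁ y‖ₑ ^ q ∂(surfaceMeasure K) := by
  refine le_trans (le_of_eq ?_) (h.setLIntegral_comp_le hr (hf.enorm.pow_const q))
  rw [← lintegral_indicator Metric.isOpen_ball.measurableSet]
  refine lintegral_congr fun u => ?_
  by_cases hur : u ∈ Metric.ball (0 : E d) r
  · rw [chartFun, indicator_of_mem hur, indicator_of_mem hur]
  · rw [chartFun, indicator_of_notMem hur, indicator_of_notMem hur, enorm_zero,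
      ENNReal.zero_rpow_of_pos hq]

theorem IsGraphChart.lintegral_chartGrad_le (h : IsGraphChart K x r e J p Φ) (hr : 0 < r)
    (hG : Measurable G) (hq : 0 < q) :
    ∫⁻ u, chartGrad r Φ G u ^ q ≤
      2 ^ q * ∫⁻ y in Metric.closedBall x (2 * r), G y ^ q ∂(surfaceMeasure K) := by
  refine le_trans (le_of_eq ?_) (mul_le_mul_right (h.setLIntegral_comp_le hr (hG.pow_const q)) _)
  rw [← lintegral_const_mul' _ _ (ENNReal.rpow_ne_top_of_nonneg hq.le (by simp)),
    ← lintegral_indicator Metric.isOpen_ball.measurableSet]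
  refine lintegral_congr fun u => ?_
  by_cases hur : u ∈ Metric.ball (0 : E d) r
  · rw [chartGrad, indicator_of_mem hur, indicator_of_mem hur, ENNReal.mul_rpow_of_nonneg _ _ hq.le]
  · rw [chartGrad, indicator_of_notMem hur, indicator_of_notMem hur, ENNReal.zero_rpow_of_pos hq]

/-- Poincaré's inequality on small balls of the boundary. -/
theorem IsGraphChart.poincare (h : IsGraphChart K x r e J p Φ) (hr : 0 < r) (hq : 1 ≤ q)
    (hg : HasWeakGradient K q f g) (hf₁ : f =ᵐ[surfaceMeasure K] f₁) (hf₁m : Measurable f₁)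
    (hf₁i : Integrable f₁ (surfaceMeasure K))
    (hG : (fun y => ‖g y‖ₑ) =ᵐ[surfaceMeasure K] G) (hGm : Measurable G)
    {t : ℝ} (ht0 : 0 < t) (ht : t ≤ r / 4) :
    ∫⁻ y in Metric.closedBall x t, ∫⁻ z in Metric.closedBall x t, ‖f₁ y - f₁ z‖ₑ ^ q
        ∂(surfaceMeasure K) ∂(surfaceMeasure K) ≤
      2 ^ d * 2 ^ d * (ENNReal.ofReal (2 * (2 * t)) ^ q *
        (2 ^ d * volume (Metric.ball (0 : E d) (2 * t))) *
          (2 ^ q * ∫⁻ y, G y ^ q ∂(surfaceMeasure K))) := by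
  have hq0 : 0 < q := by linarith
  set B := Metric.ball (0 : E d) (2 * t) with hB
  have hBm : MeasurableSet B := Metric.isOpen_ball.measurableSet
  have hBr : B ⊆ Metric.ball 0 r := Metric.ball_subset_ball (by linarith)
  have hmeas : Measurable fun w : E d × E d => ‖f₁ (Φ w.1) - f₁ (Φ w.2)‖ₑ ^ q := by
    have := hf₁m.comp h.measurable
    have h1 : Measurable fun w : E d × E d => f₁ (Φ w.1) := this.comp measurable_fst
    have h2 : Measurable fun w : E d × E d => f₁ (Φ w.2) := this.comp measurable_snd
    exact (h1.sub h2).enorm.pow_const q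
  have hmeas2 : Measurable fun y => ∫⁻ v in B, ‖f₁ y - f₁ (Φ v)‖ₑ ^ q := by
    have h1 : Measurable fun w : E (d + 1) × E d => f₁ w.1 := hf₁m.comp measurable_fst
    have h2 : Measurable fun w : E (d + 1) × E d => f₁ (Φ w.2) :=
      (hf₁m.comp h.measurable).comp measurable_snd
    exact ((h1.sub h2).enorm.pow_const q).lintegral_prod_right'
  calc _ ≤ ∫⁻ y in Metric.closedBall x t, 2 ^ d * (∫⁻ v in B, ‖f₁ y - f₁ (Φ v)‖ₑ ^ q)
        ∂(surfaceMeasure K) := by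
        refine lintegral_mono fun y => h.setLIntegral_closedBall_le ht0 (by linarith) ?_
        exact (measurable_const.sub hf₁m).enorm.pow_const q
    _ = 2 ^ d * ∫⁻ y in Metric.closedBall x t, (∫⁻ v in B, ‖f₁ y - f₁ (Φ v)‖ₑ ^ q)
        ∂(surfaceMeasure K) := lintegral_const_mul' _ _ (by simp)
    _ ≤ 2 ^ d * (2 ^ d * ∫⁻ u in B, ∫⁻ v in B, ‖f₁ (Φ u) - f₁ (Φ v)‖ₑ ^ q) := by
        gcongr
        exact h.setLIntegral_closedBall_le ht0 (by linarith) hmeas2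
    _ = 2 ^ d * 2 ^ d * ∫⁻ u in B, ∫⁻ v in B, ‖chartFun r Φ f₁ u - chartFun r Φ f₁ v‖ₑ ^ q := by
        rw [mul_assoc]
        congr 2
        refine setLIntegral_congr_fun hBm fun u hu => setLIntegral_congr_fun hBm fun v hv => ?_
        simp only [chartFun]
        rw [indicator_of_mem (hBr hu), indicator_of_mem (hBr hv)]
    _ ≤ _ := by
        gcongr
        refine ((h.weakGradientBound hg hf₁ hG).poincare hr hq (by linarith)
          (h.integrable_chartFun hf₁i) (h.measurable_chartFun hf₁m)
          (h.measurable_chartGrad hGm)).trans ?_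
        gcongr
        refine (h.lintegral_chartGrad_le hr hGm hq0).trans ?_
        exact mul_le_mul_right (setLIntegral_le_lintegral _ _) _

end ChartGradient

/-! ### Hölder representatives on the boundary -/

section HolderOnBoundary

theorem OscillationBound.congr_ae {n : ℕ} {σ : Measure (E n)} {S : Set (E n)} {κ q A N r₀ : ℝ}
    {f f₁ : E n → ℝ} (h : OscillationBound σ S κ q A N r₀ f) (hf : f =ᵐ[σ] f₁) :
    OscillationBound σ S κ q A N r₀ f₁ := by
  intro z hz r hr0 hr
  refine le_trans (le_of_eq ?_) (h z hz r hr0 hr)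
  refine lintegral_congr_ae ((ae_restrict_of_ae hf).mono fun x hx => ?_)
  refine lintegral_congr_ae ((ae_restrict_of_ae hf).mono fun y hy => ?_)
  simp only [hx, hy]

theorem integrable_of_memLp_ofReal {X F : Type*} [MeasurableSpace X] {μ : Measure X}
    [IsFiniteMeasure μ] [NormedAddCommGroup F] {f : X → F} {q : ℝ} (hq : 1 ≤ q)
    (hf : MemLp f (ENNReal.ofReal q) μ) : Integrable f μ :=
  hf.integrable (by simpa using hq)

/-- Functions on the boundary with controlled oscillation have Hölder continuous representatives. -/
theorem exists_holder_representative {d : ℕ} {c r₀ β q A : ℝ} (hc : 0 < c) (hr₀ : 0 < r₀)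
    (hβ : 0 < β) (hq : 1 ≤ q) (hA : 0 ≤ A) :
    ∃ C : ℝ≥0, 0 < C ∧ ∀ K : Set (E (d + 1)), IsFiniteMeasure (surfaceMeasure K) →
      LowerDensity (surfaceMeasure K) (frontier K) d c r₀ → ∀ f : E (d + 1) → ℝ,
      MemLp f (ENNReal.ofReal q) (surfaceMeasure K) →
      (∃ N : ℝ≥0∞, N ≠ ⊤ ∧
        OscillationBound (surfaceMeasure K) (frontier K) (2 * d + β * q) q A N.toReal r₀ f) →
      ∃ f' : E (d + 1) → ℝ, f' =ᵐ[surfaceMeasure K] f ∧ ContinuousOn f' (frontier K) ∧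
        ∀ N : ℝ≥0∞, N ≠ ⊤ →
          OscillationBound (surfaceMeasure K) (frontier K) (2 * d + β * q) q A N.toReal r₀ f →
          eLpNorm f' ⊤ (surfaceMeasure K) + holderSeminorm K β f' ≤
            C * (N + eLpNorm f (ENNReal.ofReal q) (surfaceMeasure K)) := by
  have hq0 : 0 < q := by linarith
  obtain ⟨C, hC0, hC⟩ := exists_holder_bound (n := d + 1) (d := d) hc hr₀ hβ hq hA
  refine ⟨2 * C.toNNReal + 1, by positivity, fun K hfin hdens f hf hosc => ?_⟩
  have hint := integrable_of_memLp_ofReal hq hf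
  set L := eLpNorm f (ENNReal.ofReal q) (surfaceMeasure K) with hL
  have hLt : L ≠ ⊤ := hf.2.ne
  have hfL : ∫⁻ x, ‖f x‖ₑ ^ q ∂(surfaceMeasure K) ≤ ENNReal.ofReal (L.toReal ^ q) := by
    rw [← ENNReal.ofReal_rpow_of_nonneg ENNReal.toReal_nonneg hq0.le, ENNReal.ofReal_toReal hLt,
      hL, eLpNorm_ofReal_rpow hq0]
  have key := fun N : ℝ≥0∞ => hC (surfaceMeasure K) (frontier K) hdens f N.toReal L.toReal
    ENNReal.toReal_nonneg ENNReal.toReal_nonneg hint hfL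
  -- The representative is independent of N, so its bound can later be minimized over all weak
  -- gradients.
  refine ⟨ballAverageLimit (surfaceMeasure K) r₀ f, ballAverageLimit_ae_eq hr₀ hint, ?_,
    fun N hN hNosc => ?_⟩
  · obtain ⟨N, hN, hNosc⟩ := hosc
    obtain ⟨-, h2⟩ := key N hNosc
    intro x hx
    rw [ContinuousWithinAt, tendsto_iff_dist_tendsto_zero]
    have hlim : Tendsto (fun y => C * (N.toReal + L.toReal) * dist y x ^ β) (𝓝[frontier K] x)
        (𝓝 0) := by
      have h3 : Tendsto (fun y : E (d + 1) => dist y x) (𝓝[frontier K] x) (𝓝 0) :=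
        tendsto_nhdsWithin_of_tendsto_nhds (tendsto_iff_dist_tendsto_zero.1 tendsto_id)
      simpa [Real.zero_rpow hβ.ne'] using
        (h3.rpow_const (Or.inr hβ.le)).const_mul (C * (N.toReal + L.toReal))
    refine squeeze_zero' (Eventually.of_forall fun y => dist_nonneg) ?_ hlim
    filter_upwards [self_mem_nhdsWithin] with y hy
    rw [Real.dist_eq]
    exact h2 y hy x hx
  · obtain ⟨h1, h2⟩ := key N hNosc
    have hNL : 0 ≤ C * (N.toReal + L.toReal) := by positivity
    have e : ENNReal.ofReal (C * (N.toReal + L.toReal)) = C.toNNReal * (N + L) := by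
      rw [ENNReal.ofReal_mul hC0, ENNReal.ofReal_add ENNReal.toReal_nonneg ENNReal.toReal_nonneg,
        ENNReal.ofReal_toReal hN, ENNReal.ofReal_toReal hLt]
      rfl
    have b1 : eLpNorm (ballAverageLimit (surfaceMeasure K) r₀ f) ⊤ (surfaceMeasure K) ≤
        C.toNNReal * (N + L) := by
      rw [← e, eLpNorm_exponent_top]
      exact eLpNormEssSup_le_of_ae_bound ((ae_mem_frontier K).mono fun x hx => h1 x hx)
    have b2 : holderSeminorm K β (ballAverageLimit (surfaceMeasure K) r₀ f) ≤
        C.toNNReal * (N + L) := by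
      refine iSup₂_le fun x hx => iSup₂_le fun y hy => iSup_le fun hxy => ?_
      refine ENNReal.div_le_of_le_mul ?_
      rw [← e, ← ofReal_norm (x - y), ENNReal.ofReal_rpow_of_nonneg (norm_nonneg _) hβ.le,
        ← ENNReal.ofReal_mul hNL, Real.enorm_eq_ofReal_abs, ← dist_eq_norm]
      exact ENNReal.ofReal_le_ofReal (h2 x hx y hy)
    calc _ ≤ C.toNNReal * (N + L) + C.toNNReal * (N + L) := add_le_add b1 b2
      _ = (2 * C.toNNReal : ℝ≥0∞) * (N + L) := by ring
      _ ≤ _ := by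
        gcongr
        rw [ENNReal.coe_add, ENNReal.coe_mul]
        exact le_self_add

/-- For x in B_r(z) the ball B_r(z) lies in B_{2r}(x), where |x - y|^(d+αq) is at most (2r)^(d+αq).
The exponent agrees with Campanato's for β = α - d/q. -/
theorem oscillationBound_of_gagliardo {K : Set (E (d + 1))} {α q : ℝ} (hα : 0 < α) (hq : 1 ≤ q)
    {f : E (d + 1) → ℝ} (hf : gagliardoSeminorm K α q f ≠ ⊤) (r₀ : ℝ) :
    OscillationBound (surfaceMeasure K) (frontier K) (2 * d + (α - d / q) * q) q
      (2 ^ ((d : ℝ) + α * q)) (gagliardoSeminorm K α q f).toReal r₀ f := by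
  have hq0 : 0 < q := by linarith
  intro z hz r hr0 hr
  have e1 : 2 * (d : ℝ) + (α - d / q) * q = d + α * q := by field_simp; ring
  have hR : 0 ≤ r * 2 := by linarith
  calc _ ≤ ∫⁻ x in Metric.closedBall z r, ∫⁻ y in Metric.closedBall x (r * 2), ‖f x - f y‖ₑ ^ q
        ∂(surfaceMeasure K) ∂(surfaceMeasure K) := by
        refine setLIntegral_mono' Metric.isClosed_closedBall.measurableSet fun x hx =>
          lintegral_mono_set (Metric.closedBall_subset_closedBall' ?_)
        rw [Metric.mem_closedBall, dist_comm] at hx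
        linarith
    _ ≤ ∫⁻ x in Metric.closedBall z r, ENNReal.ofReal (r * 2) ^ ((d : ℝ) + α * q) *
        gagliardoDensity (surfaceMeasure K) ((d : ℝ) + α * q) q f x ∂(surfaceMeasure K) :=
        lintegral_mono fun x => setLIntegral_sub_rpow_le (by positivity) hq0 f x
    _ ≤ ENNReal.ofReal (r * 2) ^ ((d : ℝ) + α * q) *
        ∫⁻ x, gagliardoDensity (surfaceMeasure K) ((d : ℝ) + α * q) q f x
          ∂(surfaceMeasure K) := by
        rw [lintegral_const_mul' _ _ (ENNReal.rpow_ne_top_of_nonneg (by positivity)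
          ENNReal.ofReal_ne_top)]
        exact mul_le_mul_right (setLIntegral_le_lintegral _ _) _
    _ = ENNReal.ofReal (r * 2) ^ ((d : ℝ) + α * q) * gagliardoSeminorm K α q f ^ q := by
        rw [gagliardoSeminorm, one_div, ENNReal.rpow_inv_rpow hq0.ne']
        rfl
    _ = _ := by
        conv_lhs => rw [← ENNReal.ofReal_toReal hf]
        rw [e1, ENNReal.ofReal_rpow_of_nonneg hR (by positivity),
          ENNReal.ofReal_rpow_of_nonneg ENNReal.toReal_nonneg hq0.le,
          ← ENNReal.ofReal_mul (by positivity), Real.mul_rpow hr0.le zero_le_two, mul_comm (r ^ _)]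

/-- Poincaré in a chart centred at the given point yields t^q times the volume t^d, which is
Campanato's exponent for β = 1 - d/q. -/
theorem oscillationBound_of_hasWeakGradient {K : Set (E (d + 1))} (hK : IsSmoothBody K) {r q : ℝ}
    (hr : 0 < r) (hcharts : HasUniformCharts K r) (hq : 1 ≤ q) {f : E (d + 1) → ℝ}
    (hf : MemLp f (ENNReal.ofReal q) (surfaceMeasure K)) {g : E (d + 1) → E (d + 1)}
    (hg : HasWeakGradient K q f g) :
    OscillationBound (surfaceMeasure K) (frontier K) (2 * d + (1 - d / q) * q) q
      (2 ^ d * 2 ^ d * (4 ^ q * (2 ^ d * (2 ^ d * unitBallVolume d)) * 2 ^ q))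
      (eLpNorm g (ENNReal.ofReal q) (surfaceMeasure K)).toReal (r / 4) f := by
  have hq0 : 0 < q := by linarith
  have := hK.isFiniteMeasure_surfaceMeasure
  obtain ⟨f₁, hf₁, hff₁⟩ := hf.1
  obtain ⟨G, hG, hgG⟩ := hg.1.1.enorm
  refine OscillationBound.congr_ae ?_ hff₁.symm
  have hf₁i : Integrable f₁ (surfaceMeasure K) :=
    (integrable_of_memLp_ofReal hq hf).congr hff₁
  have hgt : eLpNorm g (ENNReal.ofReal q) (surfaceMeasure K) ≠ ⊤ := hg.1.2.ne
  have hGN : ∫⁻ y, G y ^ q ∂(surfaceMeasure K) =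
      ENNReal.ofReal ((eLpNorm g (ENNReal.ofReal q) (surfaceMeasure K)).toReal ^ q) := by
    rw [← ENNReal.ofReal_rpow_of_nonneg ENNReal.toReal_nonneg hq0.le, ENNReal.ofReal_toReal hgt,
      eLpNorm_ofReal_rpow hq0]
    refine lintegral_congr_ae (hgG.mono fun y hy => ?_)
    simp only [← hy]
  intro z hz t ht0 ht
  obtain ⟨e, J, p, Φ, h⟩ := hcharts z hz
  refine (h.poincare hr hq hg hff₁ hf₁.measurable hf₁i hgG hG ht0 ht).trans (le_of_eq ?_)
  have hω := unitBallVolume_pos d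
  have e1 : 2 * (d : ℝ) + (1 - d / q) * q = q + d := by field_simp; ring
  have e2 : (2 : ℝ≥0∞) ^ d = ENNReal.ofReal (2 ^ d) := by
    rw [ENNReal.ofReal_pow zero_le_two, ENNReal.ofReal_ofNat]
  have e2' : (2 : ℝ≥0∞) ^ q = ENNReal.ofReal (2 ^ q) := by
    rw [← ENNReal.ofReal_rpow_of_nonneg zero_le_two hq0.le, ENNReal.ofReal_ofNat]
  rw [hGN, volume_ball_eq _ (by positivity : 0 < 2 * t), e2, e2',
    ENNReal.ofReal_rpow_of_nonneg (by positivity) hq0.le,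
    ← ENNReal.ofReal_mul (by positivity), ← ENNReal.ofReal_mul (by positivity),
    ← ENNReal.ofReal_mul (by positivity), ← ENNReal.ofReal_mul (by positivity),
    ← ENNReal.ofReal_mul (by positivity), ← ENNReal.ofReal_mul (by positivity), e1,
    Real.rpow_add ht0, Real.rpow_natCast]
  congr 1
  have e3 : 2 * (2 * t) = 4 * t := by ring
  rw [e3, Real.mul_rpow (by norm_num) ht0.le, mul_pow]
  ring

end HolderOnBoundary

/-! ### The first-order Sobolev inequality on the boundary -/

section SobolevOnBoundary

/-- Tonelli and the symmetry of the distance. Averaging local estimates over all centres replaces a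
covering with bounded overlap. -/
theorem lintegral_setLIntegral_closedBall {n : ℕ} {σ : Measure (E n)} [IsFiniteMeasure σ] (t : ℝ)
    {φ : E n → ℝ≥0∞} (hφ : Measurable φ) :
    ∫⁻ z, ∫⁻ y in Metric.closedBall z t, φ y ∂σ ∂σ =
      ∫⁻ y, φ y * σ (Metric.closedBall y t) ∂σ := by
  have hS : MeasurableSet {w : E n × E n | dist w.2 w.1 ≤ t} :=
    measurableSet_le (by fun_prop) measurable_const
  have h1 : ∀ z, ∫⁻ y in Metric.closedBall z t, φ y ∂σ =
      ∫⁻ y, {w : E n × E n | dist w.2 w.1 ≤ t}.indicator (fun w => φ w.2) (z, y) ∂σ := fun z => by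
    rw [← lintegral_indicator Metric.isClosed_closedBall.measurableSet]
    rfl
  have h2 : ∀ y, φ y * σ (Metric.closedBall y t) =
      ∫⁻ z, {w : E n × E n | dist w.2 w.1 ≤ t}.indicator (fun w => φ w.2) (z, y) ∂σ := fun y => by
    rw [← setLIntegral_const, ← lintegral_indicator Metric.isClosed_closedBall.measurableSet]
    refine lintegral_congr fun z => ?_
    simp only [indicator, Metric.mem_closedBall, mem_ofPred_eq, dist_comm z y]
  simp only [h1, h2]
  refine lintegral_lintegral_swap (Measurable.aemeasurable ?_)
  exact (hφ.comp measurable_snd).indicator hS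

/-- The Sobolev inequality on boundaries with uniform graph charts. -/
theorem sobolev_of_hasWeakGradient {d : ℕ} (hd : 0 < d) {r q : ℝ} (hr : 0 < r) (hq : 1 ≤ q)
    (hqd : q < d) :
    ∃ C : ℝ≥0, ∀ K : Set (E (d + 1)), IsSmoothBody K → HasUniformCharts K r →
      ∀ (f : E (d + 1) → ℝ) (g : E (d + 1) → E (d + 1)),
      MemLp f (ENNReal.ofReal q) (surfaceMeasure K) → HasWeakGradient K q f g →
      eLpNorm f (ENNReal.ofReal (d * q / (d - q))) (surfaceMeasure K) ≤
        C * (eLpNorm g (ENNReal.ofReal q) (surfaceMeasure K) +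
          eLpNorm f (ENNReal.ofReal q) (surfaceMeasure K)) := by
  have hq0 : 0 < q := by linarith
  have hd0 : (0 : ℝ) < d := by exact_mod_cast hd
  have hdq : 0 < (d : ℝ) - q := by linarith
  obtain ⟨C₀, hC₀⟩ := WeakGradientBound.sobolev hd (ρ := r / 4) (by positivity) hq hqd
  set Q := d * q / (d - q) with hQ
  have hQ0 : 0 < Q := by positivity
  have hqQ : q ≤ Q := by rw [hQ, le_div_iff₀ hdq]; nlinarith
  have hκ1 : 1 ≤ Q / q := by rwa [one_le_div hq0]
  have hω := unitBallVolume_pos d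
  -- A chart of radius r/4 gives the local Sobolev inequality on the parameter ball of radius r/16 =
  -- 2t, whose image covers the boundary within t.
  set t := r / 32 with ht
  set c₁ := (1 / 2) ^ d * unitBallVolume d * t ^ d with hc₁
  have hc₁0 : 0 < c₁ := by positivity
  set D : ℝ≥0∞ := 2 ^ d * volume (Metric.ball (0 : E d) r) with hD
  have hDt : D ≠ ⊤ := ENNReal.mul_ne_top (by simp) Metric.isBounded_ball.measure_lt_top.ne
  set A : ℝ≥0∞ := 2 ^ d * (3 * C₀) ^ Q with hA
  have hAt : A ≠ ⊤ := ENNReal.mul_ne_top (by simp)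
    (ENNReal.rpow_ne_top_of_nonneg hQ0.le (ENNReal.mul_ne_top (by simp) (by simp)))
  set C₁ : ℝ≥0∞ := (ENNReal.ofReal c₁)⁻¹ * (A * D) with hC₁
  have hC₁t : C₁ ≠ ⊤ := ENNReal.mul_ne_top
    (ENNReal.inv_ne_top.2 (ENNReal.ofReal_pos.2 hc₁0).ne') (ENNReal.mul_ne_top hAt hDt)
  have hC₁Q : C₁ ^ Q⁻¹ ≠ ⊤ := ENNReal.rpow_ne_top_of_nonneg (by positivity) hC₁t
  refine ⟨(C₁ ^ Q⁻¹).toNNReal, fun K hK hcharts f g hf hg => ?_⟩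
  have hfin := hK.isFiniteMeasure_surfaceMeasure
  set σ := surfaceMeasure K with hσ
  rw [ENNReal.coe_toNNReal hC₁Q]
  obtain ⟨f₁, hf₁, hff₁⟩ := hf.1
  have hf₁m : Measurable f₁ := hf₁.measurable
  obtain ⟨G, hG, hgG⟩ := hg.1.1.enorm
  have hf₁i : Integrable f₁ σ := (integrable_of_memLp_ofReal hq hf).congr hff₁
  set φ : E (d + 1) → ℝ≥0∞ := fun y => G y ^ q + ‖f₁ y‖ₑ ^ q with hφ
  have hφm : Measurable φ := (hG.pow_const q).add (hf₁m.enorm.pow_const q)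
  set M := ∫⁻ y, φ y ∂σ with hM
  set m : E (d + 1) → ℝ≥0∞ := fun z => ∫⁻ y in Metric.closedBall z (r / 2), φ y ∂σ with hm
  have hmM : ∀ z, m z ≤ M := fun z => setLIntegral_le_lintegral _ _
  have hψm : Measurable fun y => ‖f₁ y‖ₑ ^ Q := hf₁m.enorm.pow_const Q
  have hlocal : ∀ z ∈ frontier K, ∫⁻ y in Metric.closedBall z t, ‖f₁ y‖ₑ ^ Q ∂σ ≤
      A * (M ^ (Q / q - 1) * m z) := by
    intro z hz
    obtain ⟨e, J, p, Φ, h₀⟩ := hcharts z hz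
    have hr4 : 0 < r / 4 := by positivity
    have h := h₀.mono (t := r / 4) (by linarith)
    have h1 := hC₀ _ _ (h.integrable_chartFun hf₁i) (h.measurable_chartFun hf₁m)
      (h.measurable_chartGrad hG) (h.weakGradientBound hg hff₁ hgG)
    have e4 : 2 * (r / 4) = r / 2 := by ring
    have h2 : ∫⁻ u, chartGrad (r / 4) Φ G u ^ q ≤ 2 ^ q * m z := by
      refine (h.lintegral_chartGrad_le hr4 hG hq0).trans ?_
      rw [e4]
      refine mul_le_mul_right (lintegral_mono fun y => ?_) _
      exact le_self_add
    have h3 : ∫⁻ u, ‖chartFun (r / 4) Φ f₁ u‖ₑ ^ q ≤ m z := by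
      refine (h.lintegral_chartFun_le hr4 hf₁m hq0).trans ?_
      rw [e4]
      exact lintegral_mono fun y => le_add_self
    have h4 : eLpNorm (chartFun (r / 4) Φ f₁) (ENNReal.ofReal Q)
        (volume.restrict (Metric.ball 0 (r / 4 / 4))) ≤ 3 * C₀ * m z ^ q⁻¹ := by
      refine h1.trans ?_
      have h5 : (∫⁻ u, chartGrad (r / 4) Φ G u ^ q) ^ q⁻¹ ≤ 2 * m z ^ q⁻¹ := by
        calc _ ≤ (2 ^ q * m z) ^ q⁻¹ := by gcongr
          _ = _ := by
            rw [ENNReal.mul_rpow_of_nonneg _ _ (by positivity), ENNReal.rpow_rpow_inv hq0.ne']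
      have h6 : (∫⁻ u, ‖chartFun (r / 4) Φ f₁ u‖ₑ ^ q) ^ q⁻¹ ≤ m z ^ q⁻¹ := by gcongr
      calc _ ≤ (C₀ : ℝ≥0∞) * (2 * m z ^ q⁻¹ + m z ^ q⁻¹) := by gcongr
        _ = _ := by ring
    calc ∫⁻ y in Metric.closedBall z t, ‖f₁ y‖ₑ ^ Q ∂σ
        ≤ 2 ^ d * ∫⁻ u in Metric.ball 0 (2 * t), ‖f₁ (Φ u)‖ₑ ^ Q :=
          h.setLIntegral_closedBall_le (by positivity) (by rw [ht]; linarith) hψm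
      _ = 2 ^ d * eLpNorm (chartFun (r / 4) Φ f₁) (ENNReal.ofReal Q)
          (volume.restrict (Metric.ball 0 (r / 4 / 4))) ^ Q := by
          rw [eLpNorm_ofReal_rpow hQ0]
          have e5 : 2 * t = r / 4 / 4 := by rw [ht]; ring
          rw [e5]
          congr 1
          refine setLIntegral_congr_fun Metric.isOpen_ball.measurableSet fun u hu => ?_
          have hu' : u ∈ Metric.ball (0 : E d) (r / 4) :=
            Metric.ball_subset_ball (by linarith) hu
          simp only [chartFun, indicator_of_mem hu']
      _ ≤ 2 ^ d * (3 * C₀ * m z ^ q⁻¹) ^ Q := by gcongr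
      _ = A * (m z ^ (Q / q - 1) * m z) := by
          have e6 : m z ^ (Q / q - 1) * m z = m z ^ (Q / q) := by
            conv_lhs => rw [← ENNReal.rpow_one (m z), ← ENNReal.rpow_mul, one_mul]
            rw [← ENNReal.rpow_add_of_nonneg _ _ (by linarith) zero_le_one, sub_add_cancel]
          rw [e6, ENNReal.mul_rpow_of_nonneg _ _ hQ0.le, ← ENNReal.rpow_mul, inv_mul_eq_div, hA,
            mul_assoc]
      -- Since Q ≥ q, all but one power of the local mass is bounded by the total mass; the
      -- remaining linear term can be integrated over z.
      _ ≤ A * (M ^ (Q / q - 1) * m z) := by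
          gcongr
          exact hmM z
  have hlow : ENNReal.ofReal c₁ * ∫⁻ y, ‖f₁ y‖ₑ ^ Q ∂σ ≤
      ∫⁻ z, ∫⁻ y in Metric.closedBall z t, ‖f₁ y‖ₑ ^ Q ∂σ ∂σ := by
    rw [lintegral_setLIntegral_closedBall t hψm, mul_comm, ← lintegral_mul_const _ hψm]
    refine lintegral_mono_ae ((ae_mem_frontier K).mono fun y hy => ?_)
    exact mul_le_mul_right (hcharts.lowerDensity y hy t (by positivity) (by rw [ht]; linarith)) _
  have hup : ∫⁻ z, m z ∂σ ≤ D * M := by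
    rw [hm, lintegral_setLIntegral_closedBall (r / 2) hφm, mul_comm, hM,
      ← lintegral_mul_const _ hφm]
    refine lintegral_mono_ae ((ae_mem_frontier K).mono fun y hy => ?_)
    obtain ⟨e, J, p, Φ, h⟩ := hcharts y hy
    have := h.surfaceMeasure_closedBall_le (t := r / 2) (by positivity) (by linarith)
    rw [mul_div_cancel₀ r two_ne_zero] at this
    exact mul_le_mul_right this _
  have hφf : M ≤ eLpNorm g (ENNReal.ofReal q) σ ^ q + eLpNorm f (ENNReal.ofReal q) σ ^ q := by
    rw [hM, lintegral_add_left (hG.pow_const q), eLpNorm_ofReal_rpow hq0, eLpNorm_ofReal_rpow hq0]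
    refine add_le_add (le_of_eq ?_) (le_of_eq ?_)
    · exact lintegral_congr_ae (hgG.mono fun y hy => by simp only [← hy])
    · exact lintegral_congr_ae (hff₁.mono fun y hy => by simp only [← hy])
  have hMt : M ≠ ⊤ := ne_top_of_le_ne_top (ENNReal.add_ne_top.2
    ⟨ENNReal.rpow_ne_top_of_nonneg hq0.le hg.1.2.ne,
      ENNReal.rpow_ne_top_of_nonneg hq0.le hf.2.ne⟩) hφf
  have hMQ : M ^ (Q / q - 1) * M = M ^ (Q / q) := by
    conv_lhs => rw [← ENNReal.rpow_one M, ← ENNReal.rpow_mul, one_mul]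
    rw [← ENNReal.rpow_add_of_nonneg _ _ (by linarith) zero_le_one, sub_add_cancel]
  have hmain : ∫⁻ y, ‖f₁ y‖ₑ ^ Q ∂σ ≤ C₁ * M ^ (Q / q) := by
    have h1 : ENNReal.ofReal c₁ * ∫⁻ y, ‖f₁ y‖ₑ ^ Q ∂σ ≤ A * D * M ^ (Q / q) := by
      refine hlow.trans ((lintegral_mono_ae ((ae_mem_frontier K).mono hlocal)).trans ?_)
      rw [lintegral_const_mul' _ _ hAt, lintegral_const_mul' _ _
        (ENNReal.rpow_ne_top_of_nonneg (by linarith) hMt), ← hMQ]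
      calc _ ≤ A * (M ^ (Q / q - 1) * (D * M)) := by gcongr
        _ = _ := by ring
    rw [hC₁, mul_assoc]
    exact (ENNReal.mul_le_iff_le_inv (ENNReal.ofReal_pos.2 hc₁0).ne' ENNReal.ofReal_ne_top).1 h1
  rw [eLpNorm_congr_ae hff₁, eLpNorm_ofReal_eq hQ0]
  calc (∫⁻ y, ‖f₁ y‖ₑ ^ Q ∂σ) ^ Q⁻¹ ≤ (C₁ * M ^ (Q / q)) ^ Q⁻¹ := by gcongr
    _ = C₁ ^ Q⁻¹ * M ^ q⁻¹ := by
        rw [ENNReal.mul_rpow_of_nonneg _ _ (by positivity), ← ENNReal.rpow_mul]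
        congr 2
        field_simp
    _ ≤ C₁ ^ Q⁻¹ * ((eLpNorm g (ENNReal.ofReal q) σ ^ q) ^ q⁻¹ +
        (eLpNorm f (ENNReal.ofReal q) σ ^ q) ^ q⁻¹) := by
        gcongr
        exact (ENNReal.rpow_le_rpow hφf (by positivity)).trans
          (ENNReal.rpow_add_le_add_rpow _ _ (by positivity) (inv_le_one_of_one_le₀ hq))
    _ = _ := by
        rw [ENNReal.rpow_rpow_inv hq0.ne', ENNReal.rpow_rpow_inv hq0.ne']

end SobolevOnBoundary

/-! ### Convex bodies: equality of the two energies -/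

section Convex

variable {K : Set (E (d + 1))}

/-- A convex body lies on the inner side of its tangent hyperplanes. -/
theorem IsSmoothBody.inner_outerUnitNormal_nonpos (hK : IsSmoothBody K) (hconv : Convex ℝ K)
    {x y : E (d + 1)} (hx : x ∈ K) (hy : y ∈ frontier K) : ⟪x - y, outerUnitNormal K y⟫ ≤ 0 := by
  obtain ⟨φ, h⟩ := hK.2.2 y hy
  have hyK : y ∈ K := hK.1.isClosed.frontier_subset hy
  rw [h.isOuterUnitNormal, real_inner_smul_right]
  refine mul_nonpos_of_nonneg_of_nonpos (by positivity) ?_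
  by_contra! hpos
  obtain ⟨hφ, h0, -, hloc⟩ := h
  have hg : ∇ (fun z => -φ z) y = -∇ φ y := by simp [gradient, fderiv_fun_neg]
  have hneg : ⟪∇ (fun z => -φ z) y, x - y⟫ < 0 := by
    rw [hg, inner_neg_left, real_inner_comm]; linarith
  have t1 := eventually_neg_of_inner_neg (φ := fun z => -φ z) hφ.neg (by simp [h0]) hneg
  have hc : Tendsto (fun t : ℝ => y + t • (x - y)) (𝓝[>] 0) (𝓝 y) := by
    have : Continuous (fun t : ℝ => y + t • (x - y)) := by fun_prop
    have h0 := this.tendsto 0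
    simp only [zero_smul, add_zero] at h0
    exact h0.mono_left nhdsWithin_le_nhds
  have t2 : ∀ᶠ t : ℝ in 𝓝[>] 0, t ∈ Ioo (0 : ℝ) 1 := Ioo_mem_nhdsGT one_pos
  obtain ⟨t, a1, a2, a3⟩ := (t1.and ((hc.eventually hloc).and t2)).exists
  have hmem : y + t • (x - y) ∈ K := hconv.add_smul_sub_mem hyK hx ⟨a3.1.le, a3.2.le⟩
  linarith [a2.1 hmem]

/-- Near x the numerator is quadratic, so the kernel is O(|x - y|^(1-d-s)), integrable in dimension
d because s < 1; away from x it is bounded. Integrability rules out the default value 0 of the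
Bochner integral. -/
theorem IsSmoothBody.integrable_curvatureKernel (hK : IsSmoothBody K) (hd : 1 ≤ d) {s : ℝ}
    (hs0 : 0 < s) (hs1 : s < 1) {x : E (d + 1)} (hx : x ∈ frontier K) :
    Integrable (curvatureKernel K s x) (surfaceMeasure K) := by
  have hfin := hK.isFiniteMeasure_surfaceMeasure
  have hd1 : (1 : ℝ) ≤ d := by exact_mod_cast hd
  obtain ⟨R₁, hR₁, hchart⟩ := hK.exists_isGraphChart_small
  obtain ⟨L, R₂, hL, hR₂, hquad⟩ := hK.uniform_quadratic
  obtain ⟨e, J, p, Φ, h₀⟩ := hchart x hx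
  have hkm := hK.measurable_curvatureKernel s x
  set r := min R₁ (R₂ / 2) with hr
  have hr0 : 0 < r := by positivity
  have h := h₀.mono (t := r) (min_le_left _ _)
  have hrR : r ≤ R₂ / 2 := min_le_right _ _
  rw [← integrableOn_univ, ← union_compl_self (Metric.closedBall x (r / 2))]
  refine IntegrableOn.union ⟨hkm.aestronglyMeasurable, ?_⟩ ?_
  · rw [hasFiniteIntegral_iff_enorm]
    refine (h.setLIntegral_closedBall_le (by positivity) (by linarith) hkm.enorm).trans_lt ?_
    rw [mul_div_cancel₀ r two_ne_zero]
    have hint : IntegrableOn (fun u => curvatureKernel K s x (Φ u)) (Metric.ball 0 r) := by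
      refine integrableOn_ball_of_norm_le_rpow (C := L) (α := (d : ℝ) - 1 + s) (by simpa using hd)
        (by rw [finrank_euclideanSpace, Fintype.card_fin]; linarith) ?_
        (hkm.comp h.measurable).aestronglyMeasurable
      filter_upwards [ae_restrict_mem Metric.isOpen_ball.measurableSet] with u hu
      rcases eq_or_ne u 0 with rfl | hu0
      · rw [h.map_zero, curvatureKernel, sub_self, inner_zero_left, zero_div, norm_zero]
        positivity
      have hu1 : 0 < ‖u‖ := norm_pos_iff.2 hu0
      have hN1 : ‖u‖ ≤ ‖x - Φ u‖ := by
        have := h.frame.norm_proj_le (Φ u - x)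
        rwa [h.proj u hu, norm_sub_rev] at this
      have hN0 : 0 < ‖x - Φ u‖ := hu1.trans_le hN1
      have hN2 : ‖x - Φ u‖ < R₂ := by
        have := h.dist_le 0 (Metric.mem_ball_self hr0) u hu
        rw [h.map_zero, dist_zero_left, dist_eq_norm] at this
        rw [Metric.mem_ball, dist_zero_right] at hu
        linarith
      have hq := (hquad x hx (Φ u) (h.param.2.2.2.1 hu) hN2).2
      rw [curvatureKernel, norm_div, Real.norm_eq_abs, Real.norm_of_nonneg (by positivity)]
      calc _ ≤ L * ‖x - Φ u‖ ^ 2 / ‖x - Φ u‖ ^ ((d : ℝ) + 1 + s) := by gcongr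
        _ = L * ‖x - Φ u‖ ^ (-((d : ℝ) - 1 + s)) := by
          rw [mul_div_assoc, ← Real.rpow_ofNat, ← Real.rpow_sub hN0]
          congr 2; ring
        _ ≤ L * ‖u‖ ^ (-((d : ℝ) - 1 + s)) := by
          gcongr L * ?_
          exact Real.rpow_le_rpow_of_nonpos hu1 hN1 (by linarith)
    exact ENNReal.mul_lt_top (by simp) hint.2
  · refine Measure.integrableOn_of_bounded (M := (r / 2) ^ (-((d : ℝ) + s))) (measure_ne_top _ _)
      hkm.aestronglyMeasurable ?_
    filter_upwards [ae_restrict_of_ae (ae_mem_frontier K),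
      ae_restrict_mem Metric.isClosed_closedBall.measurableSet.compl] with y hy hyx
    have hN : r / 2 < ‖x - y‖ := by
      rw [mem_compl_iff, Metric.mem_closedBall, not_le, dist_comm, dist_eq_norm] at hyx
      exact hyx
    have hN0 : 0 < ‖x - y‖ := by linarith
    have hpow : 0 ≤ ‖x - y‖ ^ ((d : ℝ) + 1 + s) := by positivity
    rw [curvatureKernel, norm_div, Real.norm_of_nonneg hpow]
    calc _ ≤ ‖x - y‖ / ‖x - y‖ ^ ((d : ℝ) + 1 + s) := by
          gcongr
          refine (norm_inner_le_norm _ _).trans ?_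
          rw [hK.norm_outerUnitNormal hy, mul_one]
      _ = ‖x - y‖ ^ (-((d : ℝ) + s)) := by
          nth_rewrite 1 [← Real.rpow_one ‖x - y‖]
          rw [← Real.rpow_sub hN0]
          congr 1; ring
      _ ≤ _ := Real.rpow_le_rpow_of_nonpos (by positivity) hN.le (by linarith)

/-- For convex bodies the fractional Willmore energy is the nonlocal bending energy. -/
theorem IsSmoothBody.willmoreEnergy_eq_bendingEnergy (hK : IsSmoothBody K) (hconv : Convex ℝ K)
    (hd : 1 ≤ d) {c s : ℝ} (hs0 : 0 < s) (hs1 : s < 1) (p : ℝ) :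
    willmoreEnergy c s p K = bendingEnergy c s p K := by
  refine lintegral_congr_ae ((ae_mem_frontier K).mono fun x hx => ?_)
  have hint := hK.integrable_curvatureKernel hd hs0 hs1 hx
  -- Convexity excludes cancellation, so the modulus of the integral is the integral of the modulus.
  have hsign : ∀ᵐ y ∂(surfaceMeasure K), 0 ≤ -curvatureKernel K s x y := by
    refine (ae_mem_frontier K).mono fun y hy => ?_
    rw [curvatureKernel, ← neg_div]
    have := hK.inner_outerUnitNormal_nonpos hconv (hK.1.isClosed.frontier_subset hx) hy
    exact div_nonneg (by linarith) (by positivity)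
  have h1 : ‖∫ y, curvatureKernel K s x y ∂(surfaceMeasure K)‖ₑ =
      ∫⁻ y, ‖curvatureKernel K s x y‖ₑ ∂(surfaceMeasure K) := by
    rw [← enorm_neg, ← integral_neg, Real.enorm_of_nonneg (integral_nonneg_of_ae hsign),
      ofReal_integral_eq_lintegral_ofReal hint.fun_neg hsign]
    refine lintegral_congr_ae (hsign.mono fun y hy => ?_)
    simp only
    rw [← enorm_neg, Real.enorm_of_nonneg hy]
  simp only [fracMeanCurvature, fracAbsCurvature]
  rw [enorm_mul, h1]

theorem exists_hasUniformCharts {c s p Λ : ℝ} (hd : 1 ≤ d) (hc : c ≠ 0) (hs0 : 0 < s) (hs1 : s < 1)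
    (hp : (d : ℝ) / s < p) (hΛ : 0 < Λ) :
    ∃ r : ℝ, 0 < r ∧ ∀ K : Set (E (d + 1)), IsSmoothBody K →
      ((Convex ℝ K ∧ willmoreEnergy c s p K ≤ ENNReal.ofReal Λ) ∨
        bendingEnergy c s p K ≤ ENNReal.ofReal Λ) → HasUniformCharts K r := by
  have hp0 : 0 < p := (by positivity : 0 ≤ (d : ℝ) / s).trans_lt hp
  obtain ⟨r, hr, h⟩ := exists_uniform_isGraphChart d hc hs0 hs1 hp hp0 hΛ
  refine ⟨r, hr, fun K hK hE => h K hK ?_⟩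
  rcases hE with ⟨hconv, hW⟩ | hB
  · rwa [← hK.willmoreEnergy_eq_bendingEnergy hconv hd hs0 hs1 p]
  · exact hB

end Convex

/-! ### Both embeddings under uniform charts, and the theorem -/

section Main

/-- Passes to the infimum over weak gradients. Dividing by the constant needs it non-zero, since the
infimum may be ∞. -/
theorem le_mul_gradientSeminorm_add {K : Set (E (d + 1))} {q : ℝ} {f : E (d + 1) → ℝ}
    {X T : ℝ≥0∞} {C : ℝ≥0} (hC : C ≠ 0)
    (h : ∀ g, HasWeakGradient K q f g →
      X ≤ C * (eLpNorm g (ENNReal.ofReal q) (surfaceMeasure K) + T)) :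
    X ≤ C * (gradientSeminorm K q f + T) := by
  rw [mul_comm, ← ENNReal.div_le_iff_le_mul (Or.inl (by simpa using hC)) (Or.inl (by simp)),
    ← tsub_le_iff_right, gradientSeminorm]
  refine le_iInf₂ fun g hg => ?_
  rw [tsub_le_iff_right, ENNReal.div_le_iff_le_mul (Or.inl (by simpa using hC)) (Or.inl (by simp)),
    mul_comm]
  exact h g hg

theorem exists_hasWeakGradient {K : Set (E (d + 1))} {q : ℝ} {f : E (d + 1) → ℝ}
    (h : gradientSeminorm K q f < ⊤) : ∃ g, HasWeakGradient K q f g := by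
  by_contra! hne
  simp [gradientSeminorm, hne] at h

/-- The Sobolev embedding below the critical exponent. -/
theorem sobolev_embedding {α q r : ℝ} (hd : 1 ≤ d) (hα0 : 0 < α) (hq : 1 < q) (hr : 0 < r)
    (hqd : q < (d : ℝ) / α) :
    ∃ C : ℝ≥0, ∀ K : Set (E (d + 1)), IsSmoothBody K → HasUniformCharts K r →
      ∀ f : E (d + 1) → ℝ, MemSobolev K α q f →
        eLpNorm f (ENNReal.ofReal ((d : ℝ) * q / ((d : ℝ) - α * q))) (surfaceMeasure K) ≤
          C * sobolevNorm K α q f := by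
  have hω := unitBallVolume_pos d
  rcases eq_or_ne α 1 with rfl | hα
  · rw [div_one] at hqd
    obtain ⟨C, hC⟩ := sobolev_of_hasWeakGradient (d := d) hd hr hq.le hqd
    refine ⟨C + 1, fun K hK hcharts f hf => ?_⟩
    rw [sobolevNorm, sobolevSeminorm, if_pos rfl, one_mul]
    refine le_mul_gradientSeminorm_add (by positivity) fun g hg => ?_
    refine (hC K hK hcharts f g hf.1 hg).trans ?_
    gcongr
    exact le_self_add
  · obtain ⟨C, hC⟩ := fractional_sobolev (n := d + 1) (d := d) (c := (1 / 2) ^ d * unitBallVolume d)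
      hd (by positivity) hr hα0 hq.le (by rw [lt_div_iff₀ hα0] at hqd; linarith)
    refine ⟨C, fun K hK hcharts f hf => ?_⟩
    have := hK.isFiniteMeasure_surfaceMeasure
    rw [sobolevNorm, sobolevSeminorm, if_neg hα]
    exact hC (surfaceMeasure K) (frontier K) hcharts.lowerDensity (ae_mem_frontier K) f hf.1.1

/-- The Hölder embedding above the critical exponent. -/
theorem holder_embedding {α q r β : ℝ} (hα0 : 0 < α) (hq : 1 < q) (hr : 0 < r) (hβ : 0 < β)
    (hαβ : α - (d : ℝ) / q = β) :
    ∃ C : ℝ≥0, ∀ K : Set (E (d + 1)), IsSmoothBody K → HasUniformCharts K r →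
      ∀ f : E (d + 1) → ℝ, MemSobolev K α q f →
        ∃ f' : E (d + 1) → ℝ, f' =ᵐ[surfaceMeasure K] f ∧ ContinuousOn f' (frontier K) ∧
          eLpNorm f' ⊤ (surfaceMeasure K) + holderSeminorm K β f' ≤ C * sobolevNorm K α q f := by
  have hω := unitBallVolume_pos d
  have hdens : ∀ K : Set (E (d + 1)), HasUniformCharts K r →
      LowerDensity (surfaceMeasure K) (frontier K) d ((1 / 2) ^ d * unitBallVolume d) (r / 4) :=
    fun K hcharts x hx t ht0 ht => hcharts.lowerDensity x hx t ht0 (by linarith)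
  rcases eq_or_ne α 1 with rfl | hα
  · obtain ⟨C, hC0, hC⟩ := exists_holder_representative (d := d)
      (c := (1 / 2) ^ d * unitBallVolume d) (r₀ := r / 4) (β := β) (q := q)
      (A := 2 ^ d * 2 ^ d * (4 ^ q * (2 ^ d * (2 ^ d * unitBallVolume d)) * 2 ^ q))
      (by positivity) (by positivity) hβ hq.le (by positivity)
    refine ⟨C, fun K hK hcharts f hf => ?_⟩
    obtain ⟨hfq, hfs⟩ := hf
    rw [sobolevSeminorm, if_pos rfl] at hfs
    have hosc : ∀ g, HasWeakGradient K q f g → OscillationBound (surfaceMeasure K) (frontier K)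
        (2 * d + β * q) q (2 ^ d * 2 ^ d * (4 ^ q * (2 ^ d * (2 ^ d * unitBallVolume d)) * 2 ^ q))
        (eLpNorm g (ENNReal.ofReal q) (surfaceMeasure K)).toReal (r / 4) f := fun g hg => by
      rw [← hαβ]
      exact oscillationBound_of_hasWeakGradient hK hr hcharts hq.le hfq hg
    obtain ⟨g₀, hg₀⟩ := exists_hasWeakGradient hfs
    obtain ⟨f', hff', hcont, hbound⟩ := hC K hK.isFiniteMeasure_surfaceMeasure (hdens K hcharts) f
      hfq ⟨_, hg₀.1.2.ne, hosc g₀ hg₀⟩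
    refine ⟨f', hff', hcont, ?_⟩
    rw [sobolevNorm, sobolevSeminorm, if_pos rfl]
    exact le_mul_gradientSeminorm_add hC0.ne' fun g hg => hbound _ hg.1.2.ne (hosc g hg)
  · obtain ⟨C, -, hC⟩ := exists_holder_representative (d := d)
      (c := (1 / 2) ^ d * unitBallVolume d) (r₀ := r / 4) (β := β) (q := q)
      (A := 2 ^ ((d : ℝ) + α * q)) (by positivity) (by positivity) hβ hq.le (by positivity)
    refine ⟨C, fun K hK hcharts f hf => ?_⟩
    obtain ⟨hfq, hfs⟩ := hf
    rw [sobolevSeminorm, if_neg hα] at hfs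
    have hosc := oscillationBound_of_gagliardo hα0 hq.le hfs.ne (r / 4)
    rw [hαβ] at hosc
    obtain ⟨f', hff', hcont, hbound⟩ := hC K hK.isFiniteMeasure_surfaceMeasure (hdens K hcharts) f
      hfq ⟨_, hfs.ne, hosc⟩
    refine ⟨f', hff', hcont, ?_⟩
    rw [sobolevNorm, sobolevSeminorm, if_neg hα]
    exact hbound _ hfs.ne hosc

end Main

end FracWillmore

end

open FracWillmore in
theorem mainTheorem4 (d : ℕ) (hd : 1 ≤ d) (c s p Λ α q : ℝ) (hc : c ≠ 0)
    (hs0 : 0 < s) (hs1 : s < 1) (hp : (d : ℝ) / s < p) (hΛ : 0 < Λ)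
    (hα0 : 0 < α) (hα1 : α ≤ 1) (hq : 1 < q) :
    ∃ C : ℝ≥0, ∀ K : Set (E (d + 1)), IsSmoothBody K →
      ((Convex ℝ K ∧ willmoreEnergy c s p K ≤ ENNReal.ofReal Λ) ∨
        bendingEnergy c s p K ≤ ENNReal.ofReal Λ) →
      ∀ f : E (d + 1) → ℝ, MemSobolev K α q f →
        (q < (d : ℝ) / α →
          eLpNorm f (ENNReal.ofReal ((d : ℝ) * q / ((d : ℝ) - α * q))) (surfaceMeasure K) ≤
            C * sobolevNorm K α q f) ∧
        (∀ β : ℝ, 0 < β → β < α → α - (d : ℝ) / q = β →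
          ∃ f' : E (d + 1) → ℝ, f' =ᵐ[surfaceMeasure K] f ∧ ContinuousOn f' (frontier K) ∧
            eLpNorm f' ⊤ (surfaceMeasure K) + holderSeminorm K β f' ≤
              C * sobolevNorm K α q f) := by
  obtain ⟨r, hr, hcharts⟩ := exists_hasUniformCharts hd hc hs0 hs1 hp hΛ
  -- At most one of the two claims is non-vacuous for given parameters. In the borderline case q =
  -- d/α neither is, and the constant 0 serves.
  rcases lt_or_ge q ((d : ℝ) / α) with hqd | hqd
  · obtain ⟨C, hC⟩ := sobolev_embedding hd hα0 hq hr hqd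
    refine ⟨C, fun K hK hE f hf => ⟨fun _ => hC K hK (hcharts K hK hE) f hf, fun β hβ _ hαβ => ?_⟩⟩
    rw [lt_div_iff₀ hα0, mul_comm, ← lt_div_iff₀ (by linarith)] at hqd
    linarith
  · rcases le_or_gt (α - (d : ℝ) / q) 0 with hβ | hβ
    · exact ⟨0, fun K _ _ f _ => ⟨fun h => absurd h hqd.not_gt, fun β h _ h' => by linarith⟩⟩
    · obtain ⟨C, hC⟩ := holder_embedding (d := d) hα0 hq hr hβ rfl
      refine ⟨C, fun K hK hE f hf => ⟨fun h => absurd h hqd.not_gt, fun β _ _ hαβ => ?_⟩⟩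
      rw [← hαβ]
      exact hC K hK (hcharts K hK hE) f hf
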